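/- Fix a dimension $d$. A periodic framework is given by a finite directed multigraph $G$ with $n$ vertices, $m$ edges and colors $\gamma_{ij}\in\mathbb{Z}^d$ on its edges (the colored quotient graph), together with $\mathbf p\in(\mathbb{R}^d)^n$ and $\mathbf L\in\mathbb{R}^{d\times d}$. It describes the periodic graph $\tilde G$ with vertices $(i,g)$, $i\in V(G)$, $g\in\mathbb{Z}^d$, and edges joining $(i,g)$ to $(j,g+\gamma_{ij})$, placed by $\tilde{\mathbf p}(i,g)=\mathbf p_i+\mathbf L g$. For a finite index subgroup $\Lambda\le\mathbb{Z}^d$, a $\Lambda$-periodic infinitesimal motion is a pair $(\mathbf v,\mathbf M)$ with $\mathbf v:V(\tilde G)\to\mathbb{R}^d$ and $\mathbf M\in\mathbb{R}^{d\times d}$ such that $\mathbf v(i,g+\lambda)=\mathbf v(i,g)+\mathbf M\lambda$ for all $\lambda\in\Lambda$, and $\langle\tilde{\mathbf p}(y)-\tilde{\mathbf p}(x),\mathbf v(y)-\mathbf v(x)\rangle=0$ for every edge $xy$ of $\tilde G$. The framework is infinitesimally rigid if the space of $\mathbb{Z}^d$-periodic infinitesimal motions has dimension $\binom{d+1}{2}$,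 and infinitesimally ultrarigid if the space of $\Lambda$-periodic infinitesimal motions has dimension $\binom{d+1}{2}$ for every finite index subgroup $\Lambda\le\mathbb{Z}^d$. Put $D=\sum_{ij\in E(G)}\|\gamma_{ij}\|_1$. Theorem. For every $d$ there are an algorithm and constants $C,k$, all depending only on $d$, such that for every infinitesimally rigid periodic framework in dimension $d$ with rational $\mathbf p$ and $\mathbf L$, the algorithm, started on $n$, $m$, the colored graph $(G,\boldsymbol\gamma)$, $\mathbf p$ and $\mathbf L$, halts after at most $C(m+n+D+1)^k$ steps and correctly decides whether the framework is infinitesimally ultrarigid. In particular its running time is polynomial in $m$, $n$ and $D$. Here an algorithm is a program for a random access machine over the ordered field $\mathbb{Q}$, on which each arithmetic operation, comparison or (indirectly addressed) memory access of rational numbers has unit cost. -/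

import Mathlib

/-! ## Periodic frameworks, given by their colored quotient graphs -/

/-- A finite `ℤ^d`-colored (directed multi-)graph with vertex set `Fin n` and edge set `Fin m`.
It encodes the periodic graph with vertex set `Fin n × ℤ^d` in which, for every edge `e` and every
`g : ℤ^d`, the vertex `(tail e, g)` is joined to `(head e, g + color e)`; the group `ℤ^d` acts by
translating the second component. -/
structure ColoredGraph (d n m : ℕ) where
  tail : Fin m → Fin n
  head : Fin m → Fin n
  color : Fin m → (Fin d → ℤ)

namespace ColoredGraph

/-- `D`, the sum over all edges of the `ℓ¹`-norms of the colors. -/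
def totalColor {d n m : ℕ} (G : ColoredGraph d n m) : ℕ :=
  ∑ e, ∑ k, (G.color e k).natAbs

/-- The representation `ℤ^d → ℝ^d`, `g ↦ L g`, of the matrix `L`. -/
def latticeMap {d : ℕ} (L : Matrix (Fin d) (Fin d) ℝ) (g : Fin d → ℤ) : Fin d → ℝ :=
  L.mulVec (fun k => (g k : ℝ))

/-- The equivariant placement of all vertices of the periodic graph that is determined by the
positions `p` of the representatives `(i, 0)` and the lattice representation `L`. -/
def placement {d n : ℕ} (p : Fin n → Fin d → ℝ) (L : Matrix (Fin d) (Fin d) ℝ)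
    (x : Fin n × (Fin d → ℤ)) : Fin d → ℝ :=
  p x.1 + latticeMap L x.2

/-- The `Λ`-periodic infinitesimal motions of the framework `(G, p, L)`: velocities `v` of all the
vertices of the periodic graph together with a velocity `M` of the lattice representation, such
that `v` is `Λ`-equivariant with respect to `M`, and every edge of the periodic graph preserves its
length to first order. This is the tangent space at `(p, L)` (the kernel of the differential of the
squared length map) when the symmetry constraint is relaxed to `Λ`. -/
def motions {d n m : ℕ} (G : ColoredGraph d n m) (p : Fin n → Fin d → ℝ)
    (L : Matrix (Fin d) (Fin d) ℝ) (Λ : AddSubgroup (Fin d → ℤ)) :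
    Submodule ℝ ((Fin n × (Fin d → ℤ) → Fin d → ℝ) × Matrix (Fin d) (Fin d) ℝ) where
  carrier := {w |
    (∀ (i : Fin n) (g : Fin d → ℤ), ∀ l ∈ Λ, w.1 (i, g + l) = w.1 (i, g) + latticeMap w.2 l) ∧
    (∀ (e : Fin m) (g : Fin d → ℤ),
      dotProduct
        (placement p L (G.head e, g + G.color e) - placement p L (G.tail e, g))
        (w.1 (G.head e, g + G.color e) - w.1 (G.tail e, g)) = 0)}
  zero_mem' := by
    refine ⟨fun i g l _ => ?_, fun e g => ?_⟩
    · simp [latticeMap]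
    · simp
  add_mem' := by
    rintro a b ⟨ha, ha'⟩ ⟨hb, hb'⟩
    refine ⟨fun i g l hl => ?_, fun e g => ?_⟩
    · simp only [Prod.fst_add, Prod.snd_add, Pi.add_apply, ha i g l hl, hb i g l hl, latticeMap,
        Matrix.add_mulVec]
      abel
    · have h := congrArg₂ (· + ·) (ha' e g) (hb' e g)
      simp only [← dotProduct_add, add_zero] at h
      rw [← h]
      congr 1
      simp only [Prod.fst_add, Pi.add_apply]
      abel
  smul_mem' := by
    rintro c a ⟨ha, ha'⟩
    refine ⟨fun i g l hl => ?_, fun e g => ?_⟩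
    · simp only [Prod.smul_fst, Prod.smul_snd, Pi.smul_apply, ha i g l hl, latticeMap,
        Matrix.smul_mulVec, smul_add]
    · simp only [Prod.smul_fst, Pi.smul_apply, ← smul_sub, dotProduct_smul, ha' e g, smul_zero]

/-- Infinitesimal rigidity when the symmetry constraint is relaxed to `Λ`. -/
def IsInfRigidRel {d n m : ℕ} (G : ColoredGraph d n m) (p : Fin n → Fin d → ℝ)
    (L : Matrix (Fin d) (Fin d) ℝ) (Λ : AddSubgroup (Fin d → ℤ)) : Prop :=
  Module.finrank ℝ (G.motions p L Λ) = (d + 1).choose 2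

/-- Infinitesimal rigidity of the periodic framework `(G, p, L)`. -/
def IsInfRigid {d n m : ℕ} (G : ColoredGraph d n m) (p : Fin n → Fin d → ℝ)
    (L : Matrix (Fin d) (Fin d) ℝ) : Prop :=
  G.IsInfRigidRel p L ⊤

/-- Infinitesimal ultrarigidity: the framework is infinitesimally rigid and remains so when the
symmetry constraint is relaxed to any sublattice (finite index subgroup) of `ℤ^d`. -/
def IsInfUltrarigid {d n m : ℕ} (G : ColoredGraph d n m) (p : Fin n → Fin d → ℝ)
    (L : Matrix (Fin d) (Fin d) ℝ) : Prop :=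
  ∀ Λ : AddSubgroup (Fin d → ℤ), Λ.FiniteIndex → G.IsInfRigidRel p L Λ

end ColoredGraph

/-! ## Random access machines over the ordered field `ℚ` -/

namespace RatRAM

/-- The memory: scalar registers `r₀, r₁, …` and arrays `A₀, A₁, …`, all holding rational numbers.
A program, being finite, names only finitely many registers and arrays; the cells of an array are
accessed by indirect addressing. -/
structure Store where
  reg : ℕ → ℚ
  arr : ℕ → ℕ → ℚ

/-- The field operations. -/
inductive Op
  | plus
  | minus
  | times
  | divide

/-- The result of a field operation; division by zero is undefined. -/
def Op.eval : Op → ℚ → ℚ → Option ℚ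
  | .plus, a, b => some (a + b)
  | .minus, a, b => some (a - b)
  | .times, a, b => some (a * b)
  | .divide, a, b => if b = 0 then none else some (a / b)

/-- Comparisons between two registers. -/
inductive Test
  | eq (x y : ℕ)
  | lt (x y : ℕ)

def Test.eval : Test → Store → Bool
  | .eq x y, s => decide (s.reg x = s.reg y)
  | .lt x y, s => decide (s.reg x < s.reg y)

/-- Elementary instructions:
`const x q` is `r_x := q`; `op o x y z` is `r_x := r_y o r_z`;
`load x a y` is `r_x := A_a[r_y]`; `store a x y` is `A_a[r_x] := r_y`. -/
inductive Instr
  | const (x : ℕ) (q : ℚ)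
  | op (o : Op) (x y z : ℕ)
  | load (x a y : ℕ)
  | store (a x y : ℕ)

/-- A rational number is a valid address only if it is a natural number. -/
def address (q : ℚ) : Option ℕ :=
  if q.den = 1 ∧ 0 ≤ q.num then some q.num.toNat else none

def Store.setReg (s : Store) (x : ℕ) (q : ℚ) : Store :=
  { s with reg := Function.update s.reg x q }

def Store.setArr (s : Store) (a i : ℕ) (q : ℚ) : Store :=
  { s with arr := Function.update s.arr a (Function.update (s.arr a) i q) }

/-- The effect of an elementary instruction; `none` if it is undefined. -/
def Instr.exec : Instr → Store → Option Store
  | .const x q, s => some (s.setReg x q)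
  | .op o x y z, s => (o.eval (s.reg y) (s.reg z)).map (s.setReg x)
  | .load x a y, s => (address (s.reg y)).map fun i => s.setReg x (s.arr a i)
  | .store a x y, s => (address (s.reg x)).map fun i => s.setArr a i (s.reg y)

/-- Programs: instructions, composition, `if t then P else Q`, and `while t do P`. -/
inductive Prog
  | instr (c : Instr)
  | seq (P Q : Prog)
  | ite (t : Test) (P Q : Prog)
  | loop (t : Test) (P : Prog)

/-- A configuration: the stack of programs that remain to be run, and the memory. The machine has
halted when the stack is empty. -/
abbrev Config := List Prog × Store

/-- One step of the computation, of unit cost; `none` if the machine has halted, or is stuck at an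
undefined instruction. -/
def step : Config → Option Config
  | ([], _) => none
  | (.instr c :: K, s) => (c.exec s).map fun s' => (K, s')
  | (.seq P Q :: K, s) => some (P :: Q :: K, s)
  | (.ite t P Q :: K, s) => some (if t.eval s then P :: K else Q :: K, s)
  | (.loop t P :: K, s) => some (if t.eval s then P :: .loop t P :: K else K, s)

/-- The configuration after exactly `t` steps, if there is one. -/
def run : ℕ → Config → Option Config
  | 0, c => some c
  | t + 1, c => (step c).bind (run t)

/-- Started with memory `s`, the program `P` halts after exactly `t` steps with memory `s'`. -/
def HaltsIn (P : Prog) (s : Store) (t : ℕ) (s' : Store) : Prop :=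
  run t ([P], s) = some ([], s')

/-- A matrix written row by row into an array, followed by zeros. -/
def rowMajor {r c : ℕ} (f : Fin r → Fin c → ℚ) (a : ℕ) : ℚ :=
  if h : a < r * c then f (Fin.divNat ⟨a, h⟩) (Fin.modNat ⟨a, h⟩) else 0

/-- A vector written into an array, followed by zeros. -/
def vec {r : ℕ} (f : Fin r → ℚ) (a : ℕ) : ℚ :=
  if h : a < r then f ⟨a, h⟩ else 0

/-- The initial memory for a colored graph with a rational placement. The registers `r₀, r₁` hold
`n` and `m`; the arrays `A₀, …, A₄` hold the positions of the vertices, the matrix `L`, the tails,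
the heads and the colors of the edges; everything else is zero. -/
def input {d n m : ℕ} (G : ColoredGraph d n m) (p : Fin n → Fin d → ℚ)
    (L : Matrix (Fin d) (Fin d) ℚ) : Store where
  reg
    | 0 => n
    | 1 => m
    | _ => 0
  arr
    | 0 => rowMajor p
    | 1 => rowMajor (fun i j => L i j)
    | 2 => vec fun e => ((G.tail e : ℕ) : ℚ)
    | 3 => vec fun e => ((G.head e : ℕ) : ℚ)
    | 4 => rowMajor fun e k => (G.color e k : ℚ)
    | _ => fun _ => 0

end RatRAM

/-! ### Compiling a structured language with bounded loops to the machine -/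

namespace RatRAM

/-! ## Big-step execution with time bounds -/

/-! A subgroup of index `N` contains `N ℤ^d`. So a rigid framework is ultrarigid iff, for every `N`,
relaxing the symmetry to `N ℤ^d` creates no new motions (`isInfUltrarigid_iff`). Averaging over
`(ℤ/N)^d` splits a `ℤ^d`-periodic motion off any relaxed one and leaves a function on `(ℤ/N)^d` with
sum zero. By Fourier analysis, failure at `N` means that the rigidity matrix with monomial entries
`ω^γ` has a nonzero kernel at some `ω ≠ 1` with `ω^N = 1` (`periodicKernelTrivial_iff`); such a
torsion point is called degenerate.

The heart is a polynomial bound in `D` for the least order `N` of a degenerate `ω ≠ 1`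
(`exists_degenerateAt_le`). Write `ω = ζ^a` with `ζ` a primitive `N`-th root of unity. By Dirichlet
approximation there are `0 < u < N` and `b ≡ u a` modulo `N` with entries below `N / M`, where `M`
is about `N^(1/d)`. As the edge vectors are rational, Galois conjugates of `ω` are degenerate
(`Degenerate.galois`). Among them are the points `ω z^b` with `z = ζ^t` and `1 + t u` prime to `N`,
and there are at least `φ(N)` such `t < N`. Along the curve `z ↦ ω z^b` the minors are, up to
monomial factors, polynomials in `z` of degree at most `D N / M`. For `N` large against `D` this is
less than `φ(N)`, because `φ(N)` is at least a constant times `N^(1 - 1/(2d))`. Hence every point of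
the curve is degenerate (`degenerate_of_card`). The curve contains a nontrivial torsion point of
order less than `N` (`exists_degenerateAt_lt`), which contradicts minimality.

So it suffices to test all `N` up to a fixed polynomial in `D`, each by linear algebra in dimension
`N^d n d`. The program keeps the orthogonal projection onto the solutions of the equations imposed
so far and updates it by one rank-one correction per equation. This needs no pivoting, and at the
end the trace is zero iff only the zero solution is left. The program is written in a small language
of bounded loops, where correctness is a matter of invariants and the cost is polynomial in a common
bound for all ranges; `St.runs` transfers both to the machine. -/

theorem run_add (a b : ℕ) (c : Config) : run (a + b) c = (run a c).bind (run b) := by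
  induction a generalizing c with
  | zero => simp [run]
  | succ a ih =>
    rw [Nat.succ_add]
    simp only [run]
    cases step c with
    | none => rfl
    | some c' => simpa using ih c'

/-- `P`, run on top of any stack, terminates within `b` steps in a memory satisfying `Q`. -/
def Runs (P : Prog) (s : Store) (b : ℕ) (Q : Store → Prop) : Prop :=
  ∃ t s', t ≤ b ∧ (∀ K, run t (P :: K, s) = some (K, s')) ∧ Q s'

theorem Runs.mono {P : Prog} {s : Store} {b b' : ℕ} {Q Q' : Store → Prop}
    (h : Runs P s b Q) (hb : b ≤ b') (hQ : ∀ s', Q s' → Q' s') : Runs P s b' Q' := by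
  obtain ⟨t, s', ht, hr, hq⟩ := h
  exact ⟨t, s', ht.trans hb, hr, hQ _ hq⟩

theorem Runs.instr {c : Instr} {s s' : Store} {Q : Store → Prop} (h : c.exec s = some s')
    (hQ : Q s') : Runs (.instr c) s 1 Q :=
  ⟨1, s', le_rfl, fun K => by simp [run, step, h], hQ⟩

theorem Runs.const {x : ℕ} {q : ℚ} {s : Store} {Q : Store → Prop} (hQ : Q (s.setReg x q)) :
    Runs (.instr (.const x q)) s 1 Q :=
  Runs.instr rfl hQ

theorem Runs.plus {x y z : ℕ} {s : Store} {Q : Store → Prop}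
    (hQ : Q (s.setReg x (s.reg y + s.reg z))) : Runs (.instr (.op .plus x y z)) s 1 Q :=
  Runs.instr rfl hQ

theorem Runs.seq {P P' : Prog} {s : Store} {b b' : ℕ} {Q : Store → Prop}
    (h : Runs P s b fun s' => Runs P' s' b' Q) : Runs (.seq P P') s (1 + b + b') Q := by
  obtain ⟨t, s₁, ht, hr, t', s₂, ht', hr', hq⟩ := h
  refine ⟨1 + t + t', s₂, by omega, fun K => ?_, hq⟩
  rw [add_assoc, run_add]
  simp only [run, step, Option.bind_some]
  rw [run_add, hr]
  exact hr' K

theorem Runs.ite {P P' : Prog} {c : Test} {s : Store} {b : ℕ} {Q : Store → Prop}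
    (h : c.eval s = true → Runs P s b Q) (h' : c.eval s = false → Runs P' s b Q) :
    Runs (.ite c P P') s (1 + b) Q := by
  cases hc : c.eval s with
  | true =>
    obtain ⟨t, s₁, ht, hr, hq⟩ := h hc
    refine ⟨1 + t, s₁, by omega, fun K => ?_, hq⟩
    rw [run_add]
    simpa [run, step, hc] using hr K
  | false =>
    obtain ⟨t, s₁, ht, hr, hq⟩ := h' hc
    refine ⟨1 + t, s₁, by omega, fun K => ?_, hq⟩
    rw [run_add]
    simpa [run, step, hc] using hr K

/-- The number `n` of rounds is known in advance, and `I j` describes the memory before round `j`.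
Each test costs one step, including the last one, which fails. -/
theorem Runs.loop {P : Prog} {c : Test} {b : ℕ} (I : ℕ → Store → Prop) (n : ℕ)
    (hbody : ∀ j < n, ∀ s, I j s → c.eval s = true ∧ Runs P s b (I (j + 1)))
    (hend : ∀ s, I n s → c.eval s = false) {s : Store} (h0 : I 0 s) :
    Runs (.loop c P) s (n * (b + 1) + 1) (I n) := by
  suffices H : ∀ k j, j + k = n → ∀ s, I j s → Runs (.loop c P) s (k * (b + 1) + 1) (I n) from
    H n 0 (by simp) s h0
  intro k
  induction k with
  | zero =>
    intro j hj s hs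
    obtain rfl : j = n := by simpa using hj
    exact ⟨1, s, by simp, fun K => by simp [run, step, hend s hs], hs⟩
  | succ k ih =>
    intro j hj s hs
    obtain ⟨hc, t, s₁, ht, hr, hq⟩ := hbody j (by omega) s hs
    obtain ⟨t', s₂, ht', hr', hq'⟩ := ih (j + 1) (by omega) s₁ hq
    refine ⟨1 + t + t', s₂, by linarith, fun K => ?_, hq'⟩
    rw [add_assoc, run_add]
    simp only [run, step, Option.bind_some, hc, if_true]
    rw [run_add, hr]
    exact hr' K

theorem Runs.haltsIn {P : Prog} {s : Store} {b : ℕ} {Q : Store → Prop} (h : Runs P s b Q) :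
    ∃ t s', HaltsIn P s t s' ∧ t ≤ b ∧ Q s' := by
  obtain ⟨t, s', ht, hr, hq⟩ := h
  exact ⟨t, s', hr [], ht, hq⟩

/-! ## A structured language of terminating programs -/

/-- The memory of a structured program. -/
structure State where
  nat : ℕ → ℕ
  rat : ℕ → ℚ
  arr : ℕ → ℕ → ℚ

def State.setNat (σ : State) (x n : ℕ) : State := { σ with nat := Function.update σ.nat x n }

def State.setRat (σ : State) (x : ℕ) (q : ℚ) : State :=
  { σ with rat := Function.update σ.rat x q }

def State.setArr (σ : State) (a i : ℕ) (q : ℚ) : State :=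
  { σ with arr := Function.update σ.arr a (Function.update (σ.arr a) i q) }

/-- Expressions for natural numbers. -/
inductive NE
  | lit (k : ℕ)
  | var (x : ℕ)
  | add (a b : NE)
  | mul (a b : NE)

def NE.eval : NE → State → ℕ
  | .lit k, _ => k
  | .var x, σ => σ.nat x
  | .add a b, σ => a.eval σ + b.eval σ
  | .mul a b, σ => a.eval σ * b.eval σ

/-- The field operations, with `x / 0 = 0`. -/
def Op.total : Op → ℚ → ℚ → ℚ
  | .plus, a, b => a + b
  | .minus, a, b => a - b
  | .times, a, b => a * b
  | .divide, a, b => a / b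

/-- Expressions for rational numbers; `ifeq a b c e` is `c` if `a = b` and `e` otherwise, and
`sum x b f` is the sum of `f` over all `x < b`. -/
inductive QE
  | lit (q : ℚ)
  | var (x : ℕ)
  | nat (e : NE)
  | arr (a : ℕ) (e : NE)
  | op (o : Op) (a b : QE)
  | ifeq (a b c e : QE)
  | sum (x : ℕ) (b : NE) (f : QE)

def QE.eval : QE → State → ℚ
  | .lit q, _ => q
  | .var x, σ => σ.rat x
  | .nat e, σ => e.eval σ
  | .arr a e, σ => σ.arr a (e.eval σ)
  | .op o a b, σ => o.total (a.eval σ) (b.eval σ)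
  | .ifeq a b c e, σ => if a.eval σ = b.eval σ then c.eval σ else e.eval σ
  | .sum x b f, σ => ∑ j ∈ Finset.range (b.eval σ), f.eval (σ.setNat x j)

/-- All summation ranges that occur in the evaluation have at most `W` elements. -/
def QE.Bdd (W : ℕ) : QE → State → Prop
  | .lit _, _ => True
  | .var _, _ => True
  | .nat _, _ => True
  | .arr _ _, _ => True
  | .op _ a b, σ => a.Bdd W σ ∧ b.Bdd W σ
  | .ifeq a b c e, σ => a.Bdd W σ ∧ b.Bdd W σ ∧ c.Bdd W σ ∧ e.Bdd W σ
  | .sum x b f, σ => b.eval σ ≤ W ∧ ∀ j < b.eval σ, f.Bdd W (σ.setNat x j)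

/-- Statements: assignments to variables (`ceil` rounds up a rational number) and to array cells,
composition, and bounded loops. -/
inductive St
  | setN (x : ℕ) (e : NE)
  | ceil (x : ℕ) (e : QE)
  | setQ (x : ℕ) (e : QE)
  | put (a : ℕ) (i : NE) (e : QE)
  | seq (A B : St)
  | rep (x : ℕ) (b : NE) (A : St)

def St.sem : St → State → State
  | .setN x e, σ => σ.setNat x (e.eval σ)
  | .ceil x e, σ => σ.setNat x ⌈e.eval σ⌉₊
  | .setQ x e, σ => σ.setRat x (e.eval σ)
  | .put a i e, σ => σ.setArr a (i.eval σ) (e.eval σ)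
  | .seq A B, σ => B.sem (A.sem σ)
  | .rep x b A, σ => Nat.rec σ (fun j τ => A.sem (τ.setNat x j)) (b.eval σ)

/-- The memory after `j` rounds of a loop. -/
def St.iter (x : ℕ) (A : St) (σ : State) (j : ℕ) : State :=
  Nat.rec σ (fun j τ => A.sem (τ.setNat x j)) j

/-- All ranges and all rounded numbers that occur in the execution are at most `W`. -/
def St.Bdd (W : ℕ) : St → State → Prop
  | .setN _ _, _ => True
  | .ceil _ e, σ => e.Bdd W σ ∧ ⌈e.eval σ⌉₊ ≤ W
  | .setQ _ e, σ => e.Bdd W σ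
  | .put _ _ e, σ => e.Bdd W σ
  | .seq A B, σ => A.Bdd W σ ∧ B.Bdd W (A.sem σ)
  | .rep x b A, σ => b.eval σ ≤ W ∧ ∀ j < b.eval σ, A.Bdd W ((A.iter x σ j).setNat x j)

/-! ## Compilation -/

/-- The registers `3 x` and `3 x + 1` hold the variables, the registers `3 k + 2` are temporary. -/
structure Rep (s : Store) (σ : State) : Prop where
  rat : ∀ x, s.reg (3 * x) = σ.rat x
  nat : ∀ x, s.reg (3 * x + 1) = σ.nat x
  arr : s.arr = σ.arr

theorem setReg_reg (s : Store) (x : ℕ) (q : ℚ) (y : ℕ) :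
    (s.setReg x q).reg y = if y = x then q else s.reg y := by
  simp [Store.setReg, Function.update_apply]

theorem Rep.temp {s : Store} {σ : State} (h : Rep s σ) (k : ℕ) (q : ℚ) :
    Rep (s.setReg (3 * k + 2) q) σ where
  rat x := by rw [setReg_reg, if_neg (by omega), h.rat]
  nat x := by rw [setReg_reg, if_neg (by omega), h.nat]
  arr := h.arr

theorem Rep.setNat {s : Store} {σ : State} (h : Rep s σ) (x : ℕ) (n : ℕ) :
    Rep (s.setReg (3 * x + 1) n) (σ.setNat x n) where
  rat y := by rw [setReg_reg, if_neg (by omega), h.rat]; rfl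
  nat y := by
    rw [setReg_reg]; simp only [State.setNat, Function.update_apply]
    by_cases hy : y = x
    · simp [hy]
    · rw [if_neg (by omega), if_neg hy, h.nat]
  arr := h.arr

theorem Rep.setRat {s : Store} {σ : State} (h : Rep s σ) (x : ℕ) (q : ℚ) :
    Rep (s.setReg (3 * x) q) (σ.setRat x q) where
  nat y := by rw [setReg_reg, if_neg (by omega), h.nat]; rfl
  rat y := by
    rw [setReg_reg]; simp only [State.setRat, Function.update_apply]
    by_cases hy : y = x
    · simp [hy]
    · rw [if_neg (by omega), if_neg hy, h.rat]
  arr := h.arr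

theorem Rep.setArr {s : Store} {σ : State} (h : Rep s σ) (a i : ℕ) (q : ℚ) :
    Rep (s.setArr a i q) (σ.setArr a i q) where
  nat := h.nat
  rat := h.rat
  arr := by simp [Store.setArr, State.setArr, h.arr]

theorem State.setNat_setNat (σ : State) (x i j : ℕ) :
    (σ.setNat x i).setNat x j = σ.setNat x j := by
  simp [State.setNat]

theorem State.setNat_self (σ : State) (x : ℕ) : σ.setNat x (σ.nat x) = σ := by
  simp [State.setNat]

/-- `r_x := r_y`. -/
def move (x y z : ℕ) : Prog :=
  .seq (.instr (.const z 0)) (.instr (.op .plus x y z))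

theorem Runs.move {x y z : ℕ} (hyz : y ≠ z) {s : Store} {Q : Store → Prop}
    (hQ : Q ((s.setReg z 0).setReg x (s.reg y))) : Runs (move x y z) s 3 Q := by
  refine Runs.seq (Runs.const (Runs.plus ?_))
  simpa [setReg_reg, hyz] using hQ

def NE.code : NE → ℕ → Prog
  | .lit n, k => .instr (.const (3 * k + 2) n)
  | .var x, k => RatRAM.move (3 * k + 2) (3 * x + 1) (3 * k + 2)
  | .add a b, k =>
    .seq (a.code k) (.seq (b.code (k + 1))
      (.instr (.op .plus (3 * k + 2) (3 * k + 2) (3 * (k + 1) + 2))))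
  | .mul a b, k =>
    .seq (a.code k) (.seq (b.code (k + 1))
      (.instr (.op .times (3 * k + 2) (3 * k + 2) (3 * (k + 1) + 2))))

def NE.cost : NE → ℕ
  | .lit _ => 1
  | .var _ => 3
  | .add a b => a.cost + b.cost + 3
  | .mul a b => a.cost + b.cost + 3

/-- The outcome of evaluating an expression with value `v` at temporary level `k`. -/
structure Outcome (s : Store) (σ : State) (k : ℕ) (v : ℚ) (s' : Store) : Prop where
  rep : Rep s' σ
  val : s'.reg (3 * k + 2) = v
  low : ∀ j < k, s'.reg (3 * j + 2) = s.reg (3 * j + 2)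

/-- Code at level `k` overwrites only temporaries of level at least `k`. Hence a partial result at
level `k` survives the evaluation of the next operand at level `k + 1`. -/
theorem NE.runs (e : NE) (s : Store) (σ : State) (h : Rep s σ) (k : ℕ) :
    Runs (e.code k) s e.cost (Outcome s σ k (e.eval σ)) := by
  induction e generalizing s k with
  | lit n =>
    refine Runs.const ⟨h.temp k _, by simp [setReg_reg, NE.eval], fun j hj => ?_⟩
    rw [setReg_reg, if_neg (by omega)]
  | var x =>
    refine Runs.move (by omega) ⟨(h.temp k _).temp k _, ?_, fun j hj => ?_⟩
    · simp [setReg_reg, NE.eval, h.nat]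
    · rw [setReg_reg, setReg_reg, if_neg (by omega), if_neg (by omega)]
  | add a b iha ihb =>
    refine Runs.mono (Runs.seq (Runs.mono (iha s h k) le_rfl fun s₁ h₁ =>
      Runs.seq (Runs.mono (ihb s₁ h₁.rep (k + 1)) le_rfl fun s₂ h₂ => Runs.plus ?_)))
      (by simp only [NE.cost]; omega) fun _ h => h
    refine ⟨h₂.rep.temp k _, ?_, fun j hj => ?_⟩
    · rw [setReg_reg, if_pos rfl, h₂.val, h₂.low k (by omega), h₁.val]
      simp [NE.eval]
    · rw [setReg_reg, if_neg (by omega), h₂.low j (by omega), h₁.low j hj]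
  | mul a b iha ihb =>
    refine Runs.mono (Runs.seq (Runs.mono (iha s h k) le_rfl fun s₁ h₁ =>
      Runs.seq (Runs.mono (ihb s₁ h₁.rep (k + 1)) le_rfl fun s₂ h₂ => Runs.instr rfl ?_)))
      (by simp only [NE.cost]; omega) fun _ h => h
    refine ⟨h₂.rep.temp k _, ?_, fun j hj => ?_⟩
    · rw [setReg_reg, if_pos rfl, h₂.val, h₂.low k (by omega), h₁.val]
      simp [NE.eval]
    · rw [setReg_reg, if_neg (by omega), h₂.low j (by omega), h₁.low j hj]

/-- `r_x := r_x o r_y`, with `z` as temporary register. -/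
def Op.code (o : Op) (x y z : ℕ) : Prog :=
  .seq (.instr (.const z 0))
    (.ite (.eq y z)
      (match o with
        | .divide => .instr (.const x 0)
        | _ => .instr (.op o x x y))
      (.instr (.op o x x y)))

/-- The machine gets stuck on a division by zero, whereas the total operation returns `0`; the
preliminary test reconciles the two. -/
theorem Op.runs (o : Op) {x y z : ℕ} (hx : x ≠ z) (hy : y ≠ z) {s : Store} {Q : Store → Prop}
    (hQ : Q ((s.setReg z 0).setReg x (o.total (s.reg x) (s.reg y)))) :
    Runs (o.code x y z) s 4 Q := by
  unfold Op.code
  refine Runs.seq (b := 1) (b' := 2) (Runs.const (Runs.ite (b := 1) (fun hc => ?_) (fun hc => ?_)))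
  · have h0 : s.reg y = 0 := by simpa [Test.eval, setReg_reg, hy] using hc
    cases o <;> refine Runs.instr rfl ?_ <;>
      simpa [setReg_reg, hx, hy, Op.total, h0] using hQ
  · have h0 : s.reg y ≠ 0 := by simpa [Test.eval, setReg_reg, hy] using hc
    refine Runs.instr (s' := (s.setReg z 0).setReg x (o.total (s.reg x) (s.reg y))) ?_ hQ
    cases o <;> simp [Instr.exec, Op.eval, Op.total, setReg_reg, hx, hy, h0]

theorem address_natCast (n : ℕ) : address (n : ℚ) = some n := by
  simp [address]

/-- For a sum, level `k` accumulates, `k + 1` counts, `k + 2` holds the limit and `k + 3` the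
previous value of the bound variable, which is restored at the end. Levels from `k + 4` on are
scratch. -/
def QE.code : QE → ℕ → Prog
  | .lit q, k => .instr (.const (3 * k + 2) q)
  | .var x, k => RatRAM.move (3 * k + 2) (3 * x) (3 * k + 2)
  | .nat e, k => e.code k
  | .arr a e, k => .seq (e.code k) (.instr (.load (3 * k + 2) a (3 * k + 2)))
  | .op o a b, k =>
    .seq (a.code k) (.seq (b.code (k + 1))
      (o.code (3 * k + 2) (3 * (k + 1) + 2) (3 * (k + 2) + 2)))
  | .ifeq a b c e, k =>
    .seq (a.code k) (.seq (b.code (k + 1))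
      (.ite (.eq (3 * k + 2) (3 * (k + 1) + 2)) (c.code k) (e.code k)))
  | .sum x b f, k =>
    .seq (b.code (k + 2))
    (.seq (RatRAM.move (3 * (k + 3) + 2) (3 * x + 1) (3 * (k + 4) + 2))
    (.seq (.instr (.const (3 * k + 2) 0))
    (.seq (.instr (.const (3 * (k + 1) + 2) 0))
    (.seq (.loop (.lt (3 * (k + 1) + 2) (3 * (k + 2) + 2))
      (.seq (RatRAM.move (3 * x + 1) (3 * (k + 1) + 2) (3 * (k + 4) + 2))
      (.seq (f.code (k + 4))
      (.seq (.instr (.op .plus (3 * k + 2) (3 * k + 2) (3 * (k + 4) + 2)))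
      (.seq (.instr (.const (3 * (k + 4) + 2) 1))
        (.instr (.op .plus (3 * (k + 1) + 2) (3 * (k + 1) + 2) (3 * (k + 4) + 2))))))))
      (RatRAM.move (3 * x + 1) (3 * (k + 3) + 2) (3 * (k + 4) + 2))))))

def QE.cost : QE → ℕ → ℕ
  | .lit _, _ => 1
  | .var _, _ => 3
  | .nat e, _ => e.cost
  | .arr _ e, _ => e.cost + 2
  | .op _ a b, W => a.cost W + b.cost W + 6
  | .ifeq a b c e, W => a.cost W + b.cost W + c.cost W + e.cost W + 3
  | .sum _ b f, W => b.cost + W * (f.cost W + 11) + 14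

theorem QE.runs (W : ℕ) (e : QE) (s : Store) (σ : State) (h : Rep s σ) (hW : e.Bdd W σ) (k : ℕ) :
    Runs (e.code k) s (e.cost W) (Outcome s σ k (e.eval σ)) := by
  induction e generalizing s σ k with
  | lit n =>
    refine Runs.const ⟨h.temp k _, by simp [setReg_reg, QE.eval], fun j hj => ?_⟩
    rw [setReg_reg, if_neg (by omega)]
  | var x =>
    refine Runs.move (by omega) ⟨(h.temp k _).temp k _, ?_, fun j hj => ?_⟩
    · simp [setReg_reg, QE.eval, h.rat]
    · rw [setReg_reg, setReg_reg, if_neg (by omega), if_neg (by omega)]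
  | nat e => exact e.runs s σ h k
  | arr a e =>
    refine Runs.mono (Runs.seq (Runs.mono (e.runs s σ h k) le_rfl fun s₁ h₁ =>
      Runs.instr (s' := s₁.setReg (3 * k + 2) (s₁.arr a (e.eval σ))) ?_ ?_))
      (by simp only [QE.cost]; omega) fun _ h => h
    · simp [Instr.exec, h₁.val, address_natCast]
    · refine ⟨h₁.rep.temp k _, ?_, fun j hj => ?_⟩
      · simp [setReg_reg, QE.eval, h₁.rep.arr]
      · rw [setReg_reg, if_neg (by omega), h₁.low j hj]
  | op o a b iha ihb =>
    refine Runs.mono (Runs.seq (Runs.mono (iha s σ h hW.1 k) le_rfl fun s₁ h₁ =>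
      Runs.seq (Runs.mono (ihb s₁ σ h₁.rep hW.2 (k + 1)) le_rfl fun s₂ h₂ =>
        Op.runs o (by omega) (by omega) ?_))) (by simp only [QE.cost]; omega) fun _ h => h
    refine ⟨(h₂.rep.temp _ _).temp k _, ?_, fun j hj => ?_⟩
    · rw [setReg_reg, if_pos rfl, h₂.val, h₂.low k (by omega), h₁.val]
      simp [QE.eval]
    · rw [setReg_reg, setReg_reg, if_neg (by omega), if_neg (by omega), h₂.low j (by omega),
        h₁.low j hj]
  | ifeq a b c e iha ihb ihc ihe =>
    refine Runs.mono (Runs.seq (Runs.mono (iha s σ h hW.1 k) le_rfl fun s₁ h₁ =>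
      Runs.seq (Runs.mono (ihb s₁ σ h₁.rep hW.2.1 (k + 1)) le_rfl fun s₂ h₂ =>
        Runs.ite (b := c.cost W + e.cost W) (fun hc => ?_) (fun hc => ?_))))
      (by simp only [QE.cost]; omega) fun _ h => h
    · have hab : a.eval σ = b.eval σ := by
        simpa [Test.eval, h₂.val, h₂.low k (by omega), h₁.val] using hc
      refine Runs.mono (ihc s₂ σ h₂.rep hW.2.2.1 k) (by omega) fun s₃ h₃ => ⟨h₃.rep, ?_, ?_⟩
      · rw [h₃.val]; simp [QE.eval, hab]
      · intro j hj
        rw [h₃.low j hj, h₂.low j (by omega), h₁.low j hj]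
    · have hab : a.eval σ ≠ b.eval σ := by
        simpa [Test.eval, h₂.val, h₂.low k (by omega), h₁.val] using hc
      refine Runs.mono (ihe s₂ σ h₂.rep hW.2.2.2 k) (by omega) fun s₃ h₃ => ⟨h₃.rep, ?_, ?_⟩
      · rw [h₃.val]; simp [QE.eval, hab]
      · intro j hj
        rw [h₃.low j hj, h₂.low j (by omega), h₁.low j hj]
  | sum x b f ih =>
    obtain ⟨hb, hf⟩ := hW
    -- During the loop the memory represents `σ` only up to the bound variable, whose value is
    -- therefore left open.
    set I : ℕ → Store → Prop := fun j s' =>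
      (∃ i, Rep s' (σ.setNat x i)) ∧
      s'.reg (3 * k + 2) = ∑ i ∈ Finset.range j, f.eval (σ.setNat x i) ∧
      s'.reg (3 * (k + 1) + 2) = j ∧ s'.reg (3 * (k + 2) + 2) = b.eval σ ∧
      s'.reg (3 * (k + 3) + 2) = σ.nat x ∧ ∀ j < k, s'.reg (3 * j + 2) = s.reg (3 * j + 2) with hI
    refine Runs.mono (b := 1 + b.cost + (1 + 3 + (1 + 1 + (1 + 1 +
      (1 + (b.eval σ * ((1 + 3 + (1 + f.cost W + (1 + 1 + (1 + 1 + 1)))) + 1) + 1) + 3)))))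
      (Runs.seq (Runs.mono (b.runs s σ h (k + 2)) le_rfl fun s₁ h₁ =>
      Runs.seq (Runs.move (by omega) (Runs.seq (Runs.const (Runs.seq (Runs.const
      (Runs.seq (Runs.mono (Runs.loop I (b.eval σ) ?_ ?_ ?_) le_rfl fun s₂ h₂ =>
      Runs.move (by omega) ?_))))))))) ?_ fun _ h => h
    · rintro j hj s' ⟨⟨i, hr⟩, hacc, hcnt, hlim, hsav, hlow⟩
      refine ⟨by simpa [Test.eval, hcnt, hlim] using hj, ?_⟩
      have hr' := ((hr.temp (k + 4) 0).setNat x j)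
      rw [State.setNat_setNat] at hr'
      refine Runs.seq (Runs.move (by omega) (Runs.seq (Runs.mono
        (ih _ (σ.setNat x j) (by rw [hcnt]; exact hr') (hf j hj) (k + 4)) le_rfl fun s₃ h₃ =>
        Runs.seq (Runs.plus (Runs.seq (Runs.const (Runs.plus ⟨⟨j, ?_⟩, ?_, ?_, ?_, ?_, ?_⟩)))))))
      · exact ((h₃.rep.temp _ _).temp _ _).temp _ _
      · simp only [setReg_reg]
        rw [if_neg (by omega), if_neg (by omega), if_pos trivial, h₃.val, h₃.low k (by omega),
          Finset.sum_range_succ]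
        simp only [setReg_reg]
        rw [if_neg (by omega), if_neg (by omega), hacc]
      · simp only [setReg_reg]
        rw [if_pos trivial, if_neg (by omega), if_neg (by omega), if_pos trivial,
          h₃.low (k + 1) (by omega)]
        simp only [setReg_reg]
        rw [if_neg (by omega), if_neg (by omega), hcnt]
        push_cast; ring
      · simp only [setReg_reg]
        rw [if_neg (by omega), if_neg (by omega), if_neg (by omega), h₃.low (k + 2) (by omega)]
        simp only [setReg_reg]
        rw [if_neg (by omega), if_neg (by omega), hlim]
      · simp only [setReg_reg]
        rw [if_neg (by omega), if_neg (by omega), if_neg (by omega), h₃.low (k + 3) (by omega)]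
        simp only [setReg_reg]
        rw [if_neg (by omega), if_neg (by omega), hsav]
      · intro l hl
        simp only [setReg_reg]
        rw [if_neg (by omega), if_neg (by omega), if_neg (by omega), h₃.low l (by omega)]
        simp only [setReg_reg]
        rw [if_neg (by omega), if_neg (by omega), hlow l hl]
    · rintro s' ⟨-, -, hcnt, hlim, -⟩
      simp [Test.eval, hcnt, hlim]
    · refine ⟨⟨σ.nat x, ?_⟩, ?_, ?_, ?_, ?_, ?_⟩
      · rw [State.setNat_self]
        exact (((h₁.rep.temp _ _).temp _ _).temp _ _).temp _ _
      · simp only [setReg_reg]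
        rw [if_neg (by omega), if_pos trivial]; simp
      · simp [setReg_reg]
      · simp only [setReg_reg]
        rw [if_neg (by omega), if_neg (by omega), if_neg (by omega), if_neg (by omega), h₁.val]
      · simp only [setReg_reg]
        rw [if_neg (by omega), if_neg (by omega), if_pos trivial, h₁.rep.nat]
      · intro l hl
        simp only [setReg_reg]
        rw [if_neg (by omega), if_neg (by omega), if_neg (by omega), if_neg (by omega),
          h₁.low l (by omega)]
    · obtain ⟨⟨i, hr⟩, hacc, hcnt, hlim, hsav, hlow⟩ := h₂
      refine ⟨?_, ?_, ?_⟩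
      · have := (hr.temp (k + 4) 0).setNat x (σ.nat x)
        rw [State.setNat_setNat, State.setNat_self] at this
        rwa [hsav]
      · simp only [setReg_reg]
        rw [if_neg (by omega), if_neg (by omega), hacc]; rfl
      · intro l hl
        simp only [setReg_reg]
        rw [if_neg (by omega), if_neg (by omega), hlow l hl]
    · have := Nat.mul_le_mul_right (f.cost W + 11) hb
      simp only [QE.cost]
      have e : 1 + 3 + (1 + f.cost W + (1 + 1 + (1 + 1 + 1))) + 1 = f.cost W + 11 := by omega
      rw [e]; omega

/-- Rounding counts upward from `0`, so its cost is proportional to the result; this is why `St.Bdd`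
limits rounded numbers as well as ranges. The counter and the limit of a loop are temporaries below
the level of the body, out of its reach. -/
def St.code : St → ℕ → Prog
  | .setN x e, k => .seq (e.code k) (RatRAM.move (3 * x + 1) (3 * k + 2) (3 * (k + 1) + 2))
  | .setQ x e, k => .seq (e.code k) (RatRAM.move (3 * x) (3 * k + 2) (3 * (k + 1) + 2))
  | .ceil x e, k =>
    .seq (e.code k) (.seq (.instr (.const (3 * x + 1) 0))
      (.seq (.instr (.const (3 * (k + 1) + 2) 1))
        (.loop (.lt (3 * x + 1) (3 * k + 2))
          (.instr (.op .plus (3 * x + 1) (3 * x + 1) (3 * (k + 1) + 2))))))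
  | .put a i e, k =>
    .seq (i.code k) (.seq (e.code (k + 1)) (.instr (.store a (3 * k + 2) (3 * (k + 1) + 2))))
  | .seq A B, k => .seq (A.code k) (B.code k)
  | .rep x b A, k =>
    .seq (b.code k) (.seq (.instr (.const (3 * (k + 1) + 2) 0))
      (.loop (.lt (3 * (k + 1) + 2) (3 * k + 2))
        (.seq (RatRAM.move (3 * x + 1) (3 * (k + 1) + 2) (3 * (k + 2) + 2))
        (.seq (A.code (k + 2))
        (.seq (.instr (.const (3 * (k + 2) + 2) 1))
          (.instr (.op .plus (3 * (k + 1) + 2) (3 * (k + 1) + 2) (3 * (k + 2) + 2))))))))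

def St.cost : St → ℕ → ℕ
  | .setN _ e, _ => e.cost + 4
  | .setQ _ e, W => e.cost W + 4
  | .ceil _ e, W => e.cost W + W * 2 + 6
  | .put _ i e, W => i.cost + e.cost W + 3
  | .seq A B, W => A.cost W + B.cost W + 1
  | .rep _ b A, W => b.cost + W * (A.cost W + 10) + 4

theorem St.runs (W : ℕ) (A : St) (s : Store) (σ : State) (h : Rep s σ) (hW : A.Bdd W σ) (k : ℕ) :
    Runs (A.code k) s (A.cost W) fun s' =>
      Rep s' (A.sem σ) ∧ ∀ j < k, s'.reg (3 * j + 2) = s.reg (3 * j + 2) := by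
  induction A generalizing s σ k with
  | setN x e =>
    refine Runs.mono (Runs.seq (Runs.mono (e.runs s σ h k) le_rfl fun s₁ h₁ =>
      Runs.move (by omega) ?_)) (by simp only [St.cost]; omega) fun _ h => h
    rw [h₁.val]
    refine ⟨(h₁.rep.temp _ _).setNat x _, fun j hj => ?_⟩
    rw [setReg_reg, setReg_reg, if_neg (by omega), if_neg (by omega), h₁.low j hj]
  | setQ x e =>
    refine Runs.mono (Runs.seq (Runs.mono (e.runs W s σ h hW k) le_rfl fun s₁ h₁ =>
      Runs.move (by omega) ?_)) (by simp only [St.cost]; omega) fun _ h => h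
    rw [h₁.val]
    refine ⟨(h₁.rep.temp _ _).setRat x _, fun j hj => ?_⟩
    rw [setReg_reg, setReg_reg, if_neg (by omega), if_neg (by omega), h₁.low j hj]
  | put a i e =>
    refine Runs.mono (Runs.seq (Runs.mono (i.runs s σ h k) le_rfl fun s₁ h₁ =>
      Runs.seq (Runs.mono (e.runs W s₁ σ h₁.rep hW (k + 1)) le_rfl fun s₂ h₂ =>
      Runs.instr (s' := s₂.setArr a (i.eval σ) (e.eval σ)) ?_ ?_)))
      (by simp only [St.cost]; omega) fun _ h => h
    · simp [Instr.exec, h₂.val, h₂.low k (by omega), h₁.val, address_natCast]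
    · refine ⟨h₂.rep.setArr _ _ _, fun j hj => ?_⟩
      exact (h₂.low j (by omega)).trans (h₁.low j hj)
  | seq A B ihA ihB =>
    refine Runs.mono (Runs.seq (Runs.mono (ihA s σ h hW.1 k) le_rfl fun s₁ h₁ =>
      Runs.mono (ihB s₁ _ h₁.1 hW.2 k) le_rfl fun s₂ h₂ => ?_))
      (by simp only [St.cost]; omega) fun _ h => h
    exact ⟨h₂.1, fun j hj => (h₂.2 j hj).trans (h₁.2 j hj)⟩
  | ceil x e =>
    obtain ⟨he, hc⟩ := hW
    set I : ℕ → Store → Prop := fun j s' =>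
      Rep s' (σ.setNat x j) ∧ s'.reg (3 * k + 2) = e.eval σ ∧ s'.reg (3 * (k + 1) + 2) = 1 ∧
      ∀ j < k, s'.reg (3 * j + 2) = s.reg (3 * j + 2) with hI
    refine Runs.mono (b := 1 + e.cost W + (1 + 1 + (1 + 1 + (⌈e.eval σ⌉₊ * (1 + 1) + 1))))
      (Runs.seq (Runs.mono (e.runs W s σ h he k) le_rfl fun s₁ h₁ =>
      Runs.seq (Runs.const (Runs.seq (Runs.const
        (Runs.mono (Runs.loop I ⌈e.eval σ⌉₊ ?_ ?_ ?_) le_rfl fun s₂ h₂ => ?_)))))) ?_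
        fun _ h => h
    · rintro j hj s' ⟨hr, hlim, h1, hlow⟩
      have hx := hr.nat x
      simp only [State.setNat, Function.update_self] at hx
      refine ⟨by simpa [Test.eval, hx, hlim] using Nat.lt_ceil.1 hj, Runs.plus ⟨?_, ?_, ?_, ?_⟩⟩
      · have := hr.setNat x (j + 1)
        rw [State.setNat_setNat] at this
        rw [hx, h1]
        exact_mod_cast this
      · rw [setReg_reg, if_neg (by omega), hlim]
      · rw [setReg_reg, if_neg (by omega), h1]
      · intro l hl
        rw [setReg_reg, if_neg (by omega), hlow l hl]
    · rintro s' ⟨hr, hlim, h1, hlow⟩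
      have hx := hr.nat x
      simp only [State.setNat, Function.update_self] at hx
      simpa [Test.eval, hx, hlim] using Nat.le_ceil (e.eval σ)
    · refine ⟨?_, ?_, ?_, ?_⟩
      · exact_mod_cast (h₁.rep.setNat x 0).temp (k + 1) 1
      · rw [setReg_reg, setReg_reg, if_neg (by omega), if_neg (by omega), h₁.val]
      · rw [setReg_reg, if_pos rfl]
      · intro l hl
        rw [setReg_reg, setReg_reg, if_neg (by omega), if_neg (by omega), h₁.low l hl]
    · exact ⟨h₂.1, h₂.2.2.2⟩
    · simp only [St.cost]; omega
  | rep x b A ih =>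
    obtain ⟨hb, hA⟩ := hW
    set I : ℕ → Store → Prop := fun j s' =>
      Rep s' (A.iter x σ j) ∧ s'.reg (3 * (k + 1) + 2) = j ∧ s'.reg (3 * k + 2) = b.eval σ ∧
      ∀ j < k, s'.reg (3 * j + 2) = s.reg (3 * j + 2) with hI
    refine Runs.mono (b := 1 + b.cost + (1 + 1 +
      (b.eval σ * ((1 + 3 + (1 + A.cost W + (1 + 1 + 1))) + 1) + 1)))
      (Runs.seq (Runs.mono (b.runs s σ h k) le_rfl fun s₁ h₁ =>
      Runs.seq (Runs.const (Runs.mono (Runs.loop I (b.eval σ) ?_ ?_ ?_) le_rfl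
        fun s₂ h₂ => ?_)))) ?_ fun _ h => h
    · rintro j hj s' ⟨hr, hcnt, hlim, hlow⟩
      refine ⟨by simpa [Test.eval, hcnt, hlim] using hj, ?_⟩
      have hr' := ((hr.temp (k + 2) 0).setNat x j)
      refine Runs.seq (Runs.move (by omega) (Runs.seq (Runs.mono
        (ih _ ((A.iter x σ j).setNat x j) (by rw [hcnt]; exact hr') (hA j hj) (k + 2)) le_rfl
        fun s₃ h₃ => Runs.seq (Runs.const (Runs.plus ⟨?_, ?_, ?_, ?_⟩)))))
      · exact (h₃.1.temp _ _).temp _ _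
      · simp only [setReg_reg]
        rw [if_pos trivial, if_neg (by omega), if_pos trivial, h₃.2 (k + 1) (by omega)]
        simp only [setReg_reg]
        rw [if_neg (by omega), if_neg (by omega), hcnt]
        push_cast; ring
      · simp only [setReg_reg]
        rw [if_neg (by omega), if_neg (by omega), h₃.2 k (by omega)]
        simp only [setReg_reg]
        rw [if_neg (by omega), if_neg (by omega), hlim]
      · intro l hl
        simp only [setReg_reg]
        rw [if_neg (by omega), if_neg (by omega), h₃.2 l (by omega)]
        simp only [setReg_reg]
        rw [if_neg (by omega), if_neg (by omega), hlow l hl]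
    · rintro s' ⟨-, hcnt, hlim, -⟩
      simp [Test.eval, hcnt, hlim]
    · refine ⟨h₁.rep.temp _ _, ?_, ?_, ?_⟩
      · simp [setReg_reg]
      · rw [setReg_reg, if_neg (by omega), h₁.val]
      · intro l hl
        rw [setReg_reg, if_neg (by omega), h₁.low l hl]
    · exact ⟨h₂.1, h₂.2.2.2⟩
    · have := Nat.mul_le_mul_right (A.cost W + 10) hb
      simp only [St.cost]
      have e : 1 + 3 + (1 + A.cost W + (1 + 1 + 1)) + 1 ≤ A.cost W + 10 := by omega
      have := (Nat.mul_le_mul_left (b.eval σ) e).trans this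
      omega

/-! ## Polynomial bounds -/

/-- `f` is bounded by a polynomial. -/
def PolyBdd (f : ℕ → ℕ) : Prop := ∃ C k, ∀ W, f W ≤ C * (W + 1) ^ k

theorem PolyBdd.const (c : ℕ) : PolyBdd fun _ => c := ⟨c, 0, fun W => by simp⟩

theorem PolyBdd.id : PolyBdd fun W => W := ⟨1, 1, fun W => by simp⟩

theorem PolyBdd.mono {f g : ℕ → ℕ} (hg : PolyBdd g) (h : ∀ W, f W ≤ g W) : PolyBdd f := by
  obtain ⟨C, k, hC⟩ := hg
  exact ⟨C, k, fun W => (h W).trans (hC W)⟩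

theorem PolyBdd.add {f g : ℕ → ℕ} (hf : PolyBdd f) (hg : PolyBdd g) :
    PolyBdd fun W => f W + g W := by
  obtain ⟨C, k, hC⟩ := hf
  obtain ⟨C', k', hC'⟩ := hg
  refine ⟨C + C', k + k', fun W => ?_⟩
  have h1 : (W + 1) ^ k ≤ (W + 1) ^ (k + k') := Nat.pow_le_pow_right (by omega) (by omega)
  have h2 : (W + 1) ^ k' ≤ (W + 1) ^ (k + k') := Nat.pow_le_pow_right (by omega) (by omega)
  calc f W + g W ≤ C * (W + 1) ^ k + C' * (W + 1) ^ k' := add_le_add (hC W) (hC' W)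
    _ ≤ C * (W + 1) ^ (k + k') + C' * (W + 1) ^ (k + k') := by gcongr
    _ = _ := by ring

theorem PolyBdd.mul {f g : ℕ → ℕ} (hf : PolyBdd f) (hg : PolyBdd g) :
    PolyBdd fun W => f W * g W := by
  obtain ⟨C, k, hC⟩ := hf
  obtain ⟨C', k', hC'⟩ := hg
  refine ⟨C * C', k + k', fun W => ?_⟩
  calc f W * g W ≤ (C * (W + 1) ^ k) * (C' * (W + 1) ^ k') := Nat.mul_le_mul (hC W) (hC' W)
    _ = _ := by ring

theorem PolyBdd.pow {f : ℕ → ℕ} (hf : PolyBdd f) (k : ℕ) : PolyBdd fun W => f W ^ k := by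
  induction k with
  | zero => simpa using PolyBdd.const 1
  | succ k ih => simpa only [pow_succ] using ih.mul hf

theorem PolyBdd.comp {f g : ℕ → ℕ} (hf : PolyBdd f) (hg : PolyBdd g) :
    PolyBdd fun W => f (g W) := by
  obtain ⟨C, k, hC⟩ := hf
  exact ((PolyBdd.const C).mul ((hg.add (.const 1)).pow k)).mono fun W => hC (g W)

theorem QE.cost_polyBdd (e : QE) : PolyBdd e.cost := by
  induction e with
  | lit | var | nat | arr => exact PolyBdd.const _
  | op o a b iha ihb => exact (iha.add ihb).add (.const _)
  | ifeq a b c e iha ihb ihc ihe => exact (((iha.add ihb).add ihc).add ihe).add (.const _)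
  | sum x b f ih => exact ((PolyBdd.const _).add (PolyBdd.id.mul (ih.add (.const _)))).add (.const _)

/-- The depth of nesting is fixed by the program, and each loop costs at most one more factor `W`.
-/
theorem St.cost_polyBdd (A : St) : PolyBdd A.cost := by
  induction A with
  | setN x e => exact PolyBdd.const _
  | setQ x e => exact e.cost_polyBdd.add (.const _)
  | ceil x e => exact (e.cost_polyBdd.add (PolyBdd.id.mul (.const _))).add (.const _)
  | put a i e => exact ((PolyBdd.const _).add e.cost_polyBdd).add (.const _)
  | seq A B ihA ihB => exact (ihA.add ihB).add (.const _)
  | rep x b A ih =>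
    exact ((PolyBdd.const _).add (PolyBdd.id.mul (ih.add (.const _)))).add (.const _)

end RatRAM

namespace RatRAM

/-! ## Reasoning about structured programs -/

/-- The natural variables that a statement may change. -/
def St.wn : St → ℕ → Bool
  | .setN x _, y => y == x
  | .ceil x _, y => y == x
  | .setQ _ _, _ => false
  | .put _ _ _, _ => false
  | .seq A B, y => A.wn y || B.wn y
  | .rep x _ A, y => y == x || A.wn y

/-- The rational variables that a statement may change. -/
def St.wq : St → ℕ → Bool
  | .setN _ _, _ => false
  | .ceil _ _, _ => false
  | .setQ x _, y => y == x
  | .put _ _ _, _ => false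
  | .seq A B, y => A.wq y || B.wq y
  | .rep _ _ A, y => A.wq y

/-- The arrays that a statement may change. -/
def St.wa : St → ℕ → Bool
  | .setN _ _, _ => false
  | .ceil _ _, _ => false
  | .setQ _ _, _ => false
  | .put a _ _, y => y == a
  | .seq A B, y => A.wa y || B.wa y
  | .rep _ _ A, y => A.wa y

/-- `τ` agrees with `σ` except where `A` may write. -/
structure Frame (A : St) (σ τ : State) : Prop where
  nat : ∀ y, A.wn y = false → τ.nat y = σ.nat y
  rat : ∀ y, A.wq y = false → τ.rat y = σ.rat y
  arr : ∀ y, A.wa y = false → τ.arr y = σ.arr y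

theorem Frame.refl (A : St) (σ : State) : Frame A σ σ := ⟨fun _ _ => rfl, fun _ _ => rfl, fun _ _ => rfl⟩

@[simp] theorem State.setNat_nat (σ : State) (x n y : ℕ) :
    (σ.setNat x n).nat y = if y = x then n else σ.nat y := by
  simp [State.setNat, Function.update_apply]

@[simp] theorem State.setNat_rat (σ : State) (x n : ℕ) : (σ.setNat x n).rat = σ.rat := rfl

@[simp] theorem State.setNat_arr (σ : State) (x n : ℕ) : (σ.setNat x n).arr = σ.arr := rfl

@[simp] theorem State.setRat_nat (σ : State) (x : ℕ) (q : ℚ) : (σ.setRat x q).nat = σ.nat := rfl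

@[simp] theorem State.setRat_arr (σ : State) (x : ℕ) (q : ℚ) : (σ.setRat x q).arr = σ.arr := rfl

@[simp] theorem State.setRat_rat (σ : State) (x : ℕ) (q : ℚ) (y : ℕ) :
    (σ.setRat x q).rat y = if y = x then q else σ.rat y := by
  simp [State.setRat, Function.update_apply]

@[simp] theorem State.setArr_nat (σ : State) (a i : ℕ) (q : ℚ) : (σ.setArr a i q).nat = σ.nat := rfl

@[simp] theorem State.setArr_rat (σ : State) (a i : ℕ) (q : ℚ) : (σ.setArr a i q).rat = σ.rat := rfl

theorem State.setArr_arr (σ : State) (a i : ℕ) (q : ℚ) (b : ℕ) :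
    (σ.setArr a i q).arr b = if b = a then Function.update (σ.arr a) i q else σ.arr b := by
  simp [State.setArr, Function.update_apply]

theorem frame_iter {x : ℕ} {b : NE} {A : St} (h : ∀ σ, Frame A σ (A.sem σ)) (σ : State) (j : ℕ) :
    Frame (.rep x b A) σ (A.iter x σ j) := by
  induction j with
  | zero => exact Frame.refl _ _
  | succ j ih =>
    have h' := h ((A.iter x σ j).setNat x j)
    refine ⟨fun y hy => ?_, fun y hy => ?_, fun y hy => ?_⟩
    · have hy' := hy
      simp only [St.wn, Bool.or_eq_false_iff, beq_eq_false_iff_ne] at hy'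
      refine (h'.nat y hy'.2).trans ?_
      rw [State.setNat_nat, if_neg hy'.1, ih.nat y hy]
    · exact (h'.rat y hy).trans (ih.rat y hy)
    · exact (h'.arr y hy).trans (ih.arr y hy)

/-- The write sets are Boolean functions of the syntax. For a concrete program it is thus a matter
of `rfl` that a variable or an array is left alone. -/
theorem St.frame (A : St) (σ : State) : Frame A σ (A.sem σ) := by
  induction A generalizing σ with
  | setN x e | ceil x e =>
    refine ⟨fun y hy => ?_, fun y hy => rfl, fun y hy => rfl⟩
    simp only [St.wn, beq_eq_false_iff_ne] at hy
    simp [St.sem, hy]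
  | setQ x e =>
    refine ⟨fun y hy => rfl, fun y hy => ?_, fun y hy => rfl⟩
    simp only [St.wq, beq_eq_false_iff_ne] at hy
    simp [St.sem, hy]
  | put a i e =>
    refine ⟨fun y hy => rfl, fun y hy => rfl, fun y hy => ?_⟩
    simp only [St.wa, beq_eq_false_iff_ne] at hy
    simp [St.sem, hy, State.setArr_arr]
  | seq A B ihA ihB =>
    refine ⟨fun y hy => ?_, fun y hy => ?_, fun y hy => ?_⟩
    · simp only [St.wn, Bool.or_eq_false_iff] at hy
      exact ((ihB _).nat y hy.2).trans ((ihA σ).nat y hy.1)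
    · simp only [St.wq, Bool.or_eq_false_iff] at hy
      exact ((ihB _).rat y hy.2).trans ((ihA σ).rat y hy.1)
    · simp only [St.wa, Bool.or_eq_false_iff] at hy
      exact ((ihB _).arr y hy.2).trans ((ihA σ).arr y hy.1)
  | rep x b A ih => exact frame_iter ih σ _

/-- `A` respects the bound `W` when started in `σ`, and ends in a memory satisfying `Q`. -/
def St.Ok (W : ℕ) (A : St) (σ : State) (Q : State → Prop) : Prop := A.Bdd W σ ∧ Q (A.sem σ)

theorem St.Ok.mono {W : ℕ} {A : St} {σ : State} {Q Q' : State → Prop} (h : A.Ok W σ Q)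
    (hQ : ∀ τ, Frame A σ τ → Q τ → Q' τ) : A.Ok W σ Q' :=
  ⟨h.1, hQ _ (A.frame σ) h.2⟩

theorem St.ok_seq {W : ℕ} {A B : St} {σ : State} {Q : State → Prop} :
    (St.seq A B).Ok W σ Q ↔ A.Ok W σ fun τ => B.Ok W τ Q := by
  simp only [St.Ok, St.Bdd, St.sem, and_assoc]

theorem St.ok_setN {W x : ℕ} {e : NE} {σ : State} {Q : State → Prop} :
    (St.setN x e).Ok W σ Q ↔ Q (σ.setNat x (e.eval σ)) := by
  simp [St.Ok, St.Bdd, St.sem]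

theorem St.ok_setQ {W x : ℕ} {e : QE} {σ : State} {Q : State → Prop} :
    (St.setQ x e).Ok W σ Q ↔ e.Bdd W σ ∧ Q (σ.setRat x (e.eval σ)) := by
  simp [St.Ok, St.Bdd, St.sem]

theorem St.ok_put {W a : ℕ} {i : NE} {e : QE} {σ : State} {Q : State → Prop} :
    (St.put a i e).Ok W σ Q ↔ e.Bdd W σ ∧ Q (σ.setArr a (i.eval σ) (e.eval σ)) := by
  simp [St.Ok, St.Bdd, St.sem]

theorem St.Ok.ceil {W x : ℕ} {e : QE} {σ : State} {Q : State → Prop} (n : ℕ) (he : e.Bdd W σ)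
    (hn : ⌈e.eval σ⌉₊ = n) (hW : n ≤ W) (hQ : Q (σ.setNat x n)) : (St.ceil x e).Ok W σ Q :=
  ⟨⟨he, hn.trans_le hW⟩, by simpa [St.sem, hn] using hQ⟩

/-- The invariant has to mention only what the body changes; everything else is supplied by the
frame condition. -/
theorem St.Ok.rep {W x : ℕ} {b : NE} {A : St} {σ : State} {Q : State → Prop}
    (I : ℕ → State → Prop) (n : ℕ) (hn : b.eval σ = n) (hb : n ≤ W) (h0 : I 0 σ)
    (hs : ∀ j < n, ∀ τ, Frame (.rep x b A) σ τ → I j τ →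
      A.Ok W (τ.setNat x j) (I (j + 1)))
    (hQ : ∀ τ, Frame (.rep x b A) σ τ → I n τ → Q τ) :
    (St.rep x b A).Ok W σ Q := by
  subst hn
  have H : ∀ j ≤ b.eval σ, I j (A.iter x σ j) := by
    intro j
    induction j with
    | zero => exact fun _ => h0
    | succ j ih =>
      exact fun hj => (hs j hj _ (frame_iter A.frame σ j) (ih (by omega))).2
  exact ⟨⟨hb, fun j hj => (hs j hj _ (frame_iter A.frame σ j) (H j hj.le)).1⟩,
    hQ _ (frame_iter A.frame σ _) (H _ le_rfl)⟩

end RatRAM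

/-! ## Orthogonal projections by successive elimination -/

namespace Elim

open Matrix

variable {ι F : Type*} [Fintype ι] [Field F]

/-- Restrict an orthogonal projection to the hyperplane orthogonal to `a`. -/
def elimStep (a : ι → F) (P : Matrix ι ι F) : Matrix ι ι F :=
  Matrix.of fun r r' => P r r' - (P *ᵥ a) r * (P *ᵥ a) r' / (a ⬝ᵥ P *ᵥ a)

/-- `P` is the orthogonal projection onto the space of vectors satisfying `V`. -/
structure IsProjOn (P : Matrix ι ι F) (V : (ι → F) → Prop) : Prop where
  symm : Pᵀ = P
  idem : P * P = P
  fixed : ∀ x, P *ᵥ x = x ↔ V x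

theorem elimStep_eq (a : ι → F) (P : Matrix ι ι F) :
    elimStep a P = P - (a ⬝ᵥ P *ᵥ a)⁻¹ • vecMulVec (P *ᵥ a) (P *ᵥ a) := by
  ext r r'
  simp [elimStep, vecMulVec_apply]
  ring

/-- Subtracting the projection onto the line of `P a` leaves the projection onto the part of the
image of `P` orthogonal to `a`. Here `a ⬝ᵥ P *ᵥ a` is the square norm of `P a`. Over an ordered
field it vanishes only if `P a = 0`; then the new equation already holds on the image, and the
convention `x / 0 = 0` leaves `P` unchanged, as it should. -/
theorem IsProjOn.elimStep [LinearOrder F] [IsStrictOrderedRing F] {P : Matrix ι ι F}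
    {V : (ι → F) → Prop} (h : IsProjOn P V) (a : ι → F) :
    IsProjOn (elimStep a P) fun x => V x ∧ a ⬝ᵥ x = 0 := by
  have hdot : ∀ x, (P *ᵥ a) ⬝ᵥ x = a ⬝ᵥ P *ᵥ x := fun x => by
    conv_lhs => rw [← h.symm]
    rw [mulVec_transpose, dotProduct_mulVec]
  have hPb : P *ᵥ (P *ᵥ a) = P *ᵥ a := by rw [mulVec_mulVec, h.idem]
  have hbb : (P *ᵥ a) ⬝ᵥ (P *ᵥ a) = a ⬝ᵥ P *ᵥ a := by rw [hdot, hPb]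
  rw [elimStep_eq]
  by_cases hs : a ⬝ᵥ P *ᵥ a = 0
  · have hb : P *ᵥ a = 0 := by rwa [hs, dotProduct_self_eq_zero] at hbb
    rw [hs, _root_.inv_zero, zero_smul, sub_zero]
    refine ⟨h.symm, h.idem, fun x => ⟨fun hx => ⟨(h.fixed x).1 hx, ?_⟩, fun hx =>
      (h.fixed x).2 hx.1⟩⟩
    rw [← hx, ← hdot, hb, zero_dotProduct]
  · have hmul : ∀ x, (P - (a ⬝ᵥ P *ᵥ a)⁻¹ • vecMulVec (P *ᵥ a) (P *ᵥ a)) *ᵥ x =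
        P *ᵥ x - ((a ⬝ᵥ P *ᵥ a)⁻¹ * (a ⬝ᵥ P *ᵥ x)) • (P *ᵥ a) := fun x => by
      rw [sub_mulVec, smul_mulVec, vecMulVec_mulVec, hdot]
      ext r
      simp
      ring
    have hbv : vecMulVec (P *ᵥ a) (P *ᵥ a) * P = vecMulVec (P *ᵥ a) (P *ᵥ a) := by
      rw [vecMulVec_mul]
      congr 1
      rw [← mulVec_transpose, h.symm, hPb]
    have hvb : P * vecMulVec (P *ᵥ a) (P *ᵥ a) = vecMulVec (P *ᵥ a) (P *ᵥ a) := by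
      rw [mul_vecMulVec, hPb]
    have hvv : vecMulVec (P *ᵥ a) (P *ᵥ a) * vecMulVec (P *ᵥ a) (P *ᵥ a) =
        (a ⬝ᵥ P *ᵥ a) • vecMulVec (P *ᵥ a) (P *ᵥ a) := by
      rw [vecMulVec_mul_vecMulVec, hbb, vecMulVec_smul]
    refine ⟨?_, ?_, fun x => ⟨fun hx => ?_, fun hx => ?_⟩⟩
    · rw [transpose_sub, transpose_smul, h.symm, transpose_vecMulVec]
    · rw [sub_mul, mul_sub, mul_sub, h.idem, Matrix.mul_smul, hvb, Matrix.smul_mul, Matrix.smul_mul,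
        Matrix.mul_smul, hbv, hvv, inv_smul_smul₀ hs]
      abel
    -- The image of the corrected matrix lies in the image of `P`.
    · have hPx : P *ᵥ x = x := by
        conv_lhs => rw [← hx]
        rw [hmul, mulVec_sub, mulVec_smul, hPb, mulVec_mulVec, h.idem, ← hmul, hx]
      refine ⟨(h.fixed x).1 hPx, ?_⟩
      rw [hmul, hPx, sub_eq_self] at hx
      have h2 := congrArg (a ⬝ᵥ ·) hx
      simp only [dotProduct_smul, dotProduct_zero, smul_eq_mul] at h2
      field_simp at h2
      exact h2
    · rw [hmul, (h.fixed x).2 hx.1, hx.2]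
      simp

/-- For a symmetric idempotent `P`, the trace is the sum of the squares of all entries, so it
vanishes only for `P = 0`. -/
theorem IsProjOn.trace_eq_zero_iff [LinearOrder F] [IsStrictOrderedRing F] {P : Matrix ι ι F}
    {V : (ι → F) → Prop} (h : IsProjOn P V) : P.trace = 0 ↔ ∀ x, V x → x = 0 := by
  constructor
  · intro ht
    have hP : P = 0 := by
      have h1 : ∑ r, ∑ r', P r r' * P r r' = 0 := by
        rw [← ht, Matrix.trace]
        refine Finset.sum_congr rfl fun r _ => ?_
        conv_rhs => rw [← h.idem]
        rw [diag_apply, mul_apply]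
        refine Finset.sum_congr rfl fun r' _ => ?_
        rw [show P r r' = P r' r from congrFun (congrFun h.symm r') r]
      ext r r'
      have h2 := (Finset.sum_eq_zero_iff_of_nonneg
        (fun r _ => Finset.sum_nonneg fun r' _ => mul_self_nonneg _)).1 h1 r (Finset.mem_univ _)
      rw [Finset.sum_eq_zero_iff_of_nonneg (fun r' _ => mul_self_nonneg _)] at h2
      simpa using h2 r' (Finset.mem_univ _)
    intro x hx
    rw [← (h.fixed x).2 hx, hP, zero_mulVec]
  · intro hV
    have hP : P = 0 := by
      classical
      ext r r'
      have := hV (P *ᵥ Pi.single r' 1) ((h.fixed _).1 (by rw [mulVec_mulVec, h.idem]))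
      simpa using congrFun this r
    simp [hP]

/-- The program computes over `ℚ` while motions are real; elimination commutes with the inclusion.
-/
theorem map_elimStep {F' : Type*} [Field F'] (f : F →+* F') (a : ι → F) (P : Matrix ι ι F) :
    (elimStep a P).map f = elimStep (f ∘ a) (P.map f) := by
  have h : f ∘ (P *ᵥ a) = P.map f *ᵥ (f ∘ a) := funext fun r => RingHom.map_mulVec f P a r
  ext r r'
  simp [elimStep, RingHom.map_mulVec, RingHom.map_dotProduct, h]

end Elim

/-! ### The elimination program and its invariants -/

namespace RatRAM

theorem Frame.trans {A : St} {σ τ υ : State} (h : Frame A σ τ) (h' : Frame A τ υ) :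
    Frame A σ υ :=
  ⟨fun y hy => (h'.nat y hy).trans (h.nat y hy), fun y hy => (h'.rat y hy).trans (h.rat y hy),
    fun y hy => (h'.arr y hy).trans (h.arr y hy)⟩

theorem Frame.rep {A : St} {x : ℕ} {b : NE} {σ τ : State} (h : Frame A σ τ) :
    Frame (.rep x b A) σ τ := by
  refine ⟨fun y hy => h.nat y ?_, fun y hy => h.rat y hy, fun y hy => h.arr y hy⟩
  simp only [St.wn, Bool.or_eq_false_iff] at hy
  exact hy.2

theorem Frame.setNat {A : St} {x : ℕ} {b : NE} {σ τ : State} (h : Frame (.rep x b A) σ τ) (j : ℕ) :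
    Frame (.rep x b A) σ (τ.setNat x j) := by
  refine ⟨fun y hy => ?_, h.rat, h.arr⟩
  rw [← h.nat y hy]
  simp only [St.wn, Bool.or_eq_false_iff, beq_eq_false_iff_ne] at hy
  simp [hy.1]

/-- With `q = r / H`, the number `(r + 1) / H - 1` lies in `(q - 1, q]`. Integer division is thereby
available from rounding up alone. -/
theorem ceil_div (r H : ℕ) (hH : 0 < H) : ⌈(((r : ℕ) : ℚ) + 1) / H - 1⌉₊ = r / H := by
  have hH' : (0 : ℚ) < H := by exact_mod_cast hH
  apply le_antisymm
  · rw [Nat.ceil_le, sub_le_iff_le_add, div_le_iff₀ hH']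
    have : r < (r / H + 1) * H := by
      have := Nat.lt_mul_div_succ r hH
      rwa [mul_comm] at this
    exact_mod_cast this
  · rcases Nat.eq_zero_or_pos (r / H) with h | h
    · omega
    · obtain ⟨q, hq⟩ := Nat.exists_eq_succ_of_ne_zero h.ne'
      rw [hq, Nat.succ_le_iff, Nat.lt_ceil, lt_sub_iff_add_lt, lt_div_iff₀ hH']
      have := Nat.div_mul_le_self r H
      rw [hq] at this
      exact_mod_cast Nat.lt_succ_of_le this

/-! ## The program -/

/-- An expression for `(a + 1) / b - 1`, which rounds up to the integral part of `a / b`. -/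
def divE (a b : NE) : QE :=
  .op .minus (.op .divide (.nat (.add a (.lit 1))) (.nat b)) (.lit 1)

theorem divE_eval (a b : NE) (σ : State) (h : 0 < b.eval σ) :
    ⌈(divE a b).eval σ⌉₊ = a.eval σ / b.eval σ := by
  rw [← ceil_div _ _ h]
  simp [divE, QE.eval, NE.eval, Op.total]

theorem divE_bdd (W : ℕ) (a b : NE) (σ : State) : (divE a b).Bdd W σ := by
  simp [divE, QE.Bdd]

/-- Add the color of edge `9` to the group element with code in variable `10`; the code of the sum
is put into variable `13`. -/
def shift (d : ℕ) : St :=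
  .seq (.setN 16 (.lit 1)) (.seq (.setN 17 (.var 10)) (.seq (.setN 13 (.lit 0))
  (.rep 18 (.lit d)
    (.seq (.ceil 19 (divE (.var 17) (.var 5)))
    (.seq (.ceil 20 (.op .plus (.op .minus (.nat (.var 17)) (.nat (.mul (.var 5) (.var 19))))
      (.op .plus (.arr 4 (.add (.mul (.var 9) (.lit d)) (.var 18)))
        (.nat (.mul (.var 2) (.var 5))))))
    (.seq (.ceil 21 (divE (.var 20) (.var 5)))
    (.seq (.ceil 22 (.op .minus (.nat (.var 20)) (.nat (.mul (.var 5) (.var 21)))))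
    (.seq (.setN 13 (.add (.var 13) (.mul (.var 16) (.var 22))))
    (.seq (.setN 16 (.mul (.var 16) (.var 5)))
      (.setN 17 (.var 19)))))))))))

/-- The code of the sum of `g` and the group element with code `c`. -/
def shiftCode (d N : ℕ) (g : ℕ → ℤ) (c : ℕ) : ℕ :=
  ∑ l ∈ Finset.range d, N ^ l * (((c / N ^ l % N : ℕ) + g l) % (N : ℤ)).toNat

theorem shift_ok {W d N D c : ℕ} {g : ℕ → ℤ} {σ : State} (hN : σ.nat 5 = N) (hN0 : 0 < N)
    (hD : σ.nat 2 = D) (hc : σ.nat 10 = c)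
    (hg : ∀ l < d, σ.arr 4 (σ.nat 9 * d + l) = g l) (hgD : ∀ l < d, |g l| ≤ D)
    (hdW : d ≤ W) (hcW : c ≤ W) (hNW : N + D + D * N ≤ W) :
    (shift d).Ok W σ fun τ => τ.nat 13 = shiftCode d N g c := by
  simp only [shift, St.ok_seq, St.ok_setN, NE.eval]
  refine St.Ok.rep (fun l τ => τ.nat 16 = N ^ l ∧ τ.nat 17 = c / N ^ l ∧
    τ.nat 13 = shiftCode l N g c) d rfl hdW (by simp [shiftCode, hc]) ?_ fun τ _ h => h.2.2
  rintro l hl τ hF ⟨hw, hy, hc'⟩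
  have h5 := hF.nat 5 rfl
  have h2 := hF.nat 2 rfl
  have h9 := hF.nat 9 rfl
  have h4 := hF.arr 4 rfl
  simp [hN, hD] at h5 h2 h9 h4
  set y := c / N ^ l with hy_def
  have hyW : y ≤ W := (Nat.div_le_self _ _).trans hcW
  obtain ⟨hg1, hg2⟩ := abs_le.1 (hgD l hl)
  -- The summand `D * N` does not change the residue modulo `N` and makes the digit sum nonnegative,
  -- as `|g l| ≤ D`. It is also the source of the bound `hNW`.
  have hz0 : 0 ≤ ((y % N : ℕ) : ℤ) + g l + D * N := by
    have : (D : ℤ) ≤ D * N := by exact_mod_cast Nat.le_mul_of_pos_right D hN0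
    omega
  obtain ⟨z, hz⟩ := Int.eq_ofNat_of_zero_le hz0
  have hmodN := Nat.mod_lt y hN0
  have hzW : z ≤ W := by
    have : ((y % N : ℕ) : ℤ) < N := by exact_mod_cast hmodN
    have h3 : (N : ℤ) + D + D * N ≤ W := by exact_mod_cast hNW
    omega
  have hdm := Nat.div_add_mod y N
  have hdm' := Nat.div_add_mod z N
  rw [St.ok_seq]
  refine St.Ok.ceil (y / N) (divE_bdd _ _ _ _) (by rw [divE_eval] <;> simp [NE.eval, h5, hy, hN0])
    ((Nat.div_le_self _ _).trans hyW) ?_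
  rw [St.ok_seq]
  refine St.Ok.ceil z (by simp [QE.Bdd]) ?_ hzW ?_
  · have : ((y : ℚ) - N * (y / N : ℕ) + (g l + D * N)) = (z : ℕ) := by
      have h1 : (y : ℚ) = N * (y / N : ℕ) + (y % N : ℕ) := by exact_mod_cast hdm.symm
      have h2 : ((y % N : ℕ) : ℚ) + g l + D * N = z := by
        have := congrArg (Int.cast : ℤ → ℚ) hz
        push_cast at this ⊢
        exact this
      linarith
    simp [QE.eval, NE.eval, Op.total, h5, hy, h9, h4, h2, hg l hl, this]
  rw [St.ok_seq]
  refine St.Ok.ceil (z / N) (divE_bdd _ _ _ _) (by rw [divE_eval] <;> simp [NE.eval, h5, hN0])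
    ((Nat.div_le_self _ _).trans hzW) ?_
  rw [St.ok_seq]
  refine St.Ok.ceil (z % N) (by simp [QE.Bdd]) ?_ ((Nat.mod_le _ _).trans hzW) ?_
  · have : (z : ℚ) - N * (z / N : ℕ) = (z % N : ℕ) := by
      have h1 : (z : ℚ) = N * (z / N : ℕ) + (z % N : ℕ) := by exact_mod_cast hdm'.symm
      linarith
    simp [QE.eval, NE.eval, Op.total, h5, this]
  simp only [St.ok_seq, St.ok_setN, NE.eval]
  refine ⟨?_, ?_, ?_⟩
  · simp [hw, h5, pow_succ]
  · simp [hy_def, Nat.div_div_eq_div_mul, pow_succ]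
  · have : (((c / N ^ l % N : ℕ) + g l) % (N : ℤ)).toNat = z % N := by
      have h3 : ((c / N ^ l % N : ℕ) + g l) % (N : ℤ) = ((z % N : ℕ) : ℤ) := by
        rw [Int.natCast_mod z, ← hy_def, ← hz]
        simp
      rw [h3, Int.toNat_natCast]
    simp only [shiftCode, Finset.sum_range_succ, this]
    simp [hw, hc', shiftCode]

/-- Run `A` for all entries of the matrix in array `5`. -/
def fill (A : St) : St := .rep 25 (.var 8) (.rep 26 (.var 8) A)

theorem idx_inj {K i j i' j' : ℕ} (hj : j < K) (hj' : j' < K) :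
    i * K + j = i' * K + j' ↔ i = i' ∧ j = j' := by
  constructor
  · intro h
    have hK : 0 < K := by omega
    have h1 : (i * K + j) / K = i := by
      rw [mul_comm, Nat.mul_add_div hK, Nat.div_eq_of_lt hj, add_zero]
    have h2 : (i' * K + j') / K = i' := by
      rw [mul_comm, Nat.mul_add_div hK, Nat.div_eq_of_lt hj', add_zero]
    have : i = i' := by rw [← h1, ← h2, h]
    subst this
    exact ⟨rfl, by omega⟩
  · rintro ⟨rfl, rfl⟩; rfl

/-- The matrix is overwritten in place. When `A` is run for an entry, that entry still has its old
value, and this is the only old entry on which `A` may rely. -/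
theorem fill_ok {W K : ℕ} {A : St} {σ : State} (new : ℕ → ℕ → ℚ) (hK : σ.nat 8 = K) (hKW : K ≤ W)
    (h8 : A.wn 8 = false) (h25 : A.wn 25 = false)
    (hA : ∀ i < K, ∀ j < K, ∀ τ, Frame (fill A) σ τ → τ.nat 25 = i → τ.nat 26 = j →
      τ.arr 5 (i * K + j) = σ.arr 5 (i * K + j) →
      A.Ok W τ fun τ' => τ'.arr 5 = Function.update (τ.arr 5) (i * K + j) (new i j)) :
    (fill A).Ok W σ fun τ => ∀ i < K, ∀ j < K, τ.arr 5 (i * K + j) = new i j := by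
  have h8' : (fill A).wn 8 = false := by simp [fill, St.wn, h8]
  refine St.Ok.rep (fun i τ => ∀ i' < K, ∀ j' < K,
    τ.arr 5 (i' * K + j') = if i' < i then new i' j' else σ.arr 5 (i' * K + j')) K hK hKW
    (by simp) ?_ fun τ _ h i' hi' j' hj' => by rw [h i' hi' j' hj', if_pos hi']
  intro i hi τ hF hI
  refine St.Ok.rep (fun j τ => ∀ i' < K, ∀ j' < K,
    τ.arr 5 (i' * K + j') = if i' < i ∨ i' = i ∧ j' < j then new i' j' else
      σ.arr 5 (i' * K + j')) K ?_ hKW ?_ ?_ ?_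
  · have := hF.nat 8 h8'
    simp [NE.eval, this, hK]
  · intro i' hi' j' hj'
    simpa using hI i' hi' j' hj'
  · intro j hj τ' hF' hI'
    have hF2 : Frame (fill A) σ (τ'.setNat 26 j) := by
      have := (hF'.setNat j).rep (x := 25) (b := .var 8)
      exact (hF.setNat i).trans this
    refine (hA i hi j hj _ hF2 ?_ (by simp) ?_).mono fun υ hFυ hυ i' hi' j' hj' => ?_
    · have := hF'.nat 25 (by simp [St.wn, h25])
      simp [this]
    · simp [hI' i hi j hj]
    · rw [hυ, Function.update_apply]
      simp only [State.setNat_arr, hI' i' hi' j' hj', idx_inj hj' hj]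
      by_cases h : i' = i ∧ j' = j
      · obtain ⟨rfl, rfl⟩ := h
        simp
      · rw [if_neg h]
        refine if_congr ?_ rfl rfl
        omega
  · intro υ _ h i' hi' j' hj'
    rw [h i' hi' j' hj']
    refine if_congr ?_ rfl rfl
    omega

/-- Initialize the matrix with the projection onto the functions with sum zero. -/
def initP : St :=
  fill (.seq (.ceil 19 (divE (.var 25) (.var 7))) (.seq (.ceil 20 (divE (.var 26) (.var 7)))
    (.put 5 (.add (.mul (.var 25) (.var 8)) (.var 26))
      (.ifeq (.nat (.add (.var 25) (.mul (.var 7) (.var 20))))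
        (.nat (.add (.var 26) (.mul (.var 7) (.var 19))))
        (.op .minus (.ifeq (.nat (.var 25)) (.nat (.var 26)) (.lit 1) (.lit 0))
          (.op .divide (.lit 1) (.nat (.var 6)))) (.lit 0)))))

theorem initP_ok {W Q H : ℕ} {σ : State} (hQ : σ.nat 6 = Q) (hH : σ.nat 7 = H)
    (hK : σ.nat 8 = Q * H) (hKW : Q * H ≤ W) :
    initP.Ok W σ fun τ => ∀ i < Q * H, ∀ j < Q * H, τ.arr 5 (i * (Q * H) + j) =
      if i % H = j % H then (if i = j then 1 else 0) - 1 / (Q : ℚ) else 0 := by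
  refine fill_ok _ hK hKW rfl rfl ?_
  intro i hi j hj τ hF hi' hj' _
  have h6 := hF.nat 6 rfl
  have h7 := hF.nat 7 rfl
  have h8 := hF.nat 8 rfl
  rw [hQ] at h6
  rw [hH] at h7
  rw [hK] at h8
  have hH0 : 0 < H := Nat.pos_of_ne_zero fun h => by simp [h] at hi
  rw [St.ok_seq]
  refine St.Ok.ceil (i / H) (divE_bdd _ _ _ _) (by rw [divE_eval] <;> simp [NE.eval, h7, hi', hH0])
    ((Nat.div_le_self _ _).trans (by omega)) ?_
  rw [St.ok_seq]
  refine St.Ok.ceil (j / H) (divE_bdd _ _ _ _) (by rw [divE_eval] <;> simp [NE.eval, h7, hj', hH0])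
    ((Nat.div_le_self _ _).trans (by omega)) ?_
  rw [St.ok_put]
  refine ⟨by simp [QE.Bdd], ?_⟩
  -- Equality of remainders, rearranged so that the program needs neither remainders nor
  -- subtraction.
  have key : i + H * (j / H) = j + H * (i / H) ↔ i % H = j % H := by
    have h1 := Nat.div_add_mod i H
    have h2 := Nat.div_add_mod j H
    omega
  rw [State.setArr_arr, if_pos rfl]
  have key' : ((i : ℚ) + H * (j / H : ℕ) = j + H * (i / H : ℕ)) ↔ i % H = j % H := by
    rw [← key]; norm_cast
  simp [NE.eval, QE.eval, Op.total, h6, h7, h8, hi', hj', key']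

/-- Coordinate `27` of the difference of the end points of edge `9`, whose head and tail are in the
variables `11` and `12`. -/
def edgeE (d : ℕ) : QE :=
  .op .plus (.op .minus (.arr 0 (.add (.mul (.var 11) (.lit d)) (.var 27)))
    (.arr 0 (.add (.mul (.var 12) (.lit d)) (.var 27))))
  (.sum 28 (.lit d) (.op .times (.arr 1 (.add (.mul (.var 27) (.lit d)) (.var 28)))
    (.arr 4 (.add (.mul (.var 9) (.lit d)) (.var 28)))))

def edgeVal (d : ℕ) (σ : State) (k : ℕ) : ℚ :=
  σ.arr 0 (σ.nat 11 * d + k) - σ.arr 0 (σ.nat 12 * d + k) +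
    ∑ l ∈ Finset.range d, σ.arr 1 (k * d + l) * σ.arr 4 (σ.nat 9 * d + l)

theorem edgeE_eval (d : ℕ) (σ : State) (k : ℕ) :
    (edgeE d).eval (σ.setNat 27 k) = edgeVal d σ k := by
  simp [edgeE, edgeVal, QE.eval, NE.eval, Op.total]

theorem edgeE_bdd {W d : ℕ} (σ : State) (h : d ≤ W) : (edgeE d).Bdd W σ := by
  simp [edgeE, QE.Bdd, NE.eval, h]

/-- Restrict the projection in array `5` to the hyperplane belonging to edge `9`, whose end points
have coordinates starting at the positions in the variables `14` and `15`. -/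
def elim (d : ℕ) : St :=
  .seq (.rep 25 (.var 8) (.put 6 (.var 25) (.sum 27 (.lit d) (.op .times (edgeE d)
    (.op .minus (.arr 5 (.add (.mul (.var 25) (.var 8)) (.add (.var 14) (.var 27))))
      (.arr 5 (.add (.mul (.var 25) (.var 8)) (.add (.var 15) (.var 27)))))))))
  (.seq (.setQ 2 (.sum 27 (.lit d) (.op .times (edgeE d)
    (.op .minus (.arr 6 (.add (.var 14) (.var 27))) (.arr 6 (.add (.var 15) (.var 27)))))))
  (fill (.put 5 (.add (.mul (.var 25) (.var 8)) (.var 26))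
    (.op .minus (.arr 5 (.add (.mul (.var 25) (.var 8)) (.var 26)))
      (.op .divide (.op .times (.arr 6 (.var 25)) (.arr 6 (.var 26))) (.var 2))))))

/-- The linear functional `∑ₖ xₖ (y_{u + k} - y_{v + k})`. -/
def edgeVec {F : Type*} [Ring F] (d K u v : ℕ) (x : ℕ → F) (r : Fin K) : F :=
  ∑ k ∈ Finset.range d, x k *
    ((if (r : ℕ) = u + k then 1 else 0) - (if (r : ℕ) = v + k then 1 else 0))

theorem edgeVec_dotProduct {F : Type*} [CommRing F] {d K u v : ℕ} (x : ℕ → F) (y : ℕ → F)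
    (hu : u + d ≤ K) (hv : v + d ≤ K) :
    edgeVec d K u v x ⬝ᵥ (fun r => y r) = ∑ k ∈ Finset.range d, x k * (y (u + k) - y (v + k)) := by
  simp only [dotProduct, edgeVec, Finset.sum_mul]
  rw [Finset.sum_comm]
  refine Finset.sum_congr rfl fun k hk => ?_
  have hk' := Finset.mem_range.1 hk
  have h : ∀ w, w + d ≤ K → ∑ r : Fin K, (if (r : ℕ) = w + k then (1 : F) else 0) * y r =
      y (w + k) := by
    intro w hw
    rw [Finset.sum_eq_single (⟨w + k, by omega⟩ : Fin K)]
    · simp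
    · intro b _ hb
      rw [if_neg (fun h => hb (Fin.ext h)), zero_mul]
    · simp
  simp only [mul_assoc, ← Finset.mul_sum, sub_mul, Finset.sum_sub_distrib, h u hu, h v hv]

def matOf (σ : State) (K : ℕ) : Matrix (Fin K) (Fin K) ℚ :=
  Matrix.of fun r r' => σ.arr 5 (r * K + r')

-- The vector `P a` (array `6`) and the number `a ⬝ᵥ P *ᵥ a` (variable `2`) are computed before any
-- entry of `P` is overwritten. The rank-one correction then needs only the old value of the entry
-- at hand.
open Matrix in
theorem elim_ok {W d K u v : ℕ} {σ : State} (hK : σ.nat 8 = K) (hu : σ.nat 14 = u)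
    (hv : σ.nat 15 = v) (huK : u + d ≤ K) (hvK : v + d ≤ K) (hKW : K ≤ W) (hdW : d ≤ W) :
    (elim d).Ok W σ fun τ =>
      matOf τ K = Elim.elimStep (edgeVec d K u v (edgeVal d σ)) (matOf σ K) := by
  set a := edgeVec d K u v (edgeVal d σ) with ha
  set β : ℕ → ℚ := fun r => ∑ k ∈ Finset.range d, edgeVal d σ k *
    (σ.arr 5 (r * K + (u + k)) - σ.arr 5 (r * K + (v + k))) with hβ
  have hPa : ∀ r : Fin K, (matOf σ K *ᵥ a) r = β r := fun r => by
    rw [mulVec, dotProduct_comm]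
    exact edgeVec_dotProduct (edgeVal d σ) (fun j => σ.arr 5 (r * K + j)) huK hvK
  have hPa' : matOf σ K *ᵥ a = fun r : Fin K => β r := funext hPa
  have hs : a ⬝ᵥ matOf σ K *ᵥ a =
      ∑ k ∈ Finset.range d, edgeVal d σ k * (β (u + k) - β (v + k)) := by
    rw [hPa']
    exact edgeVec_dotProduct _ _ huK hvK
  rw [elim, St.ok_seq]
  refine St.Ok.rep (fun j τ => ∀ r < K, r < j → τ.arr 6 r = β r) K hK hKW (by simp) ?_ ?_
  · intro j hj τ hF hI
    have h8 := hF.nat 8 rfl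
    have h9 := hF.nat 9 rfl
    have h11 := hF.nat 11 rfl
    have h12 := hF.nat 12 rfl
    have h14 := hF.nat 14 rfl
    have h15 := hF.nat 15 rfl
    have h0 := hF.arr 0 rfl
    have h1 := hF.arr 1 rfl
    have h4 := hF.arr 4 rfl
    have h5 := hF.arr 5 rfl
    rw [St.ok_put]
    refine ⟨by simp [QE.Bdd, NE.eval, hdW, edgeE_bdd], fun r hr hrj => ?_⟩
    rw [State.setArr_arr, if_pos rfl, Function.update_apply]
    by_cases hrj' : r = j
    · subst hrj'
      simp only [NE.eval, State.setNat_nat, if_true]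
      simp only [QE.eval, edgeE_eval, NE.eval, Op.total, hβ]
      refine Finset.sum_congr rfl fun k _ => ?_
      simp [edgeVal, h8, h9, h11, h12, h14, h15, h0, h1, h4, h5, hK, hu, hv]
    · simp only [NE.eval, State.setNat_nat, if_true, if_neg hrj']
      exact hI r hr (by omega)
  · intro τ hF hI
    have h8 := hF.nat 8 rfl
    have h9 := hF.nat 9 rfl
    have h11 := hF.nat 11 rfl
    have h12 := hF.nat 12 rfl
    have h14 := hF.nat 14 rfl
    have h15 := hF.nat 15 rfl
    have h0 := hF.arr 0 rfl
    have h1 := hF.arr 1 rfl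
    have h4 := hF.arr 4 rfl
    have h5 := hF.arr 5 rfl
    rw [St.ok_seq, St.ok_setQ]
    refine ⟨by simp [QE.Bdd, NE.eval, hdW, edgeE_bdd], ?_⟩
    have hval : QE.eval (.sum 27 (.lit d) (.op .times (edgeE d)
        (.op .minus (.arr 6 (.add (.var 14) (.var 27))) (.arr 6 (.add (.var 15) (.var 27)))))) τ =
        a ⬝ᵥ matOf σ K *ᵥ a := by
      rw [hs]
      simp only [QE.eval, edgeE_eval, NE.eval, Op.total]
      refine Finset.sum_congr rfl fun k hk => ?_
      have hk' := Finset.mem_range.1 hk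
      simp [edgeVal, h9, h11, h12, h14, h15, h0, h1, h4, hu, hv,
        hI (u + k) (by omega) (by omega), hI (v + k) (by omega) (by omega)]
    rw [hval]
    refine (fill_ok (fun i j => σ.arr 5 (i * K + j) - β i * β j / (a ⬝ᵥ matOf σ K *ᵥ a))
      (by simp [h8, hK]) hKW rfl rfl ?_).mono ?_
    · intro i hi j hj υ hF' hi' hj' hold
      have h8' := hF'.nat 8 rfl
      have h2' := hF'.rat 2 rfl
      have h6' := hF'.arr 6 rfl
      simp only [State.setRat_nat, State.setRat_arr, State.setRat_rat, if_true] at h8' h2' h6' hold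
      rw [St.ok_put]
      refine ⟨by simp [QE.Bdd], ?_⟩
      rw [State.setArr_arr, if_pos rfl]
      simp [NE.eval, QE.eval, Op.total, hi', hj', h8', h8, hK, hold, h5, h2', h6', hI i hi hi,
        hI j hj hj]
    · intro υ _ h
      ext i j
      have hij := h i i.2 j j.2
      rw [hPa'] at hij
      simp only [Elim.elimStep, hPa', of_apply]
      exact hij

end RatRAM

namespace RatRAM

open Matrix

variable {d n m : ℕ}

/-! ## The linear systems solved by the program -/

theorem rowMajor_apply {r c : ℕ} (f : Fin r → Fin c → ℚ) (i : Fin r) (k : Fin c) :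
    rowMajor f (i * c + k) = f i k := by
  have hc : 0 < c := k.pos
  have h : (i : ℕ) * c + k < r * c := by
    have := Nat.mul_le_mul_right c (Nat.succ_le_of_lt i.2)
    have := k.2
    rw [Nat.succ_mul] at *
    omega
  rw [rowMajor, dif_pos h]
  congr 1
  · apply Fin.ext
    simp only [Fin.coe_divNat]
    rw [mul_comm, Nat.mul_add_div hc, Nat.div_eq_of_lt k.2, add_zero]
  · apply Fin.ext
    simp only [Fin.coe_modNat]
    rw [mul_comm, Nat.mul_add_mod, Nat.mod_eq_of_lt k.2]

theorem vec_apply {r : ℕ} (f : Fin r → ℚ) (i : Fin r) : vec f i = f i := by simp [vec]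

/-- Extend a vector by zeros. -/
def extend {F : Type*} [Zero F] (f : Fin d → F) (k : ℕ) : F := if h : k < d then f ⟨k, h⟩ else 0

theorem extend_apply {F : Type*} [Zero F] (f : Fin d → F) (k : Fin d) : extend f k = f k := by
  simp [extend]

/-- The difference of the end points of an edge. -/
def edgeDiff {F : Type*} [Field F] (G : ColoredGraph d n m) (p : Fin n → Fin d → F)
    (L : Matrix (Fin d) (Fin d) F) (e : Fin m) (k : Fin d) : F :=
  p (G.head e) k - p (G.tail e) k + ∑ l, L k l * (G.color e l : F)

/-- The linear functional expressing that edge `e` at the group element with code `c` preserves its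
length. -/
def eqVec (G : ColoredGraph d n m) (p : Fin n → Fin d → ℚ) (L : Matrix (Fin d) (Fin d) ℚ)
    (N : ℕ) (e : Fin m) (c : ℕ) : Fin (N ^ d * (n * d)) → ℚ :=
  edgeVec d _ (shiftCode d N (extend (G.color e)) c * (n * d) + G.head e * d)
    (c * (n * d) + G.tail e * d) (extend (edgeDiff G p L e))

/-- The sum over the group vanishes. -/
def SumZero {K : ℕ} (H : ℕ) (x : Fin K → ℝ) : Prop :=
  ∀ i : Fin K, ∑ j : Fin K, (if (i : ℕ) % H = j % H then x j else 0) = 0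

/-- The motions relative to `N ℤ ^ d` that are invisible to `ℤ ^ d` vanish. -/
def TrivialKernel (G : ColoredGraph d n m) (p : Fin n → Fin d → ℚ)
    (L : Matrix (Fin d) (Fin d) ℚ) (N : ℕ) : Prop :=
  ∀ x : Fin (N ^ d * (n * d)) → ℝ, SumZero (n * d) x →
    (∀ e, ∀ c < N ^ d, (fun r => (eqVec G p L N e c r : ℝ)) ⬝ᵥ x = 0) → x = 0

theorem shiftCode_lt {N : ℕ} (hN : 0 < N) (g : ℕ → ℤ) (c : ℕ) : shiftCode d N g c < N ^ d := by
  induction d with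
  | zero => simp [shiftCode]
  | succ d ih =>
    rw [shiftCode, Finset.sum_range_succ, ← shiftCode]
    set z := (((c / N ^ d % N : ℕ) + g d) % (N : ℤ)).toNat with hz
    have h1 : z < N := by
      have := Int.emod_lt_of_pos ((c / N ^ d % N : ℕ) + g d) (by exact_mod_cast hN : (0 : ℤ) < N)
      omega
    have h2 : N ^ d * z + N ^ d ≤ N ^ (d + 1) := by
      rw [pow_succ, ← Nat.mul_succ]
      exact Nat.mul_le_mul_left _ h1
    omega

theorem card_mod {Q H : ℕ} (i : Fin (Q * H)) :
    (Finset.univ.filter fun k : Fin (Q * H) => (i : ℕ) % H = k % H).card = Q := by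
  have hH : 0 < H := Nat.pos_of_ne_zero fun h => by
    have := i.2
    simp [h] at this
  rw [← Finset.card_map Fin.valEmbedding]
  have : (Finset.univ.filter fun k : Fin (Q * H) => (i : ℕ) % H = k % H).map Fin.valEmbedding =
      (Finset.range Q).image fun q => q * H + i % H := by
    ext k
    simp only [Finset.mem_map, Finset.mem_filter, Finset.mem_univ, true_and, Fin.valEmbedding_apply,
      Finset.mem_image, Finset.mem_range]
    constructor
    · rintro ⟨k, hk, rfl⟩
      refine ⟨k / H, Nat.div_lt_of_lt_mul (k.2.trans_eq (mul_comm _ _)), ?_⟩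
      rw [hk, Nat.div_add_mod']
    · rintro ⟨q, hq, rfl⟩
      have := Nat.mod_lt (i : ℕ) hH
      have h2 := Nat.mul_le_mul_right H (Nat.succ_le_of_lt hq)
      rw [Nat.succ_mul] at h2
      refine ⟨⟨q * H + i % H, by omega⟩, ?_, rfl⟩
      simp
  rw [this, Finset.card_image_of_injective _ fun a b h => ?_, Finset.card_range]
  have h' : a * H = b * H := by simpa using h
  exact Nat.eq_of_mul_eq_mul_right hH h'

/-- The matrix `E` sums over the group, and `E * E = Q • E` because a residue class modulo `H` has
`Q` elements. Thus `Q⁻¹ • E` is the orthogonal projection onto the functions that are constant along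
the group, and its complement projects onto the kernel of `E`. -/
theorem isProjOn_init (Q H : ℕ) :
    Elim.IsProjOn (Matrix.of fun i j : Fin (Q * H) =>
      if (i : ℕ) % H = j % H then (if i = j then 1 else 0) - 1 / (Q : ℝ) else 0) (SumZero H) := by
  set E : Matrix (Fin (Q * H)) (Fin (Q * H)) ℝ :=
    Matrix.of fun i j => if (i : ℕ) % H = j % H then 1 else 0 with hE
  have hP : (Matrix.of fun i j : Fin (Q * H) =>
      if (i : ℕ) % H = j % H then (if i = j then 1 else 0) - 1 / (Q : ℝ) else 0) =
      1 - (Q : ℝ)⁻¹ • E := by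
    ext i j
    by_cases hij : i = j
    · simp [hE, hij]
    · by_cases h : (i : ℕ) % H = j % H <;> simp [hE, hij, h]
  have hEE : E * E = (Q : ℝ) • E := by
    ext i j
    have hc : (Q : ℝ) = ∑ k : Fin (Q * H), if (i : ℕ) % H = k % H then 1 else 0 := by
      rw [← Finset.sum_filter, Finset.sum_const, card_mod]
      simp
    rw [Matrix.smul_apply, hc, smul_eq_mul, Matrix.mul_apply, Finset.sum_mul]
    refine Finset.sum_congr rfl fun k _ => ?_
    by_cases h : (i : ℕ) % H = k % H <;> simp [hE, h]
  have hQ : ∀ i : Fin (Q * H), (Q : ℝ) ≠ 0 := fun i h => by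
    have hi := i.2
    have : Q = 0 := by exact_mod_cast h
    simp [this] at hi
  rw [hP]
  refine ⟨?_, ?_, fun x => ?_⟩
  · rw [transpose_sub, transpose_smul, transpose_one]
    congr 2
    ext i j
    simp [hE, eq_comm]
  · simp only [sub_mul, mul_sub, one_mul, mul_one, Matrix.smul_mul, Matrix.mul_smul, hEE]
    ext i j
    have := hQ i
    simp
    field_simp
    simp
  · rw [sub_mulVec, one_mulVec, sub_eq_self, smul_mulVec]
    have hx : ∀ i, (E *ᵥ x) i = ∑ j : Fin (Q * H), (if (i : ℕ) % H = j % H then x j else 0) := fun i => by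
      simp [mulVec, dotProduct, hE]
    constructor
    · intro h i
      have := congrFun h i
      rw [Pi.smul_apply, hx] at this
      simpa [hQ i] using this
    · intro h
      ext i
      rw [Pi.smul_apply, hx, h i]
      simp

theorem _root_.Elim.IsProjOn.congr {ι F : Type*} [Fintype ι] [Field F] {P : Matrix ι ι F}
    {V V' : (ι → F) → Prop} (h : Elim.IsProjOn P V) (hV : ∀ x, V x ↔ V' x) : Elim.IsProjOn P V' :=
  ⟨h.symm, h.idem, fun x => (h.fixed x).trans (hV x)⟩

theorem edgeVec_congr {F : Type*} [Ring F] {K u v : ℕ} {x y : ℕ → F} (h : ∀ k < d, x k = y k) :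
    edgeVec d K u v x = edgeVec d K u v y := by
  ext r
  exact Finset.sum_congr rfl fun k hk => by rw [h k (Finset.mem_range.1 hk)]

/-! ## The main loop -/

/-- The data of the framework are in memory. -/
structure Ctx (G : ColoredGraph d n m) (p : Fin n → Fin d → ℚ) (L : Matrix (Fin d) (Fin d) ℚ)
    (D : ℕ) (τ : State) : Prop where
  m : τ.nat 0 = m
  n : τ.nat 1 = n
  D : τ.nat 2 = D
  p : τ.arr 0 = rowMajor p
  L : τ.arr 1 = rowMajor fun i j => L i j
  tail : τ.arr 2 = vec fun e => ((G.tail e : ℕ) : ℚ)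
  head : τ.arr 3 = vec fun e => ((G.head e : ℕ) : ℚ)
  color : τ.arr 4 = rowMajor fun e k => (G.color e k : ℚ)

theorem Ctx.of_frame {G : ColoredGraph d n m} {p : Fin n → Fin d → ℚ}
    {L : Matrix (Fin d) (Fin d) ℚ} {D : ℕ} {σ τ : State} {A : St} (h : Ctx G p L D σ)
    (hF : Frame A σ τ) (hn : ∀ x < 3, A.wn x = false) (ha : ∀ a < 5, A.wa a = false) :
    Ctx G p L D τ :=
  ⟨(hF.nat 0 (hn _ (by omega))).trans h.m, (hF.nat 1 (hn _ (by omega))).trans h.n,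
    (hF.nat 2 (hn _ (by omega))).trans h.D, (hF.arr 0 (ha _ (by omega))).trans h.p,
    (hF.arr 1 (ha _ (by omega))).trans h.L, (hF.arr 2 (ha _ (by omega))).trans h.tail,
    (hF.arr 3 (ha _ (by omega))).trans h.head, (hF.arr 4 (ha _ (by omega))).trans h.color⟩

theorem Ctx.setNat {G : ColoredGraph d n m} {p : Fin n → Fin d → ℚ}
    {L : Matrix (Fin d) (Fin d) ℚ} {D : ℕ} {σ : State} (h : Ctx G p L D σ) {x : ℕ} (hx : 3 ≤ x)
    (j : ℕ) : Ctx G p L D (σ.setNat x j) :=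
  h.of_frame ((St.setN x (.lit j)).frame σ) (fun y hy => by simp [St.wn]; omega) fun _ _ => rfl

theorem Ctx.edgeVal {G : ColoredGraph d n m} {p : Fin n → Fin d → ℚ}
    {L : Matrix (Fin d) (Fin d) ℚ} {D : ℕ} {σ : State} (h : Ctx G p L D σ) {e : Fin m}
    (he : σ.nat 9 = e) (hh : σ.nat 11 = G.head e) (ht : σ.nat 12 = G.tail e) {k : ℕ} (hk : k < d) :
    edgeVal d σ k = extend (edgeDiff G p L e) k := by
  lift k to Fin d using hk
  rw [extend_apply, RatRAM.edgeVal, edgeDiff, h.p, h.L, h.color, he, hh, ht, rowMajor_apply,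
    rowMajor_apply, Finset.sum_range]
  congr 1
  refine Finset.sum_congr rfl fun l _ => ?_
  rw [rowMajor_apply, rowMajor_apply]

/-- Impose the equation of edge `9` at the group element with code in variable `10`. -/
def edgeStep (d : ℕ) : St :=
  .seq (shift d)
  (.seq (.setN 14 (.add (.mul (.var 13) (.var 7)) (.mul (.var 11) (.lit d))))
  (.seq (.setN 15 (.add (.mul (.var 10) (.var 7)) (.mul (.var 12) (.lit d)))) (elim d)))

/-- All group elements. -/
def orbitLoop (d : ℕ) : St := .rep 10 (.var 6) (edgeStep d)

/-- All edges. -/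
def edgesLoop (d : ℕ) : St :=
  .rep 9 (.var 0) (.seq (.ceil 11 (.arr 3 (.var 9))) (.seq (.ceil 12 (.arr 2 (.var 9)))
    (orbitLoop d)))

/-- The size parameters for the modulus `N` are in memory. -/
structure Sizes (d n N : ℕ) (τ : State) : Prop where
  mod : τ.nat 5 = N
  grp : τ.nat 6 = N ^ d
  row : τ.nat 7 = n * d
  tot : τ.nat 8 = N ^ d * (n * d)

theorem Sizes.of_frame {N : ℕ} {σ τ : State} {A : St} (h : Sizes d n N σ)
    (hF : Frame A σ τ) (hn : ∀ x < 9, 5 ≤ x → A.wn x = false) : Sizes d n N τ :=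
  ⟨(hF.nat 5 (hn _ (by omega) (by omega))).trans h.mod,
    (hF.nat 6 (hn _ (by omega) (by omega))).trans h.grp,
    (hF.nat 7 (hn _ (by omega) (by omega))).trans h.row,
    (hF.nat 8 (hn _ (by omega) (by omega))).trans h.tot⟩

theorem Sizes.setNat {N : ℕ} {σ : State} (h : Sizes d n N σ) {x : ℕ} (hx : 9 ≤ x) (j : ℕ) :
    Sizes d n N (σ.setNat x j) :=
  h.of_frame ((St.setN x (.lit j)).frame σ) fun y hy _ => by simp [St.wn]; omega

/-- `W` bounds all sizes that occur for the modulus `N`. -/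
structure Bounds (d n m D N W : ℕ) : Prop where
  dim : d ≤ W
  vert : n ≤ W
  edge : m ≤ W
  grp : N ^ d ≤ W
  tot : N ^ d * (n * d) ≤ W
  aux : N + D + D * N ≤ W

/-- The projection in memory, over the reals. -/
noncomputable def projOf (σ : State) (K : ℕ) : Matrix (Fin K) (Fin K) ℝ := (matOf σ K).map (Rat.castHom ℝ)

/-- The predicate `V` stands for the equations imposed so far. Leaving it arbitrary lets the
enclosing loops append one conjunct per round. -/
theorem edgeStep_ok {W N D : ℕ} {G : ColoredGraph d n m} {p : Fin n → Fin d → ℚ}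
    {L : Matrix (Fin d) (Fin d) ℚ} {σ : State} (hC : Ctx G p L D σ) (hS : Sizes d n N σ)
    (hW : Bounds d n m D N W) (hN : 0 < N) (hD : ∀ e k, |G.color e k| ≤ D) {e : Fin m} {c : ℕ}
    (hc : c < N ^ d) (he : σ.nat 9 = e) (hc' : σ.nat 10 = c) (hh : σ.nat 11 = G.head e)
    (ht : σ.nat 12 = G.tail e) {V : (Fin (N ^ d * (n * d)) → ℝ) → Prop}
    (hP : Elim.IsProjOn (projOf σ (N ^ d * (n * d))) V) :
    (edgeStep d).Ok W σ fun τ => Elim.IsProjOn (projOf τ (N ^ d * (n * d)))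
      fun x => V x ∧ (fun r => (eqVec G p L N e c r : ℝ)) ⬝ᵥ x = 0 := by
  rw [edgeStep, St.ok_seq]
  refine (shift_ok (g := extend (G.color e)) hS.mod hN hC.D hc' ?_ ?_ hW.dim (hc.le.trans hW.grp)
    hW.aux).mono ?_
  · intro l hl
    lift l to Fin d using hl
    rw [he, hC.color, rowMajor_apply, extend_apply]
  · intro l hl
    lift l to Fin d using hl
    rw [extend_apply]
    exact hD e l
  intro τ hF h13
  have h7 := (hF.nat 7 rfl).trans hS.row
  have h8 := (hF.nat 8 rfl).trans hS.tot
  have h9 := (hF.nat 9 rfl).trans he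
  have h10 := (hF.nat 10 rfl).trans hc'
  have h11 := (hF.nat 11 rfl).trans hh
  have h12 := (hF.nat 12 rfl).trans ht
  have h5 := hF.arr 5 rfl
  have hCτ : Ctx G p L D τ := hC.of_frame hF (by intro x hx; interval_cases x <;> rfl)
    (by intro x hx; interval_cases x <;> rfl)
  simp only [St.ok_seq, St.ok_setN, NE.eval, State.setNat_nat]
  have hpos : ∀ c < N ^ d, ∀ i : Fin n, c * (n * d) + i * d + d ≤ N ^ d * (n * d) := by
    intro c hc i
    have h1 := Nat.mul_le_mul_right (n * d) (Nat.succ_le_of_lt hc)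
    have h2 := Nat.mul_le_mul_right d (Nat.succ_le_of_lt i.2)
    rw [Nat.succ_mul] at h1 h2
    omega
  refine (elim_ok (K := N ^ d * (n * d))
    (u := shiftCode d N (extend (G.color e)) c * (n * d) + G.head e * d)
    (v := c * (n * d) + G.tail e * d) (by simp [h8]) (by simp [h13, h7, h11])
    (by simp [h10, h7, h12]) (hpos _ (shiftCode_lt hN _ _) _) (hpos _ hc _) hW.tot hW.dim).mono ?_
  intro υ _ hυ
  have hCτ' := (hCτ.setNat (x := 14) (by omega)
    (shiftCode d N (extend (G.color e)) c * (n * d) + G.head e * d)).setNat (x := 15) (by omega)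
    (c * (n * d) + G.tail e * d)
  have hmat : projOf υ (N ^ d * (n * d)) =
      Elim.elimStep (fun r => (eqVec G p L N e c r : ℝ)) (projOf σ (N ^ d * (n * d))) := by
    rw [projOf, hυ, Elim.map_elimStep]
    congr 1
    · ext r
      simp only [Function.comp, eqVec, Rat.castHom, RingHom.coe_mk, MonoidHom.coe_mk, OneHom.coe_mk]
      congr 1
      refine congrFun (edgeVec_congr fun k hk => ?_) r
      simp only [h13, h7, h11, h10, h12]
      exact hCτ'.edgeVal (by simp [h9]) (by simp [h11]) (by simp [h12]) hk
    · simp [projOf, matOf, h5]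
  rw [hmat]
  exact hP.elimStep _

theorem orbitLoop_ok {W N D : ℕ} {G : ColoredGraph d n m} {p : Fin n → Fin d → ℚ}
    {L : Matrix (Fin d) (Fin d) ℚ} {σ : State} (hC : Ctx G p L D σ) (hS : Sizes d n N σ)
    (hW : Bounds d n m D N W) (hN : 0 < N) (hD : ∀ e k, |G.color e k| ≤ D) {e : Fin m}
    (he : σ.nat 9 = e) (hh : σ.nat 11 = G.head e) (ht : σ.nat 12 = G.tail e)
    {V : (Fin (N ^ d * (n * d)) → ℝ) → Prop}
    (hP : Elim.IsProjOn (projOf σ (N ^ d * (n * d))) V) :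
    (orbitLoop d).Ok W σ fun τ => Elim.IsProjOn (projOf τ (N ^ d * (n * d)))
      fun x => V x ∧ ∀ c < N ^ d, (fun r => (eqVec G p L N e c r : ℝ)) ⬝ᵥ x = 0 := by
  refine St.Ok.rep (fun c₀ τ => Elim.IsProjOn (projOf τ (N ^ d * (n * d)))
      fun x => V x ∧ ∀ c < c₀, (fun r => (eqVec G p L N e c r : ℝ)) ⬝ᵥ x = 0) (N ^ d) hS.grp hW.grp
    (hP.congr fun x => by simp) ?_ fun τ _ h => h
  intro c hc τ hF hI
  have hF' : Frame (orbitLoop d) σ (τ.setNat 10 c) := hF.setNat c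
  refine (edgeStep_ok (e := e) (c := c) (hC.of_frame hF' (by intro x hx; interval_cases x <;> rfl)
    (by intro x hx; interval_cases x <;> rfl))
    (hS.of_frame hF' (by intro x hx hx'; interval_cases x <;> rfl))
    hW hN hD hc ((hF'.nat 9 rfl).trans he) (by simp) ((hF'.nat 11 rfl).trans hh)
    ((hF'.nat 12 rfl).trans ht) hI).mono fun υ _ hυ => hυ.congr fun x => ?_
  rw [and_assoc]
  refine and_congr_right fun _ => ⟨fun h c' hc' => ?_, fun h =>
    ⟨fun c' hc' => h c' (by omega), h c (by omega)⟩⟩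
  rcases Nat.lt_succ_iff_lt_or_eq.1 hc' with h' | rfl
  · exact h.1 c' h'
  · exact h.2

theorem edgesLoop_ok {W N D : ℕ} {G : ColoredGraph d n m} {p : Fin n → Fin d → ℚ}
    {L : Matrix (Fin d) (Fin d) ℚ} {σ : State} (hC : Ctx G p L D σ) (hS : Sizes d n N σ)
    (hW : Bounds d n m D N W) (hN : 0 < N) (hD : ∀ e k, |G.color e k| ≤ D)
    {V : (Fin (N ^ d * (n * d)) → ℝ) → Prop}
    (hP : Elim.IsProjOn (projOf σ (N ^ d * (n * d))) V) :
    (edgesLoop d).Ok W σ fun τ => Elim.IsProjOn (projOf τ (N ^ d * (n * d)))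
      fun x => V x ∧ ∀ e, ∀ c < N ^ d, (fun r => (eqVec G p L N e c r : ℝ)) ⬝ᵥ x = 0 := by
  refine St.Ok.rep (fun e₀ τ => Elim.IsProjOn (projOf τ (N ^ d * (n * d)))
      fun x => V x ∧ ∀ e : Fin m, (e : ℕ) < e₀ → ∀ c < N ^ d,
        (fun r => (eqVec G p L N e c r : ℝ)) ⬝ᵥ x = 0) m hC.m hW.edge
    (hP.congr fun x => by simp) ?_ fun τ _ h => h.congr fun x => by simp
  intro e he τ hF hI
  lift e to Fin m using he
  have hF' : Frame (edgesLoop d) σ (τ.setNat 9 e) := hF.setNat e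
  have hC' := hC.of_frame hF' (by intro x hx; interval_cases x <;> rfl)
    (by intro x hx; interval_cases x <;> rfl)
  have hS' := hS.of_frame hF' (by intro x hx hx'; interval_cases x <;> rfl)
  have hh : ⌈QE.eval (.arr 3 (.var 9)) (τ.setNat 9 e)⌉₊ = G.head e := by
    rw [QE.eval, hC'.head]
    simp [NE.eval, vec_apply]
  have ht : ⌈QE.eval (.arr 2 (.var 9)) ((τ.setNat 9 e).setNat 11 (G.head e))⌉₊ = G.tail e := by
    rw [QE.eval, State.setNat_arr, hC'.tail]
    simp [NE.eval, vec_apply]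
  rw [St.ok_seq]
  refine St.Ok.ceil _ trivial hh ((G.head e).2.le.trans hW.vert) ?_
  rw [St.ok_seq]
  refine St.Ok.ceil _ trivial ht ((G.tail e).2.le.trans hW.vert) ?_
  refine (orbitLoop_ok (e := e) ((hC'.setNat (by omega) _).setNat (by omega) _)
    ((hS'.setNat (by omega) _).setNat (by omega) _) hW hN hD (by simp) (by simp) (by simp)
    hI).mono fun υ _ hυ => hυ.congr fun x => ?_
  rw [and_assoc]
  refine and_congr_right fun _ => ⟨fun h e' he' => ?_, fun h =>
    ⟨fun e' he' => h e' (by omega), h e (by omega)⟩⟩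
  rcases Nat.lt_succ_iff_lt_or_eq.1 he' with h' | h'
  · exact h.1 e' h'
  · obtain rfl : e' = e := Fin.ext h'
    exact h.2

end RatRAM

/-! ### Testing all moduli up to a polynomial bound -/

namespace RatRAM

open Matrix

variable {d n m : ℕ}

def NE.npow (e : NE) : ℕ → NE
  | 0 => .lit 1
  | k + 1 => .mul (e.npow k) e

theorem NE.npow_eval (e : NE) (k : ℕ) (σ : State) : (e.npow k).eval σ = e.eval σ ^ k := by
  induction k with
  | zero => rfl
  | succ k ih => rw [NE.npow, NE.eval, ih, pow_succ]

/-- Test the modulus that is one more than variable `4`. -/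
def modulusTest (d : ℕ) : St :=
  .seq (.setN 5 (.add (.var 4) (.lit 1)))
  (.seq (.setN 6 ((NE.var 5).npow d))
  (.seq (.setN 7 (.mul (.var 1) (.lit d)))
  (.seq (.setN 8 (.mul (.var 6) (.var 7)))
  (.seq initP
  (.seq (edgesLoop d)
    (.setQ 1 (.ifeq (.sum 25 (.var 8) (.arr 5 (.add (.mul (.var 25) (.var 8)) (.var 25)))) (.lit 0)
      (.var 1) (.lit 0))))))))

theorem projOf_init {σ : State} {Q H : ℕ}
    (h : ∀ i < Q * H, ∀ j < Q * H, σ.arr 5 (i * (Q * H) + j) =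
      if i % H = j % H then (if i = j then 1 else 0) - 1 / (Q : ℚ) else 0) :
    Elim.IsProjOn (projOf σ (Q * H)) (SumZero H) := by
  convert isProjOn_init Q H using 1
  ext i j
  have := h i i.2 j j.2
  simp only [projOf, matOf, map_apply, of_apply, this]
  split_ifs <;> simp_all [Fin.ext_iff]

/-- Once all equations are imposed, the matrix projects onto the kernel in question, and its trace
decides whether that kernel is zero. The flag in variable `1` is only ever cleared, so that a loop
over moduli computes a conjunction. -/
theorem modulusTest_ok {W D j : ℕ} {G : ColoredGraph d n m} {p : Fin n → Fin d → ℚ}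
    {L : Matrix (Fin d) (Fin d) ℚ} {σ : State} (hC : Ctx G p L D σ) (hj : σ.nat 4 = j)
    (hW : Bounds d n m D (j + 1) W) (hD : ∀ e k, |G.color e k| ≤ D) :
    (modulusTest d).Ok W σ fun τ => (TrivialKernel G p L (j + 1) → τ.rat 1 = σ.rat 1) ∧
      (¬ TrivialKernel G p L (j + 1) → τ.rat 1 = 0) := by
  set σ' := (((σ.setNat 5 (j + 1)).setNat 6 ((j + 1) ^ d)).setNat 7 (n * d)).setNat 8
    ((j + 1) ^ d * (n * d)) with hσ'
  have hC' : Ctx G p L D σ' :=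
    (((hC.setNat (by omega) _).setNat (by omega) _).setNat (by omega) _).setNat (by omega) _
  have hS : Sizes d n (j + 1) σ' := ⟨by simp [σ'], by simp [σ'], by simp [σ'], by simp [σ']⟩
  simp only [modulusTest, St.ok_seq, St.ok_setN]
  have hσ'' : (((σ.setNat 5 ((NE.add (.var 4) (.lit 1)).eval σ)).setNat 6
      (((NE.var 5).npow d).eval (σ.setNat 5 ((NE.add (.var 4) (.lit 1)).eval σ)))).setNat 7
      ((NE.mul (.var 1) (.lit d)).eval ((σ.setNat 5 ((NE.add (.var 4) (.lit 1)).eval σ)).setNat 6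
      (((NE.var 5).npow d).eval (σ.setNat 5 ((NE.add (.var 4) (.lit 1)).eval σ)))))).setNat 8
      ((NE.mul (.var 6) (.var 7)).eval (((σ.setNat 5 ((NE.add (.var 4) (.lit 1)).eval σ)).setNat 6
      (((NE.var 5).npow d).eval (σ.setNat 5 ((NE.add (.var 4) (.lit 1)).eval σ)))).setNat 7
      ((NE.mul (.var 1) (.lit d)).eval ((σ.setNat 5 ((NE.add (.var 4) (.lit 1)).eval σ)).setNat 6
      (((NE.var 5).npow d).eval (σ.setNat 5 ((NE.add (.var 4) (.lit 1)).eval σ))))))) = σ' := by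
    simp [σ', NE.eval, NE.npow_eval, hj, hC.n]
  rw [hσ'']
  refine (initP_ok hS.grp hS.row hS.tot hW.tot).mono fun τ hF hτ => ?_
  refine (edgesLoop_ok (hC'.of_frame hF (by intro x hx; interval_cases x <;> rfl)
    (by intro x hx; interval_cases x <;> rfl))
    (hS.of_frame hF (by intro x hx hx'; interval_cases x <;> rfl)) hW (by omega) hD
    (projOf_init hτ)).mono fun υ hF' hυ => ?_
  have h8 := ((hF'.nat 8 rfl).trans (hF.nat 8 rfl)).trans hS.tot
  have h1 : υ.rat 1 = σ.rat 1 := (hF'.rat 1 rfl).trans (hF.rat 1 rfl)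
  have htr : QE.eval (.sum 25 (.var 8) (.arr 5 (.add (.mul (.var 25) (.var 8)) (.var 25)))) υ =
      (matOf υ ((j + 1) ^ d * (n * d))).trace := by
    simp only [QE.eval, NE.eval, h8, Finset.sum_range, Matrix.trace]
    refine Finset.sum_congr rfl fun r _ => ?_
    simp [matOf, h8]
  have hiff : (matOf υ ((j + 1) ^ d * (n * d))).trace = 0 ↔ TrivialKernel G p L (j + 1) := by
    have h := hυ.trace_eq_zero_iff
    have hcast : (projOf υ ((j + 1) ^ d * (n * d))).trace =
        (((matOf υ ((j + 1) ^ d * (n * d))).trace : ℚ) : ℝ) := by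
      simp [projOf, Matrix.trace]
    rw [hcast, Rat.cast_eq_zero] at h
    rw [h, TrivialKernel]
    exact ⟨fun h x hx hx' => h x ⟨hx, hx'⟩, fun h x hx => h x hx.1 hx.2⟩
  rw [St.ok_setQ]
  refine ⟨by simp [QE.Bdd, NE.eval, h8, hW.tot], ?_, ?_⟩
  · intro h
    rw [State.setRat_rat, if_pos rfl, QE.eval, htr, if_pos (by rw [hiff.2 h]; rfl)]
    exact h1
  · intro h
    rw [State.setRat_rat, if_pos rfl, QE.eval, htr,
      if_neg (by simpa [QE.eval] using mt hiff.1 h)]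
    rfl

/-- The sum of the squares of all entries of all colors. -/
def sqColor (G : ColoredGraph d n m) : ℕ := ∑ e, ∑ k, (G.color e k).natAbs ^ 2

/-- The program works with the sum of squares in place of `D`, since it needs no absolute values. By
this and `totalColor_le` the two are polynomially equivalent. -/
theorem sqColor_le (G : ColoredGraph d n m) : sqColor G ≤ G.totalColor ^ 2 := by
  rw [sqColor, ColoredGraph.totalColor]
  refine (Finset.sum_le_sum fun e _ => Finset.sum_sq_le_sq_sum_of_nonneg ?_).trans
    (Finset.sum_sq_le_sq_sum_of_nonneg ?_)
  all_goals exact fun _ _ => Nat.zero_le _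

theorem totalColor_le (G : ColoredGraph d n m) : G.totalColor ≤ sqColor G := by
  refine Finset.sum_le_sum fun e _ => Finset.sum_le_sum fun k _ => ?_
  exact Nat.le_self_pow (by omega) _

theorem abs_color_le (G : ColoredGraph d n m) (e : Fin m) (k : Fin d) :
    |G.color e k| ≤ (sqColor G : ℤ) := by
  rw [Int.abs_eq_natAbs]
  have h1 : (G.color e k).natAbs ≤ ∑ k, (G.color e k).natAbs :=
    Finset.single_le_sum (f := fun k => (G.color e k).natAbs) (fun _ _ => Nat.zero_le _)
      (Finset.mem_univ k)
  have h2 : ∑ k, (G.color e k).natAbs ≤ G.totalColor :=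
    Finset.single_le_sum (f := fun e => ∑ k, (G.color e k).natAbs) (fun _ _ => Nat.zero_le _)
      (Finset.mem_univ e)
  exact_mod_cast (h1.trans h2).trans (totalColor_le G)

/-- Test all moduli up to `C (D + 1) ^ k`, where `D` is the sum of the squares of all entries of
all colors. -/
def main (d C k : ℕ) : St :=
  .seq (.ceil 1 (.var 0))
  (.seq (.ceil 2 (.sum 9 (.var 0) (.sum 27 (.lit d)
    (.op .times (.arr 4 (.add (.mul (.var 9) (.lit d)) (.var 27)))
      (.arr 4 (.add (.mul (.var 9) (.lit d)) (.var 27)))))))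
  (.seq (.setN 3 (.mul (.lit C) ((NE.add (.var 2) (.lit 1)).npow k)))
  (.seq (.setQ 1 (.lit 1))
  (.seq (.rep 4 (.var 3) (modulusTest d))
    (.setQ 0 (.var 1))))))

def initState (G : ColoredGraph d n m) (p : Fin n → Fin d → ℚ) (L : Matrix (Fin d) (Fin d) ℚ) :
    State where
  nat x := if x = 0 then m else 0
  rat x := if x = 0 then n else 0
  arr := (input G p L).arr

/-- The register layout is chosen so that the input is already a represented state: `n` sits in
rational variable `0`, `m` in natural variable `0`. The former becomes a natural variable by
rounding. -/
theorem rep_input (G : ColoredGraph d n m) (p : Fin n → Fin d → ℚ) (L : Matrix (Fin d) (Fin d) ℚ) :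
    Rep (input G p L) (initState G p L) := by
  refine ⟨fun x => ?_, fun x => ?_, rfl⟩
  · rcases x with _ | x
    · rfl
    · simp only [initState, if_neg (Nat.succ_ne_zero x)]
      rw [show 3 * (x + 1) = 3 * x + 1 + 2 by ring]
      rfl
  · rcases x with _ | x
    · rfl
    · simp only [initState, if_neg (Nat.succ_ne_zero x)]
      rw [show 3 * (x + 1) + 1 = 3 * x + 2 + 2 by ring]
      simp [input]

/-- A bound for all sizes that occur. -/
def sizeBound (d C k X : ℕ) : ℕ :=
  d + X + X ^ 2 + C * (X ^ 2 + 1) ^ k + (C * (X ^ 2 + 1) ^ k) ^ d +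
    (C * (X ^ 2 + 1) ^ k) ^ d * (X * d) +
    (C * (X ^ 2 + 1) ^ k + X ^ 2 + X ^ 2 * (C * (X ^ 2 + 1) ^ k))

theorem sizeBound_polyBdd (d C k : ℕ) : PolyBdd (sizeBound d C k) := by
  have h2 : PolyBdd fun X => X ^ 2 := PolyBdd.id.pow 2
  have hB : PolyBdd fun X => C * (X ^ 2 + 1) ^ k := (PolyBdd.const C).mul ((h2.add (.const 1)).pow k)
  exact ((((((PolyBdd.const d).add .id).add h2).add hB).add (hB.pow d)).add
    ((hB.pow d).mul (PolyBdd.id.mul (.const d)))).add ((hB.add h2).add (h2.mul hB))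

theorem bounds_of_le {C k X D N : ℕ} (hn : n ≤ X) (hm : m ≤ X) (hD : D ≤ X ^ 2)
    (hN : N ≤ C * (D + 1) ^ k) : Bounds d n m D N (sizeBound d C k X) := by
  have hN' : N ≤ C * (X ^ 2 + 1) ^ k := hN.trans (by gcongr)
  unfold sizeBound
  generalize C * (X ^ 2 + 1) ^ k = B at *
  have h1 : N ^ d ≤ B ^ d := Nat.pow_le_pow_left hN' d
  have h2 : N ^ d * (n * d) ≤ B ^ d * (X * d) := by gcongr
  have h3 : D * N ≤ X ^ 2 * B := Nat.mul_le_mul hD hN'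
  constructor <;> omega

theorem main_ok (C k : ℕ) (G : ColoredGraph d n m) (p : Fin n → Fin d → ℚ)
    (L : Matrix (Fin d) (Fin d) ℚ) :
    (main d C k).Ok (sizeBound d C k (m + n + G.totalColor)) (initState G p L) fun τ =>
      ((∀ N, 0 < N → N ≤ C * (sqColor G + 1) ^ k → TrivialKernel G p L N) → τ.rat 0 = 1) ∧
      ((¬ ∀ N, 0 < N → N ≤ C * (sqColor G + 1) ^ k → TrivialKernel G p L N) → τ.rat 0 = 0) := by
  set X := m + n + G.totalColor with hX
  have hDX : sqColor G ≤ X ^ 2 :=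
    (sqColor_le G).trans (Nat.pow_le_pow_left (Nat.le_add_left _ _) 2)
  have hb : ∀ N, N ≤ C * (sqColor G + 1) ^ k →
      Bounds d n m (sqColor G) N (sizeBound d C k X) := fun N hN =>
    bounds_of_le (by omega) (by omega) hDX hN
  -- The instance `N = 0` provides the bounds that do not involve the modulus.
  have hb0 := hb 0 (Nat.zero_le _)
  have hDW : sqColor G ≤ sizeBound d C k X := by unfold sizeBound; omega
  rw [main, St.ok_seq]
  refine St.Ok.ceil n trivial (by simp [QE.eval, initState]) hb0.vert ?_
  rw [St.ok_seq]
  refine St.Ok.ceil (sqColor G) ?_ ?_ hDW ?_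
  · simp [QE.Bdd, NE.eval, initState, hb0.dim, hb0.edge]
  · have : QE.eval (.sum 9 (.var 0) (.sum 27 (.lit d)
        (.op .times (.arr 4 (.add (.mul (.var 9) (.lit d)) (.var 27)))
          (.arr 4 (.add (.mul (.var 9) (.lit d)) (.var 27))))))
        ((initState G p L).setNat 1 n) = (sqColor G : ℕ) := by
      simp only [QE.eval, NE.eval, Op.total]
      simp only [State.setNat_nat, State.setNat_arr]
      simp only [initState, if_true, if_neg (show ¬ (0 : ℕ) = 1 by decide),
        if_neg (show ¬ (9 : ℕ) = 27 by decide), sqColor, Finset.sum_range]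
      push_cast
      refine Finset.sum_congr rfl fun e _ => Finset.sum_congr rfl fun l _ => ?_
      have : (input G p L).arr 4 = rowMajor fun e k => (G.color e k : ℚ) := rfl
      rw [this, rowMajor_apply, Nat.cast_natAbs]
      push_cast
      rw [sq_abs, sq]
    rw [this, Nat.ceil_natCast]
  simp only [St.ok_seq, St.ok_setN, St.ok_setQ]
  refine ⟨trivial, ?_⟩
  set σ := (((((initState G p L).setNat 1 n).setNat 2 (sqColor G)).setNat 3 _).setRat 1
    (QE.eval (QE.lit 1) _)) with hσ
  have hC : Ctx G p L (sqColor G) σ := ⟨rfl, rfl, rfl, rfl, rfl, rfl, rfl, rfl⟩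
  have h3 : σ.nat 3 = C * (sqColor G + 1) ^ k := by
    simp [σ, NE.eval, NE.npow_eval]
  refine St.Ok.rep (fun j τ => ((∀ N, 0 < N → N ≤ j → TrivialKernel G p L N) → τ.rat 1 = 1) ∧
      ((¬ ∀ N, 0 < N → N ≤ j → TrivialKernel G p L N) → τ.rat 1 = 0)) _ h3
      (by unfold sizeBound; have : C * (sqColor G + 1) ^ k ≤ C * (X ^ 2 + 1) ^ k := by gcongr
          omega) ⟨fun _ => by simp [σ, QE.eval], fun h => ?_⟩ ?_ ?_
  · exact absurd (fun N hN hN' => by omega) h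
  · rintro j hj τ hF ⟨hI, hI'⟩
    have hF' := hF.setNat j
    refine (modulusTest_ok (j := j) (hC.of_frame hF' (by intro x hx; interval_cases x <;> rfl)
      (by intro x hx; interval_cases x <;> rfl)) (by simp) (hb _ hj)
      (abs_color_le G)).mono fun υ _ hυ => ⟨fun h => ?_, fun h => ?_⟩
    · rw [hυ.1 (h _ (by omega) le_rfl)]
      exact hI fun N hN hN' => h N hN (by omega)
    · by_cases hj : TrivialKernel G p L (j + 1)
      · rw [hυ.1 hj]
        refine hI' fun h' => h fun N hN hN' => ?_
        rcases Nat.lt_or_ge j N with h2 | h2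
        · obtain rfl : N = j + 1 := by omega
          exact hj
        · exact h' N hN h2
      · exact hυ.2 hj
  · intro τ _ hτ
    refine ⟨trivial, ?_⟩
    simpa [QE.eval] using hτ

/-- The systems for all moduli up to a polynomial bound can be tested in polynomial time. -/
theorem exists_prog (d C k : ℕ) : ∃ (P : Prog) (C' k' : ℕ), ∀ (n m : ℕ) (G : ColoredGraph d n m)
    (p : Fin n → Fin d → ℚ) (L : Matrix (Fin d) (Fin d) ℚ), ∃ t s, HaltsIn P (input G p L) t s ∧
      t ≤ C' * (m + n + G.totalColor + 1) ^ k' ∧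
      ((∀ N, 0 < N → N ≤ C * (sqColor G + 1) ^ k → TrivialKernel G p L N) → s.reg 0 = 1) ∧
      ((¬ ∀ N, 0 < N → N ≤ C * (sqColor G + 1) ^ k → TrivialKernel G p L N) → s.reg 0 = 0) := by
  obtain ⟨C', k', h⟩ := (main d C k).cost_polyBdd.comp (sizeBound_polyBdd d C k)
  refine ⟨(main d C k).code 0, C', k', fun n m G p L => ?_⟩
  obtain ⟨hB, hQ⟩ := main_ok C k G p L
  obtain ⟨t, s, hs, ht, hR, -⟩ := (St.runs _ _ _ _ (rep_input G p L) hB 0).haltsIn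
  refine ⟨t, s, hs, ht.trans (h _), ?_⟩
  rw [show s.reg 0 = _ from hR.rat 0]
  exact hQ

end RatRAM

namespace ColoredGraph

open RatRAM

variable {d n m : ℕ}

/-! ## Ultrarigidity in terms of periodic functions with sum zero -/

/-- Reduction modulo `N`. -/
def reduce (d N : ℕ) : (Fin d → ℤ) →+ (Fin d → ZMod N) :=
  (Int.castAddHom (ZMod N)).compLeft (Fin d)

theorem reduce_apply (N : ℕ) (g : Fin d → ℤ) (k : Fin d) : reduce d N g k = (g k : ZMod N) := rfl

/-- Every `N ℤ ^ d`-periodic velocity field with sum zero that preserves the lengths of all edges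
vanishes. -/
def PeriodicKernelTrivial (G : ColoredGraph d n m) (x : Fin m → Fin d → ℝ) (N : ℕ) [NeZero N] :
    Prop :=
  ∀ w : Fin n → (Fin d → ZMod N) → Fin d → ℝ, (∀ i, ∑ c, w i c = 0) →
    (∀ e c, x e ⬝ᵥ (w (G.head e) (c + reduce d N (G.color e)) - w (G.tail e) c) = 0) → w = 0

theorem latticeMap_add (L : Matrix (Fin d) (Fin d) ℝ) (g h : Fin d → ℤ) :
    latticeMap L (g + h) = latticeMap L g + latticeMap L h := by
  rw [latticeMap, latticeMap, latticeMap, ← Matrix.mulVec_add]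
  congr 1
  ext k
  simp

theorem placement_sub (G : ColoredGraph d n m) (p : Fin n → Fin d → ℝ)
    (L : Matrix (Fin d) (Fin d) ℝ) (e : Fin m) (g : Fin d → ℤ) :
    placement p L (G.head e, g + G.color e) - placement p L (G.tail e, g) = edgeDiff G p L e := by
  ext k
  simp only [placement, latticeMap_add, Pi.sub_apply, Pi.add_apply, edgeDiff]
  simp only [latticeMap, Matrix.mulVec, dotProduct]
  ring

theorem motions_mono (G : ColoredGraph d n m) (p : Fin n → Fin d → ℝ)
    (L : Matrix (Fin d) (Fin d) ℝ) {Λ Λ' : AddSubgroup (Fin d → ℤ)} (h : Λ ≤ Λ') :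
    G.motions p L Λ' ≤ G.motions p L Λ :=
  fun _ hw => ⟨fun i g l hl => hw.1 i g l (h hl), hw.2⟩

theorem reduce_surjective {N : ℕ} [NeZero N] : Function.Surjective (reduce d N) := fun c =>
  ⟨fun k => ((c k).val : ℤ), by ext k; simp [reduce_apply]⟩

/-- Remove the linear part `M g` from a motion. What remains is a function `u` on `(ℤ/N)^d`. Its
average `a`, together with `M`, is again a motion, because the edge equations are affine in `u` with
coefficients independent of the group element. So `u - a` has sum zero and satisfies the homogeneous
equations; by hypothesis it vanishes, and the motion is `ℤ^d`-periodic. -/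
theorem motions_le_of_periodicKernelTrivial (G : ColoredGraph d n m) (p : Fin n → Fin d → ℝ)
    (L : Matrix (Fin d) (Fin d) ℝ) (N : ℕ) [NeZero N]
    (h : G.PeriodicKernelTrivial (edgeDiff G p L) N) :
    G.motions p L (reduce d N).ker ≤ G.motions p L ⊤ := by
  rintro ⟨v, M⟩ ⟨hper, hedge⟩
  simp only at hper hedge
  set lift : (Fin d → ZMod N) → (Fin d → ℤ) := fun c k => ((c k).val : ℤ) with hlift
  have hred : ∀ c, reduce d N (lift c) = c := fun c => by ext k; simp [hlift, reduce_apply]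
  set u : Fin n → (Fin d → ZMod N) → Fin d → ℝ :=
    fun i c => v (i, lift c) - latticeMap M (lift c) with hu
  have hv : ∀ i g, v (i, g) = u i (reduce d N g) + latticeMap M g := by
    intro i g
    have h1 := hper i (lift (reduce d N g)) (g - lift (reduce d N g))
      (by rw [AddMonoidHom.mem_ker, map_sub, hred, sub_self])
    have h2 := latticeMap_add M (lift (reduce d N g)) (g - lift (reduce d N g))
    rw [add_sub_cancel] at h1 h2
    rw [h1, hu, h2]
    simp only
    abel
  set a : Fin n → Fin d → ℝ := fun i => (Fintype.card (Fin d → ZMod N) : ℝ)⁻¹ • ∑ c, u i c with ha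
  have hcard : (Fintype.card (Fin d → ZMod N) : ℝ) ≠ 0 := by
    exact_mod_cast Fintype.card_ne_zero
  have hsum : ∀ i, ∑ c, u i c = (Fintype.card (Fin d → ZMod N) : ℝ) • a i := fun i => by
    rw [ha]; simp only; rw [smul_inv_smul₀ hcard]
  have hedge' : ∀ e c, edgeDiff G p L e ⬝ᵥ (u (G.head e) (c + reduce d N (G.color e)) -
      u (G.tail e) c + latticeMap M (G.color e)) = 0 := by
    intro e c
    have h1 := hedge e (lift c)
    rw [placement_sub, hv, hv, map_add, hred, latticeMap_add] at h1
    rw [← h1]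
    congr 1
    abel
  have havg : ∀ e, edgeDiff G p L e ⬝ᵥ (a (G.head e) - a (G.tail e) +
      latticeMap M (G.color e)) = 0 := by
    intro e
    have h1 : ∑ c, edgeDiff G p L e ⬝ᵥ (u (G.head e) (c + reduce d N (G.color e)) -
      u (G.tail e) c + latticeMap M (G.color e)) = 0 := Finset.sum_eq_zero fun c _ => hedge' e c
    have h2 : ∑ c, u (G.head e) (c + reduce d N (G.color e)) = ∑ c, u (G.head e) c :=
      Equiv.sum_comp (Equiv.addRight (reduce d N (G.color e))) (u (G.head e))
    rw [← dotProduct_sum, Finset.sum_add_distrib, Finset.sum_sub_distrib, h2, hsum, hsum, Finset.sum_const, Finset.card_univ, ← Nat.cast_smul_eq_nsmul ℝ,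
      ← smul_sub, ← smul_add, dotProduct_smul, smul_eq_mul] at h1
    exact (mul_eq_zero.1 h1).resolve_left hcard
  have hw := h (fun i c => u i c - a i) (fun i => by
      rw [Finset.sum_sub_distrib, hsum, Finset.sum_const, Finset.card_univ,
        ← Nat.cast_smul_eq_nsmul ℝ, sub_self]) (fun e c => by
      have h1 := hedge' e c
      have h2 := havg e
      rw [← sub_zero (0 : ℝ)]
      nth_rewrite 1 [← h1]
      rw [← h2, ← dotProduct_sub]
      congr 1
      abel)
  have hua : ∀ i c, u i c = a i := fun i c => sub_eq_zero.1 (congrFun (congrFun hw i) c)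
  refine ⟨fun i g l _ => ?_, hedge⟩
  simp only
  rw [hv, hv, hua, hua, latticeMap_add, add_assoc]

/-- A kernel element is a relaxed motion with `M = 0`. If it is `ℤ^d`-periodic, it is constant along
the group, and its sum vanishes only if it does. -/
theorem periodicKernelTrivial_of_motions_eq (G : ColoredGraph d n m) (p : Fin n → Fin d → ℝ)
    (L : Matrix (Fin d) (Fin d) ℝ) (N : ℕ) [NeZero N]
    (h : G.motions p L (reduce d N).ker = G.motions p L ⊤) :
    G.PeriodicKernelTrivial (edgeDiff G p L) N := by
  intro w hsum hedge
  have hmem : ((fun y => w y.1 (reduce d N y.2), 0) :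
      (Fin n × (Fin d → ℤ) → Fin d → ℝ) × Matrix (Fin d) (Fin d) ℝ) ∈
      G.motions p L (reduce d N).ker := by
    refine ⟨fun i g l hl => ?_, fun e g => ?_⟩
    · simp only
      rw [map_add, (AddMonoidHom.mem_ker).1 hl, add_zero]
      simp [latticeMap]
    · rw [placement_sub]
      simp only [map_add]
      exact hedge e _
  rw [h] at hmem
  have hconst : ∀ i c, w i c = w i 0 := by
    intro i c
    obtain ⟨g, rfl⟩ := reduce_surjective c
    have := hmem.1 i 0 g trivial
    simpa [latticeMap] using this
  ext i c : 2
  rw [hconst]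
  have h1 := hsum i
  rw [Finset.sum_congr rfl fun c _ => hconst i c, Finset.sum_const, Finset.card_univ,
    ← Nat.cast_smul_eq_nsmul ℝ] at h1
  exact (smul_eq_zero.1 h1).resolve_left (by exact_mod_cast Fintype.card_ne_zero)

theorem isInfUltrarigid_iff (G : ColoredGraph d n m) (p : Fin n → Fin d → ℝ)
    (L : Matrix (Fin d) (Fin d) ℝ) (hrig : G.IsInfRigid p L) :
    G.IsInfUltrarigid p L ↔
      ∀ N [NeZero N], G.PeriodicKernelTrivial (edgeDiff G p L) N := by
  constructor
  · intro h N _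
    -- For `d = 0` the prescribed dimension is `0`, and a `finrank` of `0` does not certify finite
    -- dimension.
    rcases Nat.eq_zero_or_pos d with rfl | hd
    · intro w _ _
      ext i c k
      exact k.elim0
    refine G.periodicKernelTrivial_of_motions_eq p L N ?_
    have h1 : Module.finrank ℝ (G.motions p L (reduce d N).ker) = (d + 1).choose 2 :=
      h _ inferInstance
    have : Module.Finite ℝ (G.motions p L (reduce d N).ker) :=
      Module.finite_of_finrank_pos (by rw [h1]; exact Nat.choose_pos (by omega))
    exact (Submodule.eq_of_le_of_finrank_eq (G.motions_mono p L le_top)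
      (Eq.trans hrig h1.symm)).symm
  · intro h Λ hΛ
    have : NeZero Λ.index := ⟨hΛ.index_ne_zero⟩
    -- The index annihilates the quotient by `Λ`, so the motions for `Λ` lie between those for `ℤ^d`
    -- and those for `Λ.index • ℤ^d`.
    have hle : (reduce d Λ.index).ker ≤ Λ := by
      intro g hg
      have hdvd : ∀ k, ((Λ.index : ℕ) : ℤ) ∣ g k := fun k => by
        have := congrFun ((AddMonoidHom.mem_ker).1 hg) k
        rwa [reduce_apply, Pi.zero_apply, ZMod.intCast_zmod_eq_zero_iff_dvd] at this
      choose q hq using hdvd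
      have : g = Λ.index • q := by
        ext k
        rw [hq k]
        simp
      rw [this]
      exact Λ.nsmul_index_mem q
    have h1 := (G.motions_mono p L hle).trans (G.motions_le_of_periodicKernelTrivial p L _ (h _))
    rw [IsInfRigidRel, le_antisymm h1 (G.motions_mono p L le_top)]
    exact hrig

end ColoredGraph

namespace ColoredGraph

open RatRAM

variable {d n m : ℕ}

/-! ## The linear systems of the program compute periodic kernels -/

def zmodEquivFin (N : ℕ) [NeZero N] : ZMod N ≃ Fin N where
  toFun a := ⟨a.val, ZMod.val_lt a⟩
  invFun i := ((i : ℕ) : ZMod N)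
  left_inv a := by simp
  right_inv i := by ext; exact ZMod.val_cast_of_lt i.2

/-- The codes of the elements of `(ℤ / N) ^ d`. -/
def groupCode (d N : ℕ) [NeZero N] : (Fin d → ZMod N) ≃ Fin (N ^ d) :=
  (Equiv.arrowCongr (Equiv.refl _) (zmodEquivFin N)).trans finFunctionFinEquiv

theorem groupCode_apply {N : ℕ} [NeZero N] (c : Fin d → ZMod N) :
    (groupCode d N c : ℕ) = ∑ l, (c l).val * N ^ (l : ℕ) := rfl

theorem groupCode_digit {N : ℕ} [NeZero N] (c : Fin d → ZMod N) (l : Fin d) :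
    (groupCode d N c : ℕ) / N ^ (l : ℕ) % N = (c l).val := by
  have h : ((finFunctionFinEquiv.symm (groupCode d N c)) l : ℕ) = (c l).val := by
    simp [groupCode, zmodEquivFin]
  rw [← h]; rfl

/-- The code lists the coordinates as digits in base `N`, and the group law adds digits modulo `N`
without carry. -/
theorem groupCode_add {N : ℕ} [NeZero N] (c : Fin d → ZMod N) (g : Fin d → ℤ) :
    (groupCode d N (c + reduce d N g) : ℕ) = shiftCode d N (extend g) (groupCode d N c) := by
  rw [groupCode_apply, shiftCode, Finset.sum_range]
  refine Finset.sum_congr rfl fun l _ => ?_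
  rw [groupCode_digit, extend_apply, mul_comm]
  congr 1
  have h : c l + (g l : ZMod N) = (((c l).val + g l : ℤ) : ZMod N) := by simp
  rw [Pi.add_apply, reduce_apply, h, ← ZMod.val_intCast, Int.toNat_natCast]

/-- The codes of the coordinates of all vertices. -/
def coordCode (d n N : ℕ) [NeZero N] :
    (Fin d → ZMod N) × Fin n × Fin d ≃ Fin (N ^ d * (n * d)) :=
  ((groupCode d N).prodCongr finProdFinEquiv).trans finProdFinEquiv

theorem coordCode_apply {N : ℕ} [NeZero N] (c : Fin d → ZMod N) (i : Fin n) (k : Fin d) :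
    (coordCode d n N (c, i, k) : ℕ) = groupCode d N c * (n * d) + i * d + k := by
  simp [coordCode, finProdFinEquiv]
  ring

theorem coordCode_mod {N : ℕ} [NeZero N] (c c' : Fin d → ZMod N) (i i' : Fin n) (k k' : Fin d) :
    (coordCode d n N (c, i, k) : ℕ) % (n * d) = coordCode d n N (c', i', k') % (n * d) ↔
      i = i' ∧ k = k' := by
  have hlt : ∀ (i : Fin n) (k : Fin d), (i : ℕ) * d + k < n * d := fun i k => by
    have := Nat.mul_le_mul_right d (Nat.succ_le_of_lt i.2)
    rw [Nat.succ_mul] at this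
    omega
  have hmod : ∀ (c : Fin d → ZMod N) (i : Fin n) (k : Fin d),
      (coordCode d n N (c, i, k) : ℕ) % (n * d) = i * d + k := fun c i k => by
    rw [coordCode_apply, add_assoc, mul_comm, Nat.mul_add_mod, Nat.mod_eq_of_lt (hlt i k)]
  rw [hmod, hmod, idx_inj k.2 k'.2, Fin.ext_iff, Fin.ext_iff]

/-- The index modulo `n * d` forgets exactly the group element, so a residue class collects all
translates of one coordinate of one vertex. -/
theorem sumZero_iff {N : ℕ} [NeZero N] (w : Fin n → (Fin d → ZMod N) → Fin d → ℝ)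
    (x : Fin (N ^ d * (n * d)) → ℝ) (hx : ∀ c i k, x (coordCode d n N (c, i, k)) = w i c k) :
    SumZero (n * d) x ↔ ∀ i, ∑ c, w i c = 0 := by
  have key : ∀ c i k, ∑ j : Fin (N ^ d * (n * d)),
      (if (coordCode d n N (c, i, k) : ℕ) % (n * d) = j % (n * d) then x j else 0) =
      (∑ c, w i c) k := by
    intro c i k
    rw [← Equiv.sum_comp (coordCode d n N), Fintype.sum_prod_type, Finset.sum_apply]
    refine Finset.sum_congr rfl fun c' _ => ?_
    rw [Finset.sum_eq_single (i, k)]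
    · rw [if_pos ((coordCode_mod _ _ _ _ _ _).2 ⟨rfl, rfl⟩), hx]
    · rintro ⟨i', k'⟩ _ hne
      rw [if_neg]
      rw [coordCode_mod]
      rintro ⟨rfl, rfl⟩
      exact hne rfl
    · simp
  constructor
  · intro h i
    ext k
    rw [← key 0 i k]
    exact h _
  · intro h j
    obtain ⟨⟨c, i, k⟩, rfl⟩ := (coordCode d n N).surjective j
    rw [key, h]
    rfl

theorem cast_edgeVec {K u v : ℕ} (x : ℕ → ℚ) (r : Fin K) :
    ((edgeVec d K u v x r : ℚ) : ℝ) = edgeVec d K u v (fun k => (x k : ℝ)) r := by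
  simp only [edgeVec]
  push_cast
  refine Finset.sum_congr rfl fun k _ => ?_
  split_ifs <;> simp

theorem eqVec_dotProduct {N : ℕ} [NeZero N] (G : ColoredGraph d n m) (p : Fin n → Fin d → ℚ)
    (L : Matrix (Fin d) (Fin d) ℚ) (w : Fin n → (Fin d → ZMod N) → Fin d → ℝ)
    (x : Fin (N ^ d * (n * d)) → ℝ) (hx : ∀ c i k, x (coordCode d n N (c, i, k)) = w i c k)
    (e : Fin m) (c : Fin d → ZMod N) :
    (fun r => (eqVec G p L N e (groupCode d N c) r : ℝ)) ⬝ᵥ x =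
      edgeDiff G (fun i j => (p i j : ℝ)) (L.map fun q => (q : ℝ)) e ⬝ᵥ
        (w (G.head e) (c + reduce d N (G.color e)) - w (G.tail e) c) := by
  have hy : x = fun r : Fin (N ^ d * (n * d)) => extend x (r : ℕ) := by ext r; rw [extend_apply]
  have hyc : ∀ (c : Fin d → ZMod N) (i : Fin n) (k : Fin d),
      extend x (groupCode d N c * (n * d) + i * d + k) = w i c k := fun c i k => by
    rw [← coordCode_apply, extend_apply, hx]
  have hpos : ∀ (c : Fin d → ZMod N) (i : Fin n),
      groupCode d N c * (n * d) + i * d + d ≤ N ^ d * (n * d) := by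
    intro c i
    have h1 := Nat.mul_le_mul_right (n * d) (Nat.succ_le_of_lt (groupCode d N c).2)
    have h2 := Nat.mul_le_mul_right d (Nat.succ_le_of_lt i.2)
    rw [Nat.succ_mul] at h1 h2
    omega
  rw [hy]
  simp only [eqVec, cast_edgeVec]
  rw [← groupCode_add]
  refine (edgeVec_dotProduct _ (extend x) (hpos _ _) (hpos _ _)).trans ?_
  rw [Finset.sum_range, dotProduct]
  refine Finset.sum_congr rfl fun k _ => ?_
  rw [hyc, hyc, extend_apply, Pi.sub_apply]
  congr 1
  simp [edgeDiff]

theorem trivialKernel_iff (G : ColoredGraph d n m) (p : Fin n → Fin d → ℚ)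
    (L : Matrix (Fin d) (Fin d) ℚ) (N : ℕ) [NeZero N] :
    TrivialKernel G p L N ↔ G.PeriodicKernelTrivial
      (edgeDiff G (fun i j => (p i j : ℝ)) (L.map fun q => (q : ℝ))) N := by
  constructor
  · intro h w hsum hedge
    set x : Fin (N ^ d * (n * d)) → ℝ := fun r =>
      w ((coordCode d n N).symm r).2.1 ((coordCode d n N).symm r).1
        ((coordCode d n N).symm r).2.2 with hxdef
    have hx : ∀ c i k, x (coordCode d n N (c, i, k)) = w i c k := fun c i k => by simp [x]
    have h0 := h x ((sumZero_iff w x hx).2 hsum) fun e c hc => by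
      obtain ⟨c', hc'⟩ := (groupCode d N).surjective ⟨c, hc⟩
      have h1 := eqVec_dotProduct G p L w x hx e c'
      rw [hc', hedge] at h1
      exact h1
    ext i c k
    rw [← hx, h0]
    rfl
  · intro h x hsum hedge
    set w : Fin n → (Fin d → ZMod N) → Fin d → ℝ := fun i c k => x (coordCode d n N (c, i, k))
      with hw
    have hx : ∀ c i k, x (coordCode d n N (c, i, k)) = w i c k := fun c i k => rfl
    have h0 := h w ((sumZero_iff w x hx).1 hsum) fun e c => by
      rw [← eqVec_dotProduct G p L w x hx e c]
      exact hedge e _ (groupCode d N c).2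
    ext r
    obtain ⟨⟨c, i, k⟩, rfl⟩ := (coordCode d n N).surjective r
    rw [hx, h0]
    rfl

end ColoredGraph

namespace ColoredGraph

open RatRAM

variable {d n m : ℕ}

/-! ## Characters -/

/-- The Laurent monomial `ω ^ g`. -/
def mono (ω : Fin d → ℂˣ) (g : Fin d → ℤ) : ℂˣ := ∏ l, ω l ^ g l

theorem mono_add (ω : Fin d → ℂˣ) (g h : Fin d → ℤ) : mono ω (g + h) = mono ω g * mono ω h := by
  simp [mono, zpow_add, Finset.prod_mul_distrib]

theorem mono_single (ω : Fin d → ℂˣ) (l : Fin d) : mono ω (Pi.single l 1) = ω l := by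
  rw [mono, Finset.prod_eq_single l]
  · simp
  · intro k _ hk
    simp [hk]
  · simp

theorem zpow_congr {z : ℂˣ} {N : ℕ} (hz : z ^ N = 1) {a b : ℤ} (h : a ≡ b [ZMOD N]) :
    z ^ a = z ^ b :=
  zpow_eq_zpow_iff_modEq.2 (h.of_dvd (Int.natCast_dvd_natCast.2 (orderOf_dvd_of_pow_eq_one hz)))

theorem addChar_map_sum {A ι M : Type*} [AddCommMonoid A] [CommMonoid M] (ψ : AddChar A M)
    (s : Finset ι) (f : ι → A) : ψ (∑ i ∈ s, f i) = ∏ i ∈ s, ψ (f i) := by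
  classical
  induction s using Finset.induction_on with
  | empty => simp
  | insert i s hi ih => rw [Finset.sum_insert hi, Finset.prod_insert hi, AddChar.map_add_eq_mul, ih]

/-- There is a nonzero motion that is multiplied by `ω ^ g` under translation by `g`. -/
def Degenerate (G : ColoredGraph d n m) (x : Fin m → Fin d → ℚ) (ω : Fin d → ℂˣ) : Prop :=
  ∃ u : Fin n → Fin d → ℂ, u ≠ 0 ∧ ∀ e, ∑ k, (x e k : ℂ) *
    ((mono ω (G.color e) : ℂˣ) * u (G.head e) k - u (G.tail e) k) = 0

theorem mono_lift_add {ω : Fin d → ℂˣ} {N : ℕ} [NeZero N] (hω : ∀ l, ω l ^ N = 1)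
    (c : Fin d → ZMod N) (g : Fin d → ℤ) :
    mono ω (fun l => ((c + reduce d N g) l).val) = mono ω (fun l => (c l).val) * mono ω g := by
  rw [← mono_add]
  refine Finset.prod_congr rfl fun l _ => zpow_congr (hω l) ?_
  rw [← ZMod.intCast_eq_intCast_iff]
  simp [reduce_apply]

/-- Extend `u` to the whole group by the character `χ` that belongs to `ω`. The sum over the group
vanishes since `ω ≠ 1`, and the edge equations are real, so the real and the imaginary part both lie
in the kernel. -/
theorem not_degenerate_of_periodicKernelTrivial (G : ColoredGraph d n m) (x : Fin m → Fin d → ℚ)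
    {N : ℕ} [NeZero N] (h : G.PeriodicKernelTrivial (fun e k => (x e k : ℝ)) N)
    {ω : Fin d → ℂˣ} (hω : ∀ l, ω l ^ N = 1) (hω1 : ω ≠ 1) : ¬ G.Degenerate x ω := by
  rintro ⟨u, hu, hedge⟩
  set χ : (Fin d → ZMod N) → ℂ := fun c => (mono ω (fun l => (c l).val) : ℂˣ) with hχ
  have hadd : ∀ c g, χ (c + reduce d N g) = χ c * (mono ω g : ℂˣ) := fun c g => by
    simp only [hχ, mono_lift_add hω, Units.val_mul]
  have hχ0 : χ 0 = 1 := by simp [hχ, mono]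
  have hsum : ∑ c, χ c = 0 := by
    obtain ⟨l, hl⟩ := Function.ne_iff.1 hω1
    have h1 : ∑ c, χ c = (∑ c, χ c) * ω l := by
      conv_lhs => rw [← Equiv.sum_comp (Equiv.addRight (reduce d N (Pi.single l 1)))]
      simp only [Equiv.coe_addRight, hadd, mono_single, Finset.sum_mul]
    have h2 : (∑ c, χ c) * ((ω l : ℂ) - 1) = 0 := by rw [mul_sub, ← h1]; ring
    refine (mul_eq_zero.1 h2).resolve_right fun h => hl ?_
    exact Units.ext (by simpa using sub_eq_zero.1 h)
  have hedge' : ∀ e c, ∑ k, (x e k : ℂ) * (χ (c + reduce d N (G.color e)) * u (G.head e) k -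
      χ c * u (G.tail e) k) = 0 := by
    intro e c
    rw [← mul_zero (χ c), ← hedge e, Finset.mul_sum]
    refine Finset.sum_congr rfl fun k _ => ?_
    rw [hadd]
    ring
  have hre := h (fun i c k => (χ c * u i k).re) (fun i => by
      ext k
      rw [Finset.sum_apply, ← Complex.re_sum, ← Finset.sum_mul, hsum]
      simp) (fun e c => by
      have h1 := congrArg Complex.re (hedge' e c)
      rw [Complex.re_sum, Complex.zero_re] at h1
      rw [← h1]
      refine Finset.sum_congr rfl fun k _ => ?_
      simp only [Pi.sub_apply]
      rw [← Complex.sub_re, ← Complex.ofReal_ratCast, Complex.re_ofReal_mul])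
  have him := h (fun i c k => (χ c * u i k).im) (fun i => by
      ext k
      rw [Finset.sum_apply, ← Complex.im_sum, ← Finset.sum_mul, hsum]
      simp) (fun e c => by
      have h1 := congrArg Complex.im (hedge' e c)
      rw [Complex.im_sum, Complex.zero_im] at h1
      rw [← h1]
      refine Finset.sum_congr rfl fun k _ => ?_
      simp only [Pi.sub_apply]
      rw [← Complex.sub_im, ← Complex.ofReal_ratCast, Complex.im_ofReal_mul])
  refine hu ?_
  ext i k
  have h1 := congrFun (congrFun (congrFun hre i) 0) k
  have h2 := congrFun (congrFun (congrFun him i) 0) k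
  simp only [hχ0, one_mul] at h1 h2
  exact Complex.ext h1 h2

/-- The witness is a nonzero Fourier coefficient of a kernel element, as translation by `g` acts on
coefficients as a scalar `ω ^ g`. The coefficient at the trivial character is the sum over the
group, which is zero; hence `ω ≠ 1`. -/
theorem exists_degenerate_of_not_periodicKernelTrivial (G : ColoredGraph d n m)
    (x : Fin m → Fin d → ℚ) {N : ℕ} [NeZero N]
    (h : ¬ G.PeriodicKernelTrivial (fun e k => (x e k : ℝ)) N) :
    ∃ ω : Fin d → ℂˣ, (∀ l, ω l ^ N = 1) ∧ ω ≠ 1 ∧ G.Degenerate x ω := by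
  classical
  simp only [PeriodicKernelTrivial, not_forall] at h
  obtain ⟨w, hsum, hedge, hw⟩ := h
  obtain ⟨i₀, hw⟩ := Function.ne_iff.1 hw
  obtain ⟨c₀, hw⟩ := Function.ne_iff.1 hw
  obtain ⟨k₀, hw⟩ := Function.ne_iff.1 hw
  -- Fourier inversion at `c₀`: if all coefficients vanished, so would the value there.
  obtain ⟨ψ, hψ⟩ : ∃ ψ : AddChar (Fin d → ZMod N) ℂ, ∑ c, ψ (-c) * (w i₀ c k₀ : ℂ) ≠ 0 := by
    by_contra! hall
    have h1 : ∑ ψ : AddChar (Fin d → ZMod N) ℂ, ψ c₀ * ∑ c, ψ (-c) * (w i₀ c k₀ : ℂ) = 0 :=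
      Finset.sum_eq_zero fun ψ _ => by rw [hall ψ, mul_zero]
    simp only [Finset.mul_sum, ← mul_assoc, ← AddChar.map_add_eq_mul] at h1
    rw [Finset.sum_comm] at h1
    simp only [← Finset.sum_mul, AddChar.sum_apply_eq_ite] at h1
    rw [Finset.sum_eq_single c₀] at h1
    · rw [add_neg_cancel, if_pos rfl] at h1
      rcases mul_eq_zero.1 h1 with h2 | h2
      · exact Fintype.card_ne_zero (by exact_mod_cast h2)
      · exact hw (by exact_mod_cast h2)
    · intro c _ hc
      rw [if_neg, zero_mul]
      intro h2
      exact hc (sub_eq_zero.1 (by rwa [sub_eq_add_neg])).symm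
    · simp
  have hunit : ∀ a, IsUnit (ψ a) := fun a =>
    IsUnit.of_mul_eq_one (ψ (-a)) (by rw [← AddChar.map_add_eq_mul, add_neg_cancel, AddChar.map_zero_eq_one])
  set ω : Fin d → ℂˣ := fun l => (hunit (reduce d N (Pi.single l 1))).unit with hω
  have hmono : ∀ g, ((mono ω g : ℂˣ) : ℂ) = ψ (reduce d N g) := by
    intro g
    have hg : g = ∑ l, g l • (Pi.single l 1 : Fin d → ℤ) := by
      conv_lhs => rw [← Finset.univ_sum_single g]
      refine Finset.sum_congr rfl fun l _ => ?_
      rw [← Pi.single_smul]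
      simp
    conv_rhs => rw [hg, map_sum, addChar_map_sum]
    rw [mono, Units.coe_prod]
    refine Finset.prod_congr rfl fun l _ => ?_
    rw [map_zsmul, AddChar.map_zsmul_eq_zpow, Units.val_zpow_eq_zpow_val]
    rfl
  refine ⟨ω, fun l => ?_, ?_, fun i k => ∑ c, ψ (-c) * (w i c k : ℂ), ?_, fun e => ?_⟩
  · ext
    rw [Units.val_pow_eq_pow_val, Units.val_one, hω]
    simp only [IsUnit.unit_spec]
    rw [← AddChar.map_nsmul_eq_pow, ← map_nsmul]
    have : reduce d N (N • Pi.single l 1) = 0 := by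
      ext k
      simp [reduce_apply]
    rw [this, AddChar.map_zero_eq_one]
  · intro h1
    refine hψ ?_
    have hone : ∀ c, ψ c = 1 := fun c => by
      obtain ⟨g, rfl⟩ := reduce_surjective c
      rw [← hmono, h1]
      simp [mono]
    simp only [hone, one_mul]
    have := congrFun (hsum i₀) k₀
    rw [Finset.sum_apply] at this
    exact_mod_cast this
  · intro h0
    exact hψ (congrFun (congrFun h0 i₀) k₀)
  · have hshift : ∀ k, (mono ω (G.color e) : ℂˣ) * ∑ c, ψ (-c) * (w (G.head e) c k : ℂ) =
        ∑ c, ψ (-c) * (w (G.head e) (c + reduce d N (G.color e)) k : ℂ) := by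
      intro k
      conv_lhs => rw [← Equiv.sum_comp (Equiv.addRight (reduce d N (G.color e)))]
      rw [hmono, Finset.mul_sum]
      refine Finset.sum_congr rfl fun c _ => ?_
      have h1 : reduce d N (G.color e) + -(c + reduce d N (G.color e)) = -c := by abel
      rw [Equiv.coe_addRight, ← mul_assoc, ← AddChar.map_add_eq_mul, h1]
    simp only [hshift, ← Finset.sum_sub_distrib, Finset.mul_sum]
    rw [Finset.sum_comm]
    refine Finset.sum_eq_zero fun c _ => ?_
    have h1 := congrArg (fun r : ℝ => ψ (-c) * (r : ℂ)) (hedge e c)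
    simp only [dotProduct, Complex.ofReal_zero, mul_zero] at h1
    rw [← h1]
    push_cast
    rw [Finset.mul_sum]
    refine Finset.sum_congr rfl fun k _ => ?_
    simp only [Pi.sub_apply]
    push_cast
    ring

theorem periodicKernelTrivial_iff (G : ColoredGraph d n m) (x : Fin m → Fin d → ℚ) (N : ℕ)
    [NeZero N] : G.PeriodicKernelTrivial (fun e k => (x e k : ℝ)) N ↔
      ∀ ω : Fin d → ℂˣ, (∀ l, ω l ^ N = 1) → ω ≠ 1 → ¬ G.Degenerate x ω := by
  refine ⟨fun h ω hω h1 => G.not_degenerate_of_periodicKernelTrivial x h hω h1, fun h => ?_⟩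
  by_contra hc
  obtain ⟨ω, hω, h1, hd⟩ := G.exists_degenerate_of_not_periodicKernelTrivial x hc
  exact h ω hω h1 hd

end ColoredGraph

/-! ## Elementary number theory -/

/-- This says that `φ(N)` is at least a constant times `N^(1 - 1/k)`. From `p ≤ 2 (p - 1)` follows
`p^k ≤ 2^k (p - 1)^k`. The factor `2^k` is absorbed by `p` if `p ≥ 2^k`; the fewer than `2^k`
smaller primes account for the constant, and the product of all `p ∣ N` is at most `N`. -/
theorem Nat.pow_le_mul_totient_pow (k N : ℕ) (hN : 0 < N) :
    N ^ k ≤ (2 ^ k) ^ (2 ^ k) * N * N.totient ^ k := by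
  have h1 : ∏ p ∈ N.primeFactors, p ^ k ≤
      ∏ p ∈ N.primeFactors, ((if p < 2 ^ k then 2 ^ k else 1) * p * (p - 1) ^ k) := by
    refine Finset.prod_le_prod' fun p hp => ?_
    have hp2 := (Nat.prime_of_mem_primeFactors hp).two_le
    have h2 : p ^ k ≤ 2 ^ k * (p - 1) ^ k := by
      rw [← mul_pow]
      exact Nat.pow_le_pow_left (by omega) k
    split_ifs with h
    · refine h2.trans (Nat.mul_le_mul_right _ (Nat.le_mul_of_pos_right _ (by omega)))
    · rw [one_mul]
      exact h2.trans (Nat.mul_le_mul_right _ (by omega))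
  have h2 : ∏ p ∈ N.primeFactors, (if p < 2 ^ k then 2 ^ k else 1) ≤ (2 ^ k) ^ (2 ^ k) := by
    rw [Finset.prod_ite, Finset.prod_const, Finset.prod_const_one, mul_one]
    refine Nat.pow_le_pow_right (by positivity) ?_
    calc _ ≤ (Finset.range (2 ^ k)).card := Finset.card_le_card fun p hp => by
            simpa using (Finset.mem_filter.1 hp).2
      _ = 2 ^ k := Finset.card_range _
  rw [Finset.prod_mul_distrib, Finset.prod_mul_distrib, Finset.prod_pow, Finset.prod_pow] at h1
  have h3 : ∏ p ∈ N.primeFactors, p ≤ N := Nat.le_of_dvd hN (Nat.prod_primeFactors_dvd N)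
  have h4 := Nat.totient_mul_prod_primeFactors N
  have hpos : 0 < ∏ p ∈ N.primeFactors, (p - 1) := Finset.prod_pos fun p hp => by
    have := (Nat.prime_of_mem_primeFactors hp).two_le
    omega
  refine Nat.le_of_mul_le_mul_right ?_ (pow_pos hpos k)
  calc N ^ k * (∏ p ∈ N.primeFactors, (p - 1)) ^ k
      = (∏ p ∈ N.primeFactors, p) ^ k * N.totient ^ k := by
        rw [← mul_pow, ← h4, mul_pow, mul_comm]
    _ ≤ ((2 ^ k) ^ (2 ^ k) * N * (∏ p ∈ N.primeFactors, (p - 1)) ^ k) * N.totient ^ k := by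
        refine Nat.mul_le_mul_right _ (h1.trans ?_)
        gcongr
    _ = _ := by ring

theorem Nat.exists_coprime_decomposition (N u : ℕ) (hN : 0 < N) :
    ∃ N₁ N₂, N = N₁ * N₂ ∧ N₁.Coprime N₂ ∧ N₂.Coprime u ∧ ∀ p, p.Prime → p ∣ N₁ → p ∣ u := by
  induction N using Nat.recOnPosPrimePosCoprime with
  | zero => omega
  | one => exact ⟨1, 1, by simp, by simp, by simp, fun p hp h => by simp_all⟩
  | prime_pow p k hp hk =>
    by_cases h : p ∣ u
    · refine ⟨p ^ k, 1, by simp, by simp, by simp, fun q hq hqp => ?_⟩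
      rwa [(Nat.prime_dvd_prime_iff_eq hq hp).1 (hq.dvd_of_dvd_pow hqp)]
    · exact ⟨1, p ^ k, by simp, by simp, ((Nat.Prime.coprime_iff_not_dvd hp).2 h).pow_left k,
        fun q hq h => by simp_all⟩
  | coprime a b ha hb hab iha ihb =>
    obtain ⟨a₁, a₂, rfl, ha12, hau, hpa⟩ := iha (by omega)
    obtain ⟨b₁, b₂, rfl, hb12, hbu, hpb⟩ := ihb (by omega)
    have h12 : a₁.Coprime b₂ := (hab.coprime_mul_right).coprime_mul_left_right
    have h21 : b₁.Coprime a₂ := ((hab.coprime_mul_left).coprime_mul_right_right).symm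
    refine ⟨a₁ * b₁, a₂ * b₂, by ring, ?_, hau.mul_left hbu, fun p hp h => ?_⟩
    · exact Nat.Coprime.mul_left (ha12.mul_right h12) (h21.mul_right hb12)
    · exact (hp.dvd_mul.1 h).elim (hpa p hp) (hpb p hp)

/-- At least `φ N` of the numbers `1 + t u` with `t < N` are coprime to `N`. -/
theorem Nat.totient_le_card_coprime_one_add_mul (N u : ℕ) (hN : 0 < N) :
    N.totient ≤ ((Finset.range N).filter fun t => (1 + t * u).Coprime N).card := by
  -- Every prime factor of `N₁` divides `u`, so `1 + t u` is always prime to `N₁`; modulo `N₂` the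
  -- map `t ↦ 1 + t u` is bijective. A residue `k` prime to `N` is sent to the `t` with `t ≡ k`
  -- modulo `N₁` and `1 + t u ≡ k` modulo `N₂`, which is injective.
  obtain ⟨N₁, N₂, rfl, hco, hu, hp⟩ := Nat.exists_coprime_decomposition N u hN
  have h1 : N₁ ≠ 0 := by rintro rfl; simp at hN
  have h2 : N₂ ≠ 0 := by rintro rfl; simp at hN
  obtain ⟨v, hv⟩ : ∃ v, u * v ≡ 1 [MOD N₂] := by
    rcases Nat.lt_or_ge 1 N₂ with h | h
    · obtain ⟨v, -, hv⟩ := Nat.exists_mul_mod_eq_one_of_coprime hu.symm h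
      exact ⟨v, hv.trans (Nat.mod_eq_of_lt h).symm⟩
    · obtain rfl : N₂ = 1 := by omega
      exact ⟨0, Nat.modEq_one⟩
  -- Here `k + (N₂ - 1)` replaces `k - 1`, to stay within natural numbers.
  have hkey : ∀ k t, t ≡ v * (k + (N₂ - 1)) [MOD N₂] → 1 + t * u ≡ k [MOD N₂] := by
    intro k t ht
    calc 1 + t * u ≡ 1 + (v * (k + (N₂ - 1))) * u [MOD N₂] := (ht.mul_right u).add_left 1
      _ = 1 + (u * v) * (k + (N₂ - 1)) := by ring
      _ ≡ 1 + 1 * (k + (N₂ - 1)) [MOD N₂] := (hv.mul_right _).add_left 1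
      _ = k + N₂ := by omega
      _ ≡ k [MOD N₂] := by simp
  rw [Nat.totient_eq_card_coprime]
  refine Finset.card_le_card_of_injOn
    (fun k => (Nat.chineseRemainder hco k (v * (k + (N₂ - 1))) : ℕ)) (fun k hk => ?_)
    (fun k hk k' hk' h => ?_)
  · have hk2 := (Finset.mem_filter.1 hk).2
    obtain ⟨ht1, ht2⟩ := (Nat.chineseRemainder hco k (v * (k + (N₂ - 1)))).2
    refine Finset.mem_coe.2 (Finset.mem_filter.2
      ⟨Finset.mem_range.2 (Nat.chineseRemainder_lt_mul hco _ _ h1 h2), ?_⟩)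
    refine Nat.Coprime.mul_right ?_ ?_
    · refine Nat.coprime_of_dvd fun p hp' hd hd1 => ?_
      have := (Nat.dvd_add_left ((hp p hp' hd1).mul_left _)).1 hd
      exact hp'.one_lt.ne' (Nat.dvd_one.1 this)
    · rw [Nat.Coprime, (hkey _ _ ht2).gcd_eq]
      exact (hk2.symm.coprime_mul_left_right)
  · obtain ⟨ht1, ht2⟩ := (Nat.chineseRemainder hco k (v * (k + (N₂ - 1)))).2
    obtain ⟨ht1', ht2'⟩ := (Nat.chineseRemainder hco k' (v * (k' + (N₂ - 1)))).2
    simp only at h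
    rw [← h] at ht1' ht2'
    have e1 : k ≡ k' [MOD N₁] := ht1.symm.trans ht1'
    have e2 : k ≡ k' [MOD N₂] := (hkey _ _ ht2).symm.trans (hkey _ _ ht2')
    exact ((Nat.modEq_and_modEq_iff_modEq_mul hco).1 ⟨e1, e2⟩).eq_of_lt_of_lt
      (Finset.mem_range.1 (Finset.mem_filter.1 hk).1)
      (Finset.mem_range.1 (Finset.mem_filter.1 hk').1)

/-- Simultaneous Diophantine approximation of `a / N`. -/
theorem exists_mul_sub_small {d : ℕ} (N M : ℕ) (hM0 : 0 < M) (hM : M ^ d < N) (a : Fin d → ℤ) :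
    ∃ (u : ℕ) (b : Fin d → ℤ), 0 < u ∧ u < N ∧ (∀ l, b l ≡ u * a l [ZMOD N]) ∧
      ∀ l, |b l| * M < N := by
  have hN : (0 : ℤ) < N := by
    have : 0 < N := by omega
    exact_mod_cast this
  have hM0' : (0 : ℤ) < M := by exact_mod_cast hM0
  set r : ℕ → Fin d → ℤ := fun t l => (t * a l) % N with hr
  have hcell : ∀ t l, (r t l * M / N).toNat < M := fun t l => by
    have h1 : r t l * M / N < M :=
      Int.ediv_lt_of_lt_mul hN (by
        rw [mul_comm]
        exact mul_lt_mul_of_pos_left (Int.emod_lt_of_pos _ hN) hM0')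
    omega
  -- Pigeonhole: the `N` points `t a` modulo `N` fall into `M ^ d < N` cubes of side `N / M`. The
  -- difference of two values of `t` sharing a cube is `u`.
  obtain ⟨t₁, h1, t₂, h2, hne, heq⟩ := Finset.exists_ne_map_eq_of_card_lt_of_maps_to
    (s := Finset.range N) (t := (Finset.univ : Finset (Fin d → Fin M)))
    (by simpa using hM) (f := fun t l => ⟨(r t l * M / N).toNat, hcell t l⟩)
    (fun t _ => Finset.mem_coe.2 (Finset.mem_univ _))
  have hclose : ∀ t t' l, (r t l * M / N).toNat = (r t' l * M / N).toNat →
      |r t' l - r t l| * M < N := by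
    intro t t' l h
    have hnn : ∀ t, 0 ≤ r t l * M / N := fun t =>
      Int.ediv_nonneg (mul_nonneg (Int.emod_nonneg _ hN.ne') hM0'.le) hN.le
    have h3 := hnn t
    have h4 := hnn t'
    have h5 : r t l * M / N = r t' l * M / N := by omega
    have e1 := Int.mul_ediv_add_emod (r t l * M) N
    have e2 := Int.mul_ediv_add_emod (r t' l * M) N
    rw [h5] at e1
    have f1 := Int.emod_nonneg (r t l * M) hN.ne'
    have f2 := Int.emod_nonneg (r t' l * M) hN.ne'
    have g1 := Int.emod_lt_of_pos (r t l * M) hN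
    have g2 := Int.emod_lt_of_pos (r t' l * M) hN
    rw [← abs_of_pos hM0', ← abs_mul, sub_mul, abs_lt]
    constructor <;> linarith
  have hmod : ∀ t t' l, t ≤ t' → r t' l - r t l ≡ ((t' - t : ℕ) : ℤ) * a l [ZMOD N] := by
    intro t t' l h
    rw [Nat.cast_sub h, sub_mul]
    exact (Int.mod_modEq _ _).sub (Int.mod_modEq _ _)
  have heq' : ∀ l, (r t₁ l * M / N).toNat = (r t₂ l * M / N).toNat := fun l =>
    congrArg Fin.val (congrFun heq l)
  have h1' := Finset.mem_range.1 h1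
  have h2' := Finset.mem_range.1 h2
  rcases Nat.lt_or_gt_of_ne hne with h | h
  · exact ⟨t₂ - t₁, fun l => r t₂ l - r t₁ l, by omega, by omega, fun l => hmod _ _ l h.le,
      fun l => hclose _ _ l (heq' l)⟩
  · exact ⟨t₁ - t₂, fun l => r t₁ l - r t₂ l, by omega, by omega, fun l => hmod _ _ l h.le,
      fun l => hclose _ _ l (heq' l).symm⟩

/-! ## Minors -/

namespace Matrix

/-- A trivial kernel means that the rows span, so a basis can be selected among them. Injectivity of
`f` later ensures that no edge is counted twice in a degree. -/
theorem exists_det_submatrix_ne_zero {K μ ν : Type*} [Field K] [Fintype μ] [Fintype ν]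
    [DecidableEq ν] (A : Matrix μ ν K) (hA : ∀ u, A *ᵥ u = 0 → u = 0) :
    ∃ f : ν → μ, Function.Injective f ∧ (A.submatrix f id).det ≠ 0 := by
  have hspan : Submodule.span K (Set.range A) = ⊤ := by
    have hr : A.rank = Fintype.card ν := by
      rw [Matrix.rank, LinearMap.finrank_range_of_inj, Module.finrank_fintype_fun_eq_card]
      rw [← LinearMap.ker_eq_bot, LinearMap.ker_eq_bot']
      exact hA
    rw [Matrix.rank_eq_finrank_span_row] at hr
    refine Submodule.eq_top_of_finrank_eq ?_
    rw [Module.finrank_fintype_fun_eq_card, ← hr]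
    rfl
  obtain ⟨κ, f, hf, hs, hli⟩ := exists_linearIndependent' K (A : μ → ν → K)
  have : Fintype κ := Fintype.ofInjective f hf
  rw [hspan] at hs
  have hcard : Fintype.card ν = Fintype.card κ := by
    rw [← Module.finrank_fintype_fun_eq_card (R := K) (η := ν),
      Module.finrank_eq_card_basis (Module.Basis.mk hli hs.ge)]
  obtain ⟨e⟩ := Fintype.card_eq.1 hcard
  refine ⟨f ∘ e, hf.comp e.injective, ?_⟩
  have h2 : LinearIndependent K (A.submatrix (f ∘ e) id).row :=
    hli.comp e e.injective
  rw [Matrix.linearIndependent_rows_iff_isUnit, Matrix.isUnit_iff_isUnit_det] at h2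
  exact h2.ne_zero

theorem natDegree_det_le {R ν : Type*} [CommRing R] [Fintype ν] [DecidableEq ν]
    (A : Matrix ν ν (Polynomial R)) (δ : ν → ℕ) (h : ∀ i j, (A i j).natDegree ≤ δ i) :
    A.det.natDegree ≤ ∑ i, δ i := by
  rw [Matrix.det_apply]
  refine Polynomial.natDegree_sum_le_of_forall_le _ _ fun σ _ => ?_
  refine (Polynomial.natDegree_smul_le _ _).trans ?_
  refine (Polynomial.natDegree_prod_le _ _).trans ?_
  rw [← Equiv.sum_comp σ δ]
  exact Finset.sum_le_sum fun i _ => h _ _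

end Matrix

namespace ColoredGraph

open RatRAM Matrix Polynomial

variable {d n m : ℕ}

/-! ## Degenerate torsion points -/

/-- The linear equations for the motions with character `ω`. -/
noncomputable def rigidityMatrix (G : ColoredGraph d n m) (x : Fin m → Fin d → ℚ)
    (ω : Fin d → ℂˣ) : Matrix (Fin m) (Fin n × Fin d) ℂ :=
  Matrix.of fun e y => (x e y.2 : ℂ) * ((if G.head e = y.1 then ((mono ω (G.color e) : ℂˣ) : ℂ) else 0)
    - (if G.tail e = y.1 then 1 else 0))

theorem degenerate_iff (G : ColoredGraph d n m) (x : Fin m → Fin d → ℚ) (ω : Fin d → ℂˣ) :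
    G.Degenerate x ω ↔ ∃ u ≠ 0, G.rigidityMatrix x ω *ᵥ u = 0 := by
  have key : ∀ (u : Fin n → Fin d → ℂ) e, (G.rigidityMatrix x ω *ᵥ fun y => u y.1 y.2) e =
      ∑ k, (x e k : ℂ) *
        ((mono ω (G.color e) : ℂˣ) * u (G.head e) k - u (G.tail e) k) := by
    intro u e
    simp only [mulVec, dotProduct, rigidityMatrix, of_apply, Fintype.sum_prod_type_right]
    refine Finset.sum_congr rfl fun k _ => ?_
    simp only [mul_assoc, sub_mul, ite_mul, zero_mul, one_mul, ← Finset.mul_sum,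
      Finset.sum_sub_distrib, Finset.sum_ite_eq, Finset.mem_univ, if_true]
  constructor
  · rintro ⟨u, hu, h⟩
    refine ⟨fun y => u y.1 y.2, fun h0 => hu ?_, ?_⟩
    · ext i k
      exact congrFun h0 (i, k)
    · ext e
      rw [key]
      exact h e
  · rintro ⟨u, hu, h⟩
    refine ⟨fun i k => u (i, k), fun h0 => hu ?_, fun e => ?_⟩
    · ext ⟨i, k⟩
      exact congrFun (congrFun h0 i) k
    · rw [← key (fun i k => u (i, k))]
      exact congrFun h e

theorem det_eq_zero_of_degenerate {G : ColoredGraph d n m} {x : Fin m → Fin d → ℚ}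
    {ω : Fin d → ℂˣ} (h : G.Degenerate x ω) (f : Fin n × Fin d → Fin m) :
    ((G.rigidityMatrix x ω).submatrix f id).det = 0 := by
  obtain ⟨u, hu, hA⟩ := (G.degenerate_iff x ω).1 h
  refine Matrix.exists_mulVec_eq_zero_iff.1 ⟨u, hu, ?_⟩
  ext y
  exact congrFun hA (f y)

theorem exists_det_ne_zero_of_not_degenerate {G : ColoredGraph d n m} {x : Fin m → Fin d → ℚ}
    {ω : Fin d → ℂˣ} (h : ¬ G.Degenerate x ω) : ∃ f : Fin n × Fin d → Fin m,
      Function.Injective f ∧ ((G.rigidityMatrix x ω).submatrix f id).det ≠ 0 := by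
  refine Matrix.exists_det_submatrix_ne_zero _ fun u hu => ?_
  by_contra h0
  exact h ((G.degenerate_iff x ω).2 ⟨u, h0, hu⟩)

theorem mono_zpow (z : ℂˣ) (a g : Fin d → ℤ) : mono (fun l => z ^ a l) g = z ^ (a ⬝ᵥ g) := by
  have key : ∀ s : Finset (Fin d), ∏ l ∈ s, z ^ (a l * g l) = z ^ ∑ l ∈ s, a l * g l := by
    intro s
    induction s using Finset.induction_on with
    | empty => simp
    | insert l s hl ih => rw [Finset.prod_insert hl, Finset.sum_insert hl, ih, ← _root_.zpow_add]
  simp only [mono, dotProduct, ← _root_.zpow_mul, key]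

theorem mono_mul (ω ω' : Fin d → ℂˣ) (g : Fin d → ℤ) : mono (ω * ω') g = mono ω g * mono ω' g := by
  simp [mono, mul_zpow, Finset.prod_mul_distrib]

/-- Degeneracy is invariant under Galois conjugation. -/
theorem Degenerate.galois {G : ColoredGraph d n m} {x : Fin m → Fin d → ℚ} {N : ℕ} (hN : 0 < N)
    {ζ : ℂˣ} (hζ : IsPrimitiveRoot ζ N) {a : Fin d → ℤ} (h : G.Degenerate x fun l => ζ ^ a l)
    {k : ℕ} (hk : k.Coprime N) : G.Degenerate x fun l => (ζ ^ k) ^ a l := by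
  by_contra hc
  obtain ⟨f, -, hf⟩ := exists_det_ne_zero_of_not_degenerate hc
  -- At `N`-th roots of unity exponents matter only modulo `N`, so the minor is the value of one
  -- rational polynomial.
  set R : Matrix (Fin m) (Fin n × Fin d) ℚ[X] := Matrix.of fun e y =>
    C (x e y.2) * ((if G.head e = y.1 then X ^ ((a ⬝ᵥ G.color e) % N).toNat else 0) -
      (if G.tail e = y.1 then 1 else 0)) with hR
  have hN' : (N : ℤ) ≠ 0 := by exact_mod_cast hN.ne'
  have hmap : ∀ z : ℂˣ, z ^ N = 1 →
      ((G.rigidityMatrix x fun l => z ^ a l).submatrix f id) =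
        (R.submatrix f id).map (aeval (z : ℂ)) := by
    intro z hz
    ext i y
    have h1 : ((mono (fun l => z ^ a l) (G.color (f i)) : ℂˣ) : ℂ) =
        (z : ℂ) ^ ((a ⬝ᵥ G.color (f i)) % N).toNat := by
      rw [mono_zpow, ← Units.val_pow_eq_pow_val, ← zpow_natCast,
        Int.toNat_of_nonneg (Int.emod_nonneg _ hN')]
      congr 1
      exact zpow_congr hz (Int.mod_modEq _ _).symm
    simp only [rigidityMatrix, hR, submatrix_apply, of_apply, map_apply, map_mul, map_sub, h1,
      aeval_C, id]
    congr 1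
    split_ifs <;> simp
  have hdet : ∀ z : ℂˣ, z ^ N = 1 →
      ((G.rigidityMatrix x fun l => z ^ a l).submatrix f id).det =
        aeval (z : ℂ) (R.submatrix f id).det := by
    intro z hz
    rw [hmap z hz, AlgHom.map_det]
    rfl
  have h0 := det_eq_zero_of_degenerate h f
  rw [hdet ζ hζ.pow_eq_one] at h0
  have hζ' : IsPrimitiveRoot (ζ : ℂ) N := IsPrimitiveRoot.coe_units_iff.2 hζ
  have hζk : IsPrimitiveRoot ((ζ ^ k : ℂˣ) : ℂ) N :=
    IsPrimitiveRoot.coe_units_iff.2 (hζ.pow_of_coprime k hk)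
  refine hf ?_
  rw [hdet _ (by rw [← pow_mul, mul_comm, pow_mul, hζ.pow_eq_one, one_pow])]
  -- All primitive `N`-th roots of unity share one minimal polynomial, the cyclotomic one.
  have hdvd := minpoly.dvd ℚ (ζ : ℂ) h0
  rw [← cyclotomic_eq_minpoly_rat hζ' hN, cyclotomic_eq_minpoly_rat hζk hN] at hdvd
  obtain ⟨q, hq⟩ := hdvd
  rw [hq, map_mul, minpoly.aeval, zero_mul]

/-- If the points `ω z ^ b` are degenerate for more values of `z` than the degree allows, then they
are degenerate for all `z`. -/
theorem degenerate_of_card {G : ColoredGraph d n m} {x : Fin m → Fin d → ℚ} (ω : Fin d → ℂˣ)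
    (b : Fin d → ℤ) (S : Finset ℂˣ) (hS : ∀ z ∈ S, G.Degenerate x fun l => ω l * z ^ b l)
    (hcard : ∑ e, (b ⬝ᵥ G.color e).natAbs < S.card) (z₀ : ℂˣ) :
    G.Degenerate x fun l => ω l * z₀ ^ b l := by
  by_contra hc
  obtain ⟨f, hfinj, hf⟩ := exists_det_ne_zero_of_not_degenerate hc
  -- The row of an edge with color `γ` is multiplied by `z` to the power `max 0 (-(b ⬝ᵥ γ))`. This
  -- clears negative exponents and leaves degree at most `|b ⬝ᵥ γ|`.
  set A : Matrix (Fin n × Fin d) (Fin n × Fin d) ℂ[X] := Matrix.of fun i y =>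
    C (x (f i) y.2 : ℂ) * ((if G.head (f i) = y.1 then
      C ((mono ω (G.color (f i)) : ℂˣ) : ℂ) * X ^ (b ⬝ᵥ G.color (f i)).toNat else 0) -
      (if G.tail (f i) = y.1 then X ^ (-(b ⬝ᵥ G.color (f i))).toNat else 0)) with hA
  have hmap : ∀ z : ℂˣ, A.map (eval (z : ℂ)) =
      Matrix.of fun i y => (z : ℂ) ^ (-(b ⬝ᵥ G.color (f i))).toNat *
        (G.rigidityMatrix x fun l => ω l * z ^ b l).submatrix f id i y := by
    intro z
    ext i y
    have h1 : (z : ℂ) ^ (-(b ⬝ᵥ G.color (f i))).toNat *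
        ((mono (fun l => ω l * z ^ b l) (G.color (f i)) : ℂˣ) : ℂ) =
        ((mono ω (G.color (f i)) : ℂˣ) : ℂ) * (z : ℂ) ^ (b ⬝ᵥ G.color (f i)).toNat := by
      have h2 : mono (fun l => ω l * z ^ b l) (G.color (f i)) =
          mono ω (G.color (f i)) * z ^ (b ⬝ᵥ G.color (f i)) := by
        rw [← mono_zpow]
        exact mono_mul _ _ _
      have h3 : z ^ (-(b ⬝ᵥ G.color (f i))).toNat * z ^ (b ⬝ᵥ G.color (f i)) =
          z ^ (b ⬝ᵥ G.color (f i)).toNat := by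
        rw [← zpow_natCast, ← zpow_natCast, ← _root_.zpow_add]
        congr 1
        omega
      rw [h2, ← Units.val_pow_eq_pow_val, ← Units.val_pow_eq_pow_val, ← h3]
      push_cast
      ring
    simp only [rigidityMatrix, hA, submatrix_apply, of_apply, map_apply, eval_mul, eval_sub, eval_C,
      id]
    by_cases hh : G.head (f i) = y.1 <;> by_cases ht : G.tail (f i) = y.1 <;>
      simp only [hh, ht, if_true, if_false, eval_mul, eval_pow, eval_C, eval_X, eval_zero]
    · linear_combination -(x (f i) y.2 : ℂ) * h1
    · linear_combination -(x (f i) y.2 : ℂ) * h1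
    · ring
    · ring
  have hdet : ∀ z : ℂˣ, eval (z : ℂ) A.det =
      (∏ i, (z : ℂ) ^ (-(b ⬝ᵥ G.color (f i))).toNat) *
        ((G.rigidityMatrix x fun l => ω l * z ^ b l).submatrix f id).det := by
    intro z
    rw [← Matrix.det_mul_column, ← hmap z]
    exact (RingHom.map_det (evalRingHom (z : ℂ)) A)
  have hne : A.det ≠ 0 := by
    intro h0
    have h1 := hdet z₀
    rw [h0, eval_zero] at h1
    refine mul_ne_zero ?_ hf h1.symm
    exact Finset.prod_ne_zero_iff.2 fun i _ => pow_ne_zero _ z₀.ne_zero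
  have hdeg : A.det.natDegree ≤ ∑ e, (b ⬝ᵥ G.color e).natAbs := by
    refine (Matrix.natDegree_det_le A (fun i => (b ⬝ᵥ G.color (f i)).natAbs) fun i y => ?_).trans ?_
    · rw [hA, of_apply]
      refine (natDegree_C_mul_le _ _).trans ((natDegree_sub_le _ _).trans (max_le ?_ ?_))
      · by_cases hh : G.head (f i) = y.1
        · rw [if_pos hh]
          exact (natDegree_C_mul_X_pow_le _ _).trans (by omega)
        · simp [if_neg hh]
      · by_cases ht : G.tail (f i) = y.1
        · rw [if_pos ht, natDegree_X_pow]
          omega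
        · simp [if_neg ht]
    · rw [← Finset.sum_image (f := fun e => (b ⬝ᵥ G.color e).natAbs) (g := f) (s := Finset.univ)
        (fun i _ j _ h => hfinj h)]
      exact Finset.sum_le_sum_of_subset (Finset.subset_univ _)
  have hroots : S.card ≤ A.det.natDegree := by
    rw [← Finset.card_map ⟨(Units.val : ℂˣ → ℂ), Units.val_injective⟩]
    refine card_le_degree_of_subset_roots fun r hr => ?_
    obtain ⟨z, hz, rfl⟩ := Finset.mem_map.1 hr
    rw [mem_roots hne, IsRoot.def]
    refine (hdet z).trans ?_
    rw [det_eq_zero_of_degenerate (hS z hz), mul_zero]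
  omega

end ColoredGraph

/-! ### The least order of a degenerate torsion point -/

namespace ColoredGraph

open RatRAM Matrix

variable {d n m : ℕ}

/-- Some nontrivial `N`-torsion point is degenerate. -/
def DegenerateAt (G : ColoredGraph d n m) (x : Fin m → Fin d → ℚ) (N : ℕ) : Prop :=
  ∃ ω : Fin d → ℂˣ, (∀ l, ω l ^ N = 1) ∧ ω ≠ 1 ∧ G.Degenerate x ω

theorem exists_pow_eq_unit (w : ℂˣ) {g : ℕ} (hg : 0 < g) : ∃ z : ℂˣ, z ^ g = w := by
  obtain ⟨z, hz⟩ := IsAlgClosed.exists_pow_nat_eq (w : ℂ) hg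
  have hz0 : z ≠ 0 := by
    rintro rfl
    rw [zero_pow hg.ne'] at hz
    exact w.ne_zero hz.symm
  exact ⟨Units.mk0 z hz0, Units.ext (by simpa using hz)⟩

theorem exists_primitiveRoot_unit {N : ℕ} (hN : N ≠ 0) : ∃ ζ : ℂˣ, IsPrimitiveRoot ζ N := by
  have h := Complex.isPrimitiveRoot_exp N hN
  exact ⟨(h.isUnit hN).unit, IsPrimitiveRoot.coe_units_iff.1 h⟩

/-- A degenerate one-parameter coset through a torsion point yields one of smaller order. -/
theorem exists_degenerateAt_lt {G : ColoredGraph d n m} {x : Fin m → Fin d → ℚ} {N : ℕ}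
    {ζ : ℂˣ} (hζ : IsPrimitiveRoot ζ N) {a : Fin d → ℤ} (hdeg : G.Degenerate x fun l => ζ ^ a l)
    (hne : (fun l => ζ ^ a l) ≠ 1) {u : ℕ} (hu : 0 < u) (huN : u < N) {b : Fin d → ℤ}
    (hb : ∀ l, b l ≡ u * a l [ZMOD N]) (hbN : ∀ l, |b l| < N - 1)
    (hcard : ∑ e, (b ⬝ᵥ G.color e).natAbs < N.totient) :
    ∃ N', 0 < N' ∧ N' < N ∧ G.DegenerateAt x N' := by
  have hN : 0 < N := hu.trans huN
  -- In this case `u a ≡ 0`, so the given point is itself `u`-torsion.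
  by_cases hb0 : b = 0
  · refine ⟨u, hu, huN, fun l => ζ ^ a l, fun l => ?_, hne, hdeg⟩
    have h1 := hb l
    rw [hb0, Pi.zero_apply] at h1
    rw [← zpow_natCast, ← _root_.zpow_mul, mul_comm, ← zpow_congr hζ.pow_eq_one h1, zpow_zero]
  have hall : ∀ z : ℂˣ, G.Degenerate x fun l => ζ ^ a l * z ^ b l := by
    classical
    refine degenerate_of_card (fun l => ζ ^ a l) b
      (((Finset.range N).filter fun t => (1 + t * u).Coprime N).image fun t => ζ ^ t) ?_ ?_
    · intro z hz
      obtain ⟨t, ht, rfl⟩ := Finset.mem_image.1 hz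
      -- Since `b ≡ u a`, the point `ζ^a (ζ^t)^b` is the conjugate `(ζ^(1 + t u))^a`.
      have h1 := hdeg.galois hN hζ (Finset.mem_filter.1 ht).2
      convert h1 using 2 with l
      rw [← zpow_natCast, ← zpow_natCast, ← _root_.zpow_mul, ← _root_.zpow_mul,
        ← _root_.zpow_add]
      refine zpow_congr hζ.pow_eq_one ?_
      have h2 : ((1 + t * u : ℕ) : ℤ) * a l = a l + t * (u * a l) := by push_cast; ring
      rw [h2]
      exact ((hb l).mul_left _).add_left _
    · refine hcard.trans_le ((Nat.totient_le_card_coprime_one_add_mul N u hN).trans ?_)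
      rw [Finset.card_image_of_injOn]
      intro s hs t ht h
      exact hζ.pow_inj (Finset.mem_range.1 (Finset.mem_filter.1 hs).1)
        (Finset.mem_range.1 (Finset.mem_filter.1 ht).1) h
  have hg : 0 < u.gcd N := Nat.gcd_pos_of_pos_left _ hu
  -- With the Bézout relation `g = u A + N B` for `g = gcd(u, N)`, choose `z^g = ζ^(-A)`. Then `(ζ^a
  -- z^b)^g = ζ^(a g - A b) = 1`, because `A b ≡ A u a ≡ a g`. The point is `g`-torsion, and `g ≤ u
  -- < N`.
  obtain ⟨z, hz⟩ := exists_pow_eq_unit (ζ ^ (-u.gcdA N)) hg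
  by_cases h1 : (fun l => ζ ^ a l * z ^ b l) = 1
  -- If that point is trivial, the coset is the subgroup of all `z^b`. As `b ≠ 0` has entries
  -- smaller than `N - 1`, a primitive root of order `N - 1` gives a nontrivial point on it.
  · obtain ⟨η, hη⟩ := exists_primitiveRoot_unit (N := N - 1) (by omega)
    refine ⟨N - 1, by omega, by omega, fun l => η ^ b l, fun l => ?_, fun h => ?_, ?_⟩
    · rw [← zpow_natCast, ← _root_.zpow_mul, mul_comm, _root_.zpow_mul, zpow_natCast,
        hη.pow_eq_one, _root_.one_zpow]
    · obtain ⟨l, hl⟩ := Function.ne_iff.1 hb0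
      have h2 := (hη.zpow_eq_one_iff_dvd _).1 (congrFun h l)
      have h3 := Int.le_of_dvd (abs_pos.2 hl) ((dvd_abs _ _).2 h2)
      have h4 := hbN l
      omega
    · convert hall (z * η) using 2 with l
      rw [mul_zpow, ← mul_assoc, congrFun h1 l, Pi.one_apply, one_mul]
  · refine ⟨u.gcd N, hg, (Nat.le_of_dvd hu (Nat.gcd_dvd_left u N)).trans_lt huN, _, fun l => ?_,
      h1, hall z⟩
    have h2 : (z ^ b l) ^ u.gcd N = ζ ^ (-u.gcdA N * b l) := by
      rw [← zpow_natCast, ← _root_.zpow_mul, mul_comm, _root_.zpow_mul, zpow_natCast, hz,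
        ← _root_.zpow_mul]
    rw [mul_pow, h2, ← zpow_natCast, ← _root_.zpow_mul, ← _root_.zpow_add, ← zpow_zero ζ]
    refine zpow_congr hζ.pow_eq_one ?_
    refine (((hb l).mul_left (-u.gcdA N)).add_left (a l * (u.gcd N : ℕ))).trans ?_
    rw [Nat.gcd_eq_gcd_ab, Int.modEq_zero_iff_dvd]
    exact ⟨a l * u.gcdB N, by ring⟩

theorem sum_natAbs_dotProduct_mul_le (G : ColoredGraph d n m) (b : Fin d → ℤ) {M N : ℕ}
    (hb : ∀ l, |b l| * M ≤ N) : (∑ e, (b ⬝ᵥ G.color e).natAbs) * M ≤ N * G.totalColor := by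
  rw [totalColor, Finset.sum_mul, Finset.mul_sum]
  refine Finset.sum_le_sum fun e _ => ?_
  zify
  calc |b ⬝ᵥ G.color e| * M ≤ (∑ l, |b l * G.color e l|) * M :=
        mul_le_mul_of_nonneg_right (Finset.abs_sum_le_sum_abs _ _) (by positivity)
    _ = ∑ l, |b l| * M * |G.color e l| := by
        rw [Finset.sum_mul]
        refine Finset.sum_congr rfl fun l _ => ?_
        rw [abs_mul]
        ring
    _ ≤ ∑ l, N * |G.color e l| :=
        Finset.sum_le_sum fun l _ => mul_le_mul_of_nonneg_right (hb l) (abs_nonneg _)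
    _ = N * ∑ l, |G.color e l| := by rw [Finset.mul_sum]

/-- The witness is the largest `M` with `M ^ d < N`; then `N ≤ (M + 1) ^ d`, and `M + 1 ≤ 2 * M`. -/
theorem exists_root_bounds {N : ℕ} (hd : d ≠ 0) (hN : 2 ^ d < N) :
    ∃ M, 2 ≤ M ∧ M ^ d < N ∧ N ≤ (2 * M) ^ d := by
  have hex : ∃ M, N ≤ (M + 1) ^ d := ⟨N, (Nat.le_succ N).trans (Nat.le_self_pow hd _)⟩
  have h2 : 2 ≤ Nat.find hex := by
    by_contra! h
    have h1 := (Nat.find_spec hex).trans (Nat.pow_le_pow_left (by omega : _ ≤ 2) d)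
    omega
  refine ⟨Nat.find hex, h2, ?_, (Nat.find_spec hex).trans (Nat.pow_le_pow_left (by omega) d)⟩
  have h1 := Nat.find_min hex (m := Nat.find hex - 1) (by omega)
  rwa [Nat.sub_add_cancel (by omega), not_le] at h1

/-- The smallest order of a degenerate nontrivial torsion point is polynomially bounded. -/
theorem exists_degenerateAt_le (d : ℕ) : ∃ C k : ℕ, ∀ {n m : ℕ} (G : ColoredGraph d n m)
    (x : Fin m → Fin d → ℚ), (∃ N, 0 < N ∧ G.DegenerateAt x N) →
    ∃ N, 0 < N ∧ N ≤ C * (G.totalColor + 1) ^ k ∧ G.DegenerateAt x N := by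
  classical
  set B : ℕ := (2 ^ (2 * d)) ^ (2 ^ (2 * d)) with hB
  -- `B` is the constant of the totient bound with exponent `2 d`, and `4 ^ d` comes from squaring
  -- `N ≤ (2 M)^d`. The summand `2 ^ d` ensures `M ≥ 2`.
  refine ⟨2 ^ d + 4 + 4 ^ d * B, 2 * d, fun {n m} G x hex => ?_⟩
  obtain ⟨hN, hND⟩ := Nat.find_spec hex
  have hmin : ∀ N', 0 < N' → N' < Nat.find hex → ¬ G.DegenerateAt x N' := fun N' h0 h h' =>
    Nat.find_min hex h ⟨h0, h'⟩
  refine ⟨Nat.find hex, hN, ?_, hND⟩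
  generalize Nat.find hex = N at *
  by_contra! hlt
  set T := G.totalColor with hT
  obtain ⟨ω, hω, hω1, hdeg⟩ := hND
  have hd : d ≠ 0 := by
    rintro rfl
    exact hω1 (Subsingleton.elim _ _)
  have hT1 : 1 ≤ (T + 1) ^ (2 * d) := Nat.one_le_pow _ _ (by omega)
  have hTT : T ^ (2 * d) ≤ (T + 1) ^ (2 * d) := Nat.pow_le_pow_left (by omega) _
  have hN1 : 2 ^ d < N := by nlinarith [Nat.zero_le (4 ^ d * B)]
  have hN3 : 4 ^ d * B * T ^ (2 * d) < N := by
    refine lt_of_le_of_lt ?_ hlt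
    exact Nat.mul_le_mul (Nat.le_add_left _ _) hTT
  obtain ⟨M, hM2, hMN, hNM⟩ := exists_root_bounds hd hN1
  have : NeZero N := ⟨hN.ne'⟩
  obtain ⟨ζ, hζ⟩ := exists_primitiveRoot_unit hN.ne'
  have hpow : ∀ l, ∃ i : ℕ, ζ ^ i = ω l := fun l => by
    obtain ⟨i, -, hi⟩ := (IsPrimitiveRoot.coe_units_iff.2 hζ).eq_pow_of_pow_eq_one
      (ξ := (ω l : ℂ)) (by rw [← Units.val_pow_eq_pow_val, hω l, Units.val_one])
    exact ⟨i, Units.ext (by simpa using hi)⟩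
  choose a' ha' using hpow
  obtain rfl : (fun l => ζ ^ ((a' l : ℕ) : ℤ)) = ω := by
    ext l
    rw [zpow_natCast, ha']
  obtain ⟨u, b, hu, huN, hb, hbM⟩ := exists_mul_sub_small N M (by omega) hMN fun l => (a' l : ℤ)
  -- Raised to the power `2 d`, the right side is at least `N^2 / 4^d` times `N^(2d - 1) / B`. This
  -- exceeds `(T N)^(2d)` as soon as `N > 4^d B T^(2d)`. A totient bound with exponent `d` would
  -- leave no power of `N` to spare.
  have hlarge : T * N < M * N.totient := by
    have h1 := Nat.pow_le_mul_totient_pow (2 * d) N hN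
    have h2 : N ^ 2 ≤ 4 ^ d * M ^ (2 * d) := by
      calc N ^ 2 ≤ ((2 * M) ^ d) ^ 2 := Nat.pow_le_pow_left hNM 2
        _ = 4 ^ d * M ^ (2 * d) := by
          rw [show (4 : ℕ) = 2 ^ 2 by norm_num, mul_pow, mul_pow, ← pow_mul, ← pow_mul, ← pow_mul,
            mul_comm d 2]
    refine lt_of_pow_lt_pow_left₀ (2 * d) (Nat.zero_le _) ?_
    have hB0 : 0 < 4 ^ d * B := by positivity
    refine lt_of_mul_lt_mul_left (a := 4 ^ d * B * N) ?_ (Nat.zero_le _)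
    calc 4 ^ d * B * N * (T * N) ^ (2 * d)
        = (4 ^ d * B * T ^ (2 * d)) * (N * N ^ (2 * d)) := by ring
      _ < N * (N * N ^ (2 * d)) := Nat.mul_lt_mul_of_pos_right hN3 (by positivity)
      _ = N ^ 2 * N ^ (2 * d) := by ring
      _ ≤ (4 ^ d * M ^ (2 * d)) * (B * N * N.totient ^ (2 * d)) := Nat.mul_le_mul h2 h1
      _ = 4 ^ d * B * N * (M * N.totient) ^ (2 * d) := by ring
  have hcard : ∑ e, (b ⬝ᵥ G.color e).natAbs < N.totient := by
    refine lt_of_mul_lt_mul_right (a := M) ?_ (Nat.zero_le _)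
    refine (G.sum_natAbs_dotProduct_mul_le b fun l => (hbM l).le).trans_lt ?_
    rw [mul_comm N, mul_comm _ M]
    exact hlarge
  have hN2 : 2 < N := by
    have := Nat.le_self_pow hd 2
    omega
  obtain ⟨N', h0, h1, h2⟩ := exists_degenerateAt_lt hζ hdeg hω1 hu huN hb (fun l => by
    have h3 := hbM l
    have h4 : |b l| * 2 ≤ |b l| * M :=
      mul_le_mul_of_nonneg_left (by exact_mod_cast hM2) (abs_nonneg _)
    omega) hcard
  exact hmin N' h0 h1 h2

end ColoredGraph

/-! ### The decision procedure -/

theorem theorem1p4 (d : ℕ) :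
    ∃ (P : RatRAM.Prog) (C k : ℕ),
      ∀ (n m : ℕ) (G : ColoredGraph d n m) (p : Fin n → Fin d → ℚ)
        (L : Matrix (Fin d) (Fin d) ℚ),
        G.IsInfRigid (fun i j => (p i j : ℝ)) (L.map (fun q => (q : ℝ))) →
        ∃ (t : ℕ) (s : RatRAM.Store),
          RatRAM.HaltsIn P (RatRAM.input G p L) t s ∧
          t ≤ C * (m + n + G.totalColor + 1) ^ k ∧
          (G.IsInfUltrarigid (fun i j => (p i j : ℝ)) (L.map (fun q => (q : ℝ))) →
            s.reg 0 = 1) ∧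
          (¬ G.IsInfUltrarigid (fun i j => (p i j : ℝ)) (L.map (fun q => (q : ℝ))) →
            s.reg 0 = 0) := by
  obtain ⟨C₀, k₀, hbound⟩ := ColoredGraph.exists_degenerateAt_le d
  obtain ⟨P, C, k, hP⟩ := RatRAM.exists_prog d C₀ k₀
  refine ⟨P, C, k, fun n m G p L hrig => ?_⟩
  obtain ⟨t, s, hhalt, ht, h1, h0⟩ := hP n m G p L
  -- The edge vectors are rational, as the Galois argument requires.
  have hcast : RatRAM.edgeDiff G (fun i j => (p i j : ℝ)) (L.map fun q => (q : ℝ)) =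
      fun e k => ((RatRAM.edgeDiff G p L e k : ℚ) : ℝ) := by
    ext e k
    simp [RatRAM.edgeDiff]
  have htriv : ∀ N, 0 < N → (RatRAM.TrivialKernel G p L N ↔ ¬ G.DegenerateAt (RatRAM.edgeDiff G p L) N) := by
    intro N hN
    have : NeZero N := ⟨hN.ne'⟩
    rw [ColoredGraph.trivialKernel_iff, hcast, ColoredGraph.periodicKernelTrivial_iff,
      ColoredGraph.DegenerateAt]
    push Not
    rfl
  have hultra : G.IsInfUltrarigid (fun i j => (p i j : ℝ)) (L.map fun q => (q : ℝ)) ↔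
      ∀ N, 0 < N → N ≤ C₀ * (RatRAM.sqColor G + 1) ^ k₀ → RatRAM.TrivialKernel G p L N := by
    rw [ColoredGraph.isInfUltrarigid_iff G _ _ hrig]
    constructor
    · intro h N hN _
      have : NeZero N := ⟨hN.ne'⟩
      exact (ColoredGraph.trivialKernel_iff G p L N).2 (h N)
    · intro h N hN
      rw [← ColoredGraph.trivialKernel_iff, htriv N (NeZero.pos N)]
      intro hdeg
      -- A failure at any modulus forces one within the tested range, since `D` is at most the sum
      -- of squares used by the program.
      obtain ⟨N', h0', hle, hdeg'⟩ := hbound G _ ⟨N, NeZero.pos N, hdeg⟩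
      refine (htriv N' h0').1 (h N' h0' (hle.trans ?_)) hdeg'
      exact Nat.mul_le_mul_left _
        (Nat.pow_le_pow_left (Nat.add_le_add_right (RatRAM.totalColor_le G) 1) _)
  exact ⟨t, s, hhalt, ht, fun h => h1 (hultra.1 h), fun h => h0 (mt hultra.2 h)⟩
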